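/- **Setting.** Let $\Omega$ be the set of real sequences $z=(z_i)_{i\ge1}$ with $z_1\ge z_2\ge\dots\ge0$ and $0<|z|:=\sum_i z_i<\infty$, and let $\Omega_1=\{z\in\Omega:|z|=1\}$, both with the product topology; $B(E)$ denotes the bounded Borel functions on $E$. For $z\in\Omega$, $M_{ij}z$ is obtained by merging $z_i,z_j$ into $z_i+z_j$ and reordering, and $S_i^{(y)}z$ by splitting $z_i$ into $y$ and $z_i-y$ and reordering. For kernels $K,F$ on $(0,\infty)^2$ put $$L\Phi(z)=\tfrac12\sum_{i\ne j,\ z_iz_j>0}K(z_i,z_j)\big(\Phi(M_{ij}z)-\Phi(z)\big)+\tfrac12\sum_i\int_0^{z_i}F(y,z_i-y)\big(\Phi(S_i^{(y)}z)-\Phi(z)\big)\,dy ,$$ and, for kernels $K_1,F_1$ on $\{x,y>0,\ x+y\le1\}$ and functions $\Phi$ on $\Omega_1$, $$L_1^\sharp\Phi(x)=\tfrac12\sum_{i\ne j,\ x_ix_j>0}K_1(x_i,x_j)\big(\Phi(M_{ij}x)-\Phi(x)\big)+\tfrac12\sum_i x_i\int_0^1F_1(ux_i,(1-u)x_i)\big(\Phi(S_i^{(ux_i)}x)-\Phi(x)\big)\,du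 .$$ A measurable adapted process $Z=\{Z(t):t\ge0\}$ with values in $E$ on a filtered probability space is *generated by* an operator $\mathcal L$ if $\Phi(Z(t))-\Phi(Z(0))-\int_0^t\mathcal L\Phi(Z(u))\,du$ is a martingale for every $\Phi\in B(E)$ with $\mathcal L\Phi\in B(E)$. The $k$th correlation measure of $\Xi(Z):=\sum_i\mathbf 1_{\{Z_i>0\}}\delta_{Z_i}$ is the mean measure on $(0,\infty)^k$ of $\sum\delta_{(Z_{i_1},\dots,Z_{i_k})}$, summed over $k$-tuples of distinct indices with $Z_{i_1},\dots,Z_{i_k}>0$. Let $B^k_{+,c}$ be the set of nonnegative bounded Borel functions on $(0,\infty)^k$ with compact support ($B^0_{+,c}$: nonnegative constants), and let $\lambda\ge0$. A family of measures $c_k(t,\cdot)$ on $(0,\infty)^k$ ($t\ge0$, $k\ge1$) is *admissible* (with exponent $\lambda$) if every $c_k(t,\cdot)$ is locally finite and, for all $k\ge1$, $f\in B^k_{+,c}$, $g\in B^{k-1}_{+,c}$ and $1\le l\le k$, the following functions of $t$ are locally integrable on $[0,\infty)$: * $\int f\,dc_k(t)$; * $\int z_lz_{l+1}f(\mathrm{Coag}_{l}\mathbf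 z)\,c_{k+1}(t,d\mathbf z)$; * $\int z_l(z_l^{1+\lambda}\vee1)\,g(z_1,\dots,z_{l-1},z_{l+1},\dots,z_k)\,c_k(t,d\mathbf z)$. Here $\mathrm{Coag}_l\mathbf z=(z_1,\dots,z_{l-1},z_l+z_{l+1},z_{l+2},\dots,z_{k+1})$. The family *solves weakly the hierarchy with kernels $K,F$* if for all $t>0$, $k\ge1$, $f\in B^k_{+,c}$ all the integrals below are finite and $$\begin{aligned}\int f\,dc_k(t)-\int f\,dc_k(0)={}&\tfrac12\sum_{l=1}^k\int_0^t\!ds\!\int K(z_l,z_{l+1})f(\mathrm{Coag}_l\mathbf z)\,c_{k+1}(s,d\mathbf z)-\tfrac12\sum_{l=1}^k\int_0^t\!ds\!\int\!\int_0^{z_l}\!F(y,z_l-y)\,dy\,f(\mathbf z)\,c_k(s,d\mathbf z)\\&-\sum_{l=1}^k\int_0^t\!ds\!\int K(z_l,z_{l+1})f(z_1,\dots,z_l,z_{l+2},\dots,z_{k+1})\,c_{k+1}(s,d\mathbf z)\\&+\sum_{l=1}^k\int_0^t\!ds\!\int\!\int_0^{z_l}\!F(y,z_l-y)f(z_1,\dots,z_{l-1},y,z_{l+1},\dots,z_k)\,dy\,c_k(s,d\mathbf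 z)\\&-\sum_{1\le l<m\le k}\int_0^t\!ds\!\int K(z_l,z_m)f(\mathbf z)\,c_k(s,d\mathbf z)\\&+\sum_{1\le l<m\le k}\int_0^t\!ds\!\int\!\int_0^{z_l}\!F(y,z_l-y)f(\mathrm{Frag}^{(y)}_{l,m}\mathbf z)\,dy\,c_{k-1}(s,d\mathbf z),\end{aligned}$$ where $\mathrm{Frag}^{(y)}_{l,m}\mathbf z=(z_1,\dots,z_{l-1},y,z_{l+1},\dots,z_{m-1},z_l-y,z_m,\dots,z_{k-1})$ (for $k=1$ the last two sums are empty). **Theorem 3.2.** (i) Let $\lambda\ge0$ and let $\hat H,\check H$ be symmetric nonnegative Borel functions on $(0,\infty)^2$, homogeneous of degree $\lambda$, with $0<\sup_{0<u<1}\hat H(u,1-u)<\infty$ and $0<\int_0^1\check H(u,1-u)\,du<\infty$. Put $K(x,y)=xy\hat H(x,y)$ and $F(x,y)=(x+y)\check H(x,y)$. Let $\{Z(t)\}$ be a process on $\Omega$ generated by $L$ with $E[|Z(0)|^k]<\infty$ for all $k\in\mathbb N$, and let $r_k(t,\cdot)$ be the $k$th correlation measure of $\Xi(Z(t))$. Then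 $\{r_k(t,\cdot)\}$ is admissible with exponent $\lambda$ and solves weakly the hierarchy with kernels $K,F$. (ii) Let $\hat Q,\check Q$ be symmetric nonnegative bounded Borel functions on $\{(x,y):x,y>0,\ x+y\le1\}$, and put $K_1(x,y)=xy\hat Q(x,y)$, $F_1(x,y)=(x+y)\check Q(x,y)$. Let $\{X(t)\}$ be a process on $\Omega_1$ generated by $L_1^\sharp$, and let $q_k(t,\cdot)$ be the $k$th correlation measure of $\Xi(X(t))$. Then $\{q_k(t,\cdot)\}$ is admissible with every exponent $\lambda\ge0$ and solves weakly the hierarchy with kernels $K_1,F_1$. -/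

import Mathlib

open MeasureTheory ProbabilityTheory Set
open scoped NNReal ENNReal

noncomputable section

namespace CoagFrag

/-! ## State spaces -/

/-- Nonincreasing, nonnegative, summable sequences `z 0 ≥ z 1 ≥ ⋯ ≥ 0`. -/
structure IsSizeSeq (z : ℕ → ℝ) : Prop where
  antitone : Antitone z
  nonneg : ∀ i, 0 ≤ z i
  summable : Summable z

/-- Size sequences whose total mass `∑ z i` lies in `I`, with the topology and the Borel structure
induced by the product `ℝ^ℕ`. -/
abbrev Cone (I : Set ℝ) : Type := {z : ℕ → ℝ // IsSizeSeq z ∧ ∑' i, z i ∈ I}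

/-- `Ω`: total mass in `(0, ∞)`. -/
abbrev Omega : Type := Cone (Ioi 0)

/-- `Ω₁`: total mass `1`. -/
abbrev OmegaOne : Type := Cone {1}

/-- The total mass `|z| = ∑ z i`. -/
def mass {I : Set ℝ} (z : Cone I) : ℝ := ∑' i, z.1 i

/-! ## Merging and splitting, followed by reordering -/

/-- Delete the `i`-th entry of a sequence. -/
def removeAt (i : ℕ) (z : ℕ → ℝ) : ℕ → ℝ := fun n => if n < i then z n else z (n + 1)

/-- Insert the value `v` into a nonincreasing sequence, at the place that keeps it nonincreasing. -/
def insertSorted (v : ℝ) (z : ℕ → ℝ) : ℕ → ℝ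
  | 0 => max v (z 0)
  | n + 1 => max (min v (z n)) (z (n + 1))

theorem IsSizeSeq.removeAt {z : ℕ → ℝ} (hz : IsSizeSeq z) (i : ℕ) :
    IsSizeSeq (removeAt i z) := by
  have hs : Summable (CoagFrag.removeAt i z) := by
    rw [← summable_nat_add_iff i]
    refine ((summable_nat_add_iff (i + 1)).2 hz.summable).congr fun n => ?_
    simp [CoagFrag.removeAt, add_assoc]
  refine ⟨antitone_nat_of_succ_le fun n => ?_, fun n => ?_, hs⟩
  · unfold CoagFrag.removeAt
    split_ifs <;> first | omega | exact hz.antitone (by omega)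
  · unfold CoagFrag.removeAt
    split_ifs <;> exact hz.nonneg _

theorem tsum_removeAt {z : ℕ → ℝ} (hz : IsSizeSeq z) (i : ℕ) :
    ∑' n, removeAt i z n = ∑' n, z n - z i := by
  rw [← (hz.removeAt i).summable.sum_add_tsum_nat_add i,
    ← hz.summable.sum_add_tsum_nat_add (i + 1), Finset.sum_range_succ]
  have h1 : ∑ n ∈ Finset.range i, removeAt i z n = ∑ n ∈ Finset.range i, z n :=
    Finset.sum_congr rfl fun n hn => by simp [removeAt, Finset.mem_range.1 hn]
  have h2 : ∀ n, removeAt i z (n + i) = z (n + (i + 1)) := fun n => by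
    simp [removeAt, add_assoc]
  simp only [h1, h2]
  ring

/-- `insertSorted v z` has the entries of `z` together with one further entry `v`. -/
theorem sum_insertSorted {z : ℕ → ℝ} (hz : Antitone z) (v : ℝ) (g : ℝ → ℝ) (n : ℕ) :
    ∑ k ∈ Finset.range (n + 1), g (insertSorted v z k)
      = ∑ k ∈ Finset.range n, g (z k) + g (max v (z n)) := by
  induction n with
  | zero => simp [insertSorted]
  | succ n ih =>
    rw [Finset.sum_range_succ, ih, Finset.sum_range_succ]
    have h := hz (Nat.le_succ n)
    simp only [Nat.succ_eq_add_one] at h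
    simp only [insertSorted]
    rcases le_total v (z n) with hv | hv
    · rw [max_eq_right hv, min_eq_left hv]
    · rw [max_eq_left hv, min_eq_right hv, max_eq_left h, max_eq_left (h.trans hv)]
      ring

theorem IsSizeSeq.hasSum_insertSorted {z : ℕ → ℝ} (hz : IsSizeSeq z) {v : ℝ} (hv : 0 ≤ v) :
    (∀ n, 0 ≤ CoagFrag.insertSorted v z n) ∧
      HasSum (CoagFrag.insertSorted v z) (∑' n, z n + v) := by
  have h0 : ∀ n, 0 ≤ CoagFrag.insertSorted v z n := fun n => by
    cases n with
    | zero => exact le_max_of_le_left hv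
    | succ n => exact le_max_of_le_right (hz.nonneg _)
  refine ⟨h0, (hasSum_iff_tendsto_nat_of_nonneg h0 _).2 ?_⟩
  rw [← Filter.tendsto_add_atTop_iff_nat 1]
  have h1 := sum_insertSorted hz.antitone v (fun x => x)
  simp only [h1]
  have h2 := hz.summable.tendsto_atTop_zero
  have h3 := (tendsto_const_nhds (x := v)).max h2
  rw [max_eq_left hv] at h3
  exact hz.summable.hasSum.tendsto_sum_nat.add h3

theorem IsSizeSeq.insertSorted {z : ℕ → ℝ} (hz : IsSizeSeq z) {v : ℝ} (hv : 0 ≤ v) :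
    IsSizeSeq (insertSorted v z) := by
  refine ⟨antitone_nat_of_succ_le fun n => ?_, (hz.hasSum_insertSorted hv).1,
    (hz.hasSum_insertSorted hv).2.summable⟩
  cases n with
  | zero => exact max_le_max (min_le_left _ _) (hz.antitone (by omega))
  | succ n =>
    exact max_le_max (min_le_min le_rfl (hz.antitone (by omega))) (hz.antitone (by omega))

theorem tsum_insertSorted {z : ℕ → ℝ} (hz : IsSizeSeq z) {v : ℝ} (hv : 0 ≤ v) :
    ∑' n, insertSorted v z n = ∑' n, z n + v :=
  (hz.hasSum_insertSorted hv).2.tsum_eq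

/-- `M_{ij} z`: the entries `z i` and `z j` are merged into `z i + z j`, then the sequence is
reordered. (For `i = j`, which never occurs below, `z` is left unchanged.) -/
def merge {I : Set ℝ} (i j : ℕ) (z : Cone I) : Cone I :=
  if h : i = j then z else
    ⟨insertSorted (z.1 i + z.1 j) (removeAt (min i j) (removeAt (max i j) z.1)), by
      have h1 := z.2.1.removeAt (max i j)
      have h2 := h1.removeAt (min i j)
      have hv := add_nonneg (z.2.1.nonneg i) (z.2.1.nonneg j)
      refine ⟨h2.insertSorted hv, ?_⟩
      have hm : min i j < max i j := by omega
      rw [tsum_insertSorted h2 hv, tsum_removeAt h1, tsum_removeAt z.2.1]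
      have h3 : removeAt (max i j) z.1 (min i j) = z.1 (min i j) := by simp only [removeAt, if_pos hm]
      have h4 : z.1 (max i j) + z.1 (min i j) = z.1 i + z.1 j := by
        rcases le_total i j with hij | hij <;> simp [hij, add_comm]
      rw [h3, sub_sub, h4, sub_add_cancel]
      exact z.2.2⟩

/-- `S_i^{(y)} z`: the entry `z i` is split into `y` and `z i - y`, then the sequence is
reordered. (Unless `0 < y < z i`, the sequence is left unchanged.) -/
def split {I : Set ℝ} (i : ℕ) (y : ℝ) (z : Cone I) : Cone I :=
  if h : 0 < y ∧ y < z.1 i then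
    ⟨insertSorted y (insertSorted (z.1 i - y) (removeAt i z.1)), by
      have h1 := z.2.1.removeAt i
      have hv : 0 ≤ z.1 i - y := by linarith [h.2]
      have h2 := h1.insertSorted hv
      refine ⟨h2.insertSorted h.1.le, ?_⟩
      rw [tsum_insertSorted h2 h.1.le, tsum_insertSorted h1 hv, tsum_removeAt z.2.1]
      have h3 : ∑' n, z.1 n - z.1 i + (z.1 i - y) + y = ∑' n, z.1 n := by ring
      rw [h3]
      exact z.2.2⟩
  else z

/-! ## Generators -/

/-- `L Φ(z) = ½ ∑_{i ≠ j, z_i z_j > 0} K(z_i, z_j) (Φ(M_{ij} z) - Φ(z))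
  + ½ ∑_i ∫_0^{z_i} F(y, z_i - y) (Φ(S_i^{(y)} z) - Φ(z)) dy`. -/
def generator (K F : ℝ → ℝ → ℝ) (Φ : Omega → ℝ) (z : Omega) : ℝ :=
  (1 / 2) * (∑' p : ℕ × ℕ, if p.1 ≠ p.2 ∧ 0 < z.1 p.1 * z.1 p.2 then
      K (z.1 p.1) (z.1 p.2) * (Φ (merge p.1 p.2 z) - Φ z) else 0)
  + (1 / 2) * ∑' i : ℕ, ∫ y in Ioo 0 (z.1 i), F y (z.1 i - y) * (Φ (split i y z) - Φ z)

/-- `L₁^♯ Φ(x) = ½ ∑_{i ≠ j, x_i x_j > 0} K₁(x_i, x_j) (Φ(M_{ij} x) - Φ(x))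
  + ½ ∑_i x_i ∫_0^1 F₁(u x_i, (1 - u) x_i) (Φ(S_i^{(u x_i)} x) - Φ(x)) du`. -/
def generatorSharp (K₁ F₁ : ℝ → ℝ → ℝ) (Φ : OmegaOne → ℝ) (x : OmegaOne) : ℝ :=
  (1 / 2) * (∑' p : ℕ × ℕ, if p.1 ≠ p.2 ∧ 0 < x.1 p.1 * x.1 p.2 then
      K₁ (x.1 p.1) (x.1 p.2) * (Φ (merge p.1 p.2 x) - Φ x) else 0)
  + (1 / 2) * ∑' i : ℕ, x.1 i * ∫ u in Ioo (0 : ℝ) 1,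
      F₁ (u * x.1 i) ((1 - u) * x.1 i) * (Φ (split i (u * x.1 i) x) - Φ x)

/-- `B(E)`: bounded Borel functions. -/
def IsBoundedBorel {E : Type*} [MeasurableSpace E] (Φ : E → ℝ) : Prop :=
  Measurable Φ ∧ ∃ C, ∀ z, |Φ z| ≤ C

/-- `Z` is a process generated by `L` (with arbitrary initial law), in the sense of the martingale
problem: `Z` is a measurable `ℱ`-adapted process and, for all `Φ ∈ B(E)` with `L Φ ∈ B(E)`,
`Φ(Z(t)) - Φ(Z(0)) - ∫_0^t L Φ(Z(u)) du` is a martingale. -/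
structure IsGeneratedBy {E S : Type*} [MeasurableSpace E] {mS : MeasurableSpace S}
    (L : (E → ℝ) → E → ℝ) (P : Measure S) (ℱ : Filtration ℝ≥0 mS)
    (Z : ℝ≥0 → S → E) : Prop where
  measurable : Measurable (fun q : ℝ≥0 × S => Z q.1 q.2)
  adapted : ∀ t, Measurable[ℱ t] (Z t)
  martingale : ∀ Φ : E → ℝ, IsBoundedBorel Φ → IsBoundedBorel (L Φ) →
    Martingale (fun t ω => Φ (Z t ω) - Φ (Z 0 ω) -
        ∫ u in Ioc (0 : ℝ) t, L Φ (Z u.toNNReal ω)) ℱ P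

/-! ## Correlation measures -/

/-- For `ξ = Ξ(z) = ∑_i 1_{z_i > 0} δ_{z_i}`, the modified product counting measure
`ξ^{[k]} = ∑ δ_{(z_{i_1}, …, z_{i_k})}` over `k`-tuples of distinct indices with positive entries,
as a measure on `ℝ^k` carried by `(0, ∞)^k`. -/
def factorialMeasure (k : ℕ) (z : ℕ → ℝ) : Measure (Fin k → ℝ) :=
  open Classical in
  Measure.sum fun i : Fin k ↪ ℕ =>
    if ∀ l, 0 < z (i l) then Measure.dirac (fun l => z (i l)) else 0

/-- The `k`-th correlation measure of `Ξ(Y)` for a random element `Y` of `Ω` or `Ω₁`: the mean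
measure `B ↦ E[Ξ(Y)^{[k]}(B)]`. -/
def correlationMeasure {I : Set ℝ} {S : Type*} [MeasurableSpace S] (P : Measure S)
    (Y : S → Cone I) (k : ℕ) : Measure (Fin k → ℝ) :=
  P.bind fun ω => factorialMeasure k (Y ω).1

/-! ## The weak hierarchy -/

/-- The open orthant `(0, ∞)^k`. -/
def orthant (k : ℕ) : Set (Fin k → ℝ) := {z | ∀ l, 0 < z l}

/-- `B_{+,c}^k`: nonnegative bounded Borel functions with compact support in `(0, ∞)^k`
(extended by zero to `ℝ^k`). -/
structure IsTest {k : ℕ} (f : (Fin k → ℝ) → ℝ) : Prop where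
  measurable : Measurable f
  nonneg : ∀ z, 0 ≤ f z
  bounded : ∃ C, ∀ z, f z ≤ C
  compact_support : ∃ C ⊆ orthant k, IsCompact C ∧ ∀ z ∉ C, f z = 0

/-- `(z_1, …, z_{l-1}, z_l + z_{l+1}, z_{l+2}, …, z_{k+1})`. -/
def coag {k : ℕ} (l : Fin k) (z : Fin (k + 1) → ℝ) : Fin k → ℝ := fun i =>
  if i < l then z i.castSucc else if i = l then z l.castSucc + z l.succ else z i.succ

/-- `(z_1, …, z_l, z_{l+2}, …, z_{k+1})`. -/
def dropNext {k : ℕ} (l : Fin k) (z : Fin (k + 1) → ℝ) : Fin k → ℝ := fun i =>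
  if i ≤ l then z i.castSucc else z i.succ

/-- For `l < m`, the vector `(z_1, …, z_{l-1}, y, z_{l+1}, …, z_{m-1}, z_l - y, z_m, …, z_{k-1})`,
where `k = n + 1`. -/
def frag {n : ℕ} (l : Fin n) (m : Fin (n + 1)) (y : ℝ) (z : Fin n → ℝ) : Fin (n + 1) → ℝ :=
  m.insertNth (z l - y) (Function.update z l y)

/-- Local integrability on `[0, ∞)` of a nonnegative, possibly infinite function of time. -/
def LocIntegrable (φ : ℝ≥0 → ℝ≥0∞) : Prop :=
  ∀ T : ℝ, AEMeasurable (fun t : ℝ => φ t.toNNReal) (volume.restrict (Icc 0 T)) ∧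
    ∫⁻ t in Icc 0 T, φ t.toNNReal < ∞

/-- Admissibility (with exponent `lam`) of a family `c t k` of measures on `(0, ∞)^k`, `k ≥ 1`
(the index `k = n + 1` is used; the member `k = 0` is irrelevant). In `locIntegrable_weight`, for
`n = 0` the function `g` is a nonnegative constant, which gives the condition without `g`. -/
structure Admissible (lam : ℝ) (c : ℝ≥0 → (k : ℕ) → Measure (Fin k → ℝ)) : Prop where
  carried : ∀ t n, c t (n + 1) (orthant (n + 1))ᶜ = 0
  locallyFinite : ∀ t n, ∀ C ⊆ orthant (n + 1), IsCompact C → c t (n + 1) C < ∞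
  locIntegrable_test : ∀ n, ∀ f : (Fin (n + 1) → ℝ) → ℝ, IsTest f →
    LocIntegrable fun t => ∫⁻ z, ENNReal.ofReal (f z) ∂c t (n + 1)
  locIntegrable_coag : ∀ n, ∀ f : (Fin (n + 1) → ℝ) → ℝ, IsTest f → ∀ l : Fin (n + 1),
    LocIntegrable fun t =>
      ∫⁻ z, ENNReal.ofReal (z l.castSucc * z l.succ * f (coag l z)) ∂c t (n + 2)
  locIntegrable_weight : ∀ n, ∀ g : (Fin n → ℝ) → ℝ, IsTest g → ∀ l : Fin (n + 1),
    LocIntegrable fun t =>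
      ∫⁻ z, ENNReal.ofReal (z l * max (z l ^ (1 + lam)) 1 * g (l.removeNth z)) ∂c t (n + 1)

/-- Finiteness of `∫_0^t ds ∫ h(z) c_k(s, dz)`. -/
def TimeSpaceIntegrable (c : ℝ≥0 → (k : ℕ) → Measure (Fin k → ℝ)) (t : ℝ≥0) {k : ℕ}
    (h : (Fin k → ℝ) → ℝ) : Prop :=
  (∀ᵐ s ∂(volume.restrict (Ioc (0 : ℝ) t)), Integrable h (c s.toNNReal k)) ∧
    IntegrableOn (fun s : ℝ => ∫ z, h z ∂c s.toNNReal k) (Ioc 0 t)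

/-- `∫_0^t ds ∫ h(z) c_k(s, dz)`. -/
def timeSpaceIntegral (c : ℝ≥0 → (k : ℕ) → Measure (Fin k → ℝ)) (t : ℝ≥0) {k : ℕ}
    (h : (Fin k → ℝ) → ℝ) : ℝ :=
  ∫ s in Ioc (0 : ℝ) t, ∫ z, h z ∂c s.toNNReal k

section Terms

variable (K F : ℝ → ℝ → ℝ) {n : ℕ} (f : (Fin (n + 1) → ℝ) → ℝ)

/-- Gain by coagulation: `K(z_l, z_{l+1}) f(Coag_{l,l+1} z)`. -/
def term1 (l : Fin (n + 1)) (z : Fin (n + 2) → ℝ) : ℝ :=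
  K (z l.castSucc) (z l.succ) * f (coag l z)

/-- Loss by fragmentation: `∫_0^{z_l} F(y, z_l - y) dy f(z)`. -/
def term2 (l : Fin (n + 1)) (z : Fin (n + 1) → ℝ) : ℝ :=
  (∫ y in Ioo 0 (z l), F y (z l - y)) * f z

/-- Loss by coagulation with a further cluster:
`K(z_l, z_{l+1}) f(z_1, …, z_l, z_{l+2}, …, z_{k+1})`. -/
def term3 (l : Fin (n + 1)) (z : Fin (n + 2) → ℝ) : ℝ :=
  K (z l.castSucc) (z l.succ) * f (dropNext l z)

/-- Gain by fragmentation: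
`∫_0^{z_l} F(y, z_l - y) f(z_1, …, z_{l-1}, y, z_{l+1}, …, z_k) dy`. -/
def term4 (l : Fin (n + 1)) (z : Fin (n + 1) → ℝ) : ℝ :=
  ∫ y in Ioo 0 (z l), F y (z l - y) * f (Function.update z l y)

/-- Loss by coagulation within the tuple: `K(z_l, z_m) f(z)`. -/
def term5 (l m : Fin (n + 1)) (z : Fin (n + 1) → ℝ) : ℝ :=
  K (z l) (z m) * f z

/-- Gain by fragmentation into two members of the tuple:
`∫_0^{z_l} F(y, z_l - y) f(Frag_{l,m}^{(y)} z) dy`, for `z` of length `k - 1 = n`. -/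
def term6 (l : Fin n) (m : Fin (n + 1)) (z : Fin n → ℝ) : ℝ :=
  ∫ y in Ioo 0 (z l), F y (z l - y) * f (frag l m y z)

end Terms

/-- The weak form of the hierarchical coagulation-fragmentation equation with kernels `K`, `F`:
for all `t > 0`, `k = n + 1 ≥ 1` and `f ∈ B_{+,c}^k` every integral in the equation is finite and
the equation holds. For `k = 1` the sums over `l < m` are empty. Pairs `1 ≤ l < m ≤ k` are
represented by `l m : Fin (n + 1)`, and in the last sum, since `l ≤ k - 1`, by `l : Fin n`. -/
def SatisfiesWeakHierarchy (K F : ℝ → ℝ → ℝ)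
    (c : ℝ≥0 → (k : ℕ) → Measure (Fin k → ℝ)) : Prop :=
  ∀ t : ℝ≥0, 0 < t → ∀ n : ℕ, ∀ f : (Fin (n + 1) → ℝ) → ℝ, IsTest f →
    (Integrable f (c t (n + 1)) ∧ Integrable f (c 0 (n + 1)) ∧
      (∀ l : Fin (n + 1), TimeSpaceIntegrable c t (term1 K f l) ∧
        TimeSpaceIntegrable c t (term2 F f l) ∧ TimeSpaceIntegrable c t (term3 K f l) ∧
        TimeSpaceIntegrable c t (term4 F f l)) ∧
      (∀ l m : Fin (n + 1), l < m → TimeSpaceIntegrable c t (term5 K f l m)) ∧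
      (∀ (l : Fin n) (m : Fin (n + 1)), l.castSucc < m →
        TimeSpaceIntegrable c t (term6 F f l m))) ∧
    ∫ z, f z ∂c t (n + 1) - ∫ z, f z ∂c 0 (n + 1) =
      (1 / 2) * ∑ l : Fin (n + 1), timeSpaceIntegral c t (term1 K f l)
      - (1 / 2) * ∑ l : Fin (n + 1), timeSpaceIntegral c t (term2 F f l)
      - ∑ l : Fin (n + 1), timeSpaceIntegral c t (term3 K f l)
      + ∑ l : Fin (n + 1), timeSpaceIntegral c t (term4 F f l)
      - ∑ l : Fin (n + 1), ∑ m : Fin (n + 1),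
          (if l < m then timeSpaceIntegral c t (term5 K f l m) else 0)
      + ∑ l : Fin n, ∑ m : Fin (n + 1),
          (if l.castSucc < m then timeSpaceIntegral c t (term6 F f l m) else 0)

/-! ## Rate functions -/

/-- Symmetric, nonnegative, Borel functions on `(0, ∞)^2`, homogeneous of degree `lam`. -/
structure IsHomogeneousRate (lam : ℝ) (H : ℝ → ℝ → ℝ) : Prop where
  measurable : Measurable fun p : Ioi (0 : ℝ) × Ioi (0 : ℝ) => H p.1 p.2
  nonneg : ∀ x y, 0 < x → 0 < y → 0 ≤ H x y
  symm : ∀ x y, 0 < x → 0 < y → H x y = H y x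
  homogeneous : ∀ a x y, 0 < a → 0 < x → 0 < y → H (a * x) (a * y) = a ^ lam * H x y

/-- `0 < sup {H(u, 1 - u) : 0 < u < 1} < ∞`. -/
def CoagBound (H : ℝ → ℝ → ℝ) : Prop :=
  BddAbove ((fun u : ℝ => H u (1 - u)) '' Ioo 0 1) ∧
    0 < sSup ((fun u : ℝ => H u (1 - u)) '' Ioo 0 1)

/-- `0 < ∫_0^1 H(u, 1 - u) du < ∞`. -/
def FragBound (H : ℝ → ℝ → ℝ) : Prop :=
  IntegrableOn (fun u : ℝ => H u (1 - u)) (Ioo 0 1) ∧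
    0 < ∫ u in Ioo (0 : ℝ) 1, H u (1 - u)

/-- The triangle `{(x, y) : x, y > 0, x + y ≤ 1}`. -/
def triangle : Set (ℝ × ℝ) := {p | 0 < p.1 ∧ 0 < p.2 ∧ p.1 + p.2 ≤ 1}

/-- Symmetric, nonnegative, bounded Borel functions on the triangle. -/
structure IsBoundedRate (Q : ℝ → ℝ → ℝ) : Prop where
  measurable : Measurable fun p : triangle => Q p.1.1 p.1.2
  nonneg : ∀ x y, (x, y) ∈ triangle → 0 ≤ Q x y
  symm : ∀ x y, (x, y) ∈ triangle → Q x y = Q y x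
  bounded : ∃ C, ∀ x y, (x, y) ∈ triangle → Q x y ≤ C

/-- The coagulation kernel `(x, y) ↦ x y H(x, y)`. -/
def coagKernel (H : ℝ → ℝ → ℝ) (x y : ℝ) : ℝ := x * y * H x y

/-- The fragmentation kernel `(x, y) ↦ (x + y) H(x, y)`. -/
def fragKernel (H : ℝ → ℝ → ℝ) (x y : ℝ) : ℝ := (x + y) * H x y

end CoagFrag

end

open CoagFrag

/-! For a test function `f`, let `pairing f z` be the integral of `f` against the factorial measure
of `z`. Its expectation along the process is the integral of `f` against the correlation measure.
The hierarchy is therefore the expectation of the martingale identity for `pairing f`, once the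
generator applied to `pairing f` is known to be the combination of the six terms integrated against
factorial measures (`coneGenerator_pairing`).

That computation is combinatorial. Reordering does not affect a sum over tuples of distinct indices,
so a merge of `a` and `b` amounts to overwriting the entry at `a` by the sum and the entry at `b` by
`0`, and a split amounts to overwriting one entry and adjoining another. Sorting tuples according to
which of the affected indices they use, and where, leaves a gain and a loss
(`tupleSum_merge_balance`, `tupleSum_split_balance`). Summation over pairs or pieces gives the
terms: the choice of an index outside the tuple raises the order to `k + 1`, the choice of two
indices inside it gives the double sum over `l < m`, and a split whose two pieces both belong to the
tuple comes from order `k - 1`. All rearrangements take place in `[0, ∞]`, where series may be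
permuted freely; real subtraction comes only after gain and loss are known to be finite.

Two analytic points remain. A compactly supported `f` is bounded by a multiple of the product of any
selection of coordinates. With the factor `xy` in `K` and the bound on the total rate of `F`, every
term is then at most `C ∏ x_l (1 + ∑ x_l)^N`, and the integral of this against the factorial measure
of `z` is at most a polynomial in the mass (`MassBounded.lintegral_le`). Moreover `pairing f` need
not be bounded, so it is no admissible test function of the martingale problem; but merging and
splitting preserve mass, hence a function of the mass acts as a constant for the generator
(`coneGenerator_mul_mass`). This shows that the law of the mass does not change in time, so its
moments stay finite, and it lets `pairing f` be cut off at mass `R`. Dominated convergence as `R →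
∞` concludes.

Since the rates are controlled only on part of the plane, kernels are first replaced by their
extension by zero; neither the generator nor the hierarchy sees the difference. Part (ii) uses the
same argument: the substitution `y = u x_i` identifies its generator with the one above, and the
mass is identically `1`. -/

noncomputable section

namespace CoagFrag

open Function
open scoped Classical

/-! ### Sums over tuples of distinct indices. -/

section TupleSum

variable {ι κ : Type*} {k n : ℕ}

/-- The sum of `h` over the `k`-tuples `(z (i 0), …, z (i (k - 1)))` with distinct indices. -/
def tupleSum (z : ι → ℝ) (h : (Fin k → ℝ) → ℝ≥0∞) : ℝ≥0∞ :=
  ∑' i : Fin k → ι, if Injective i then h (fun j => z (i j)) else 0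

/-- The part of `tupleSum z h` in which the index `a` is not used. -/
def avoidingSum (z : ι → ℝ) (a : ι) (h : (Fin k → ℝ) → ℝ≥0∞) : ℝ≥0∞ :=
  ∑' i : Fin k → ι, if Injective i ∧ ∀ j, i j ≠ a then h (fun j => z (i j)) else 0

/-- The part of `tupleSum z h` in which the `l`-th index is `a`, with `u` in place of `z a`. -/
def pinnedSum (z : ι → ℝ) (l : Fin k) (a : ι) (u : ℝ) (h : (Fin k → ℝ) → ℝ≥0∞) : ℝ≥0∞ :=
  ∑' i : Fin k → ι,
    if Injective i ∧ i l = a then h (update (fun j => z (i j)) l u) else 0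

/-- A tuple that uses an index outside the range of `σ` has a nonpositive coordinate, where `h`
vanishes. This allows a deleted entry to be modelled by an entry `0`. -/
theorem tupleSum_comp_injective {σ : ι → κ} (hσ : Injective σ) {w : κ → ℝ}
    (hw : ∀ b ∉ range σ, w b ≤ 0) {h : (Fin k → ℝ) → ℝ≥0∞} (h0 : ∀ x ∉ orthant k, h x = 0) :
    tupleSum (fun a => w (σ a)) h = tupleSum w h := by
  have hinj : Injective (fun (i : Fin k → ι) l => σ (i l)) := hσ.comp_left
  rw [tupleSum, tupleSum, ← hinj.tsum_eq]
  · refine tsum_congr fun i => ?_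
    have : Injective (fun l => σ (i l)) ↔ Injective i := hσ.of_comp_iff i
    simp only [this]
  · intro i hi
    by_contra hc
    apply hi
    have : ∃ l, i l ∉ range σ := by
      by_contra! hall
      choose g hg using hall
      exact hc ⟨g, funext hg⟩
    obtain ⟨l, hl⟩ := this
    have h1 : h (fun j => w (i j)) = 0 := h0 _ fun hx => absurd (hx l) (not_lt.2 (hw _ hl))
    simp [h1]

theorem tupleSum_comp_bijective {σ : ι → κ} (hσ : Bijective σ) (w : κ → ℝ)
    (h : (Fin k → ℝ) → ℝ≥0∞) : tupleSum (fun a => w (σ a)) h = tupleSum w h := by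
  rw [tupleSum, tupleSum, ← (Equiv.piCongrRight fun _ : Fin k => Equiv.ofBijective σ hσ).tsum_eq]
  refine tsum_congr fun i => ?_
  have : Injective (fun l => σ (i l)) ↔ Injective i := hσ.1.of_comp_iff i
  change (if Injective i then _ else _)
    = if Injective (fun l => σ (i l)) then h (fun l => w (σ (i l))) else 0
  simp only [this]

/-- An injective tuple either avoids `a` or takes the value `a` at exactly one place. -/
theorem ite_injective_split (i : Fin k → ι) (a : ι) (c : ℝ≥0∞) :
    (if Injective i then c else 0) = (if Injective i ∧ ∀ j, i j ≠ a then c else 0)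
      + ∑ l : Fin k, if Injective i ∧ i l = a then c else 0 := by
  by_cases hi : Injective i
  · by_cases ha : ∃ l, i l = a
    · obtain ⟨l, hl⟩ := ha
      have h1 : ¬ ∀ j, i j ≠ a := fun h => h l hl
      have h2 : ∀ m, i m = a ↔ m = l := fun m =>
        ⟨fun hm => hi (hm.trans hl.symm), fun hm => hm ▸ hl⟩
      rw [if_pos hi, if_neg (fun h => h1 h.2), zero_add]
      simp [hi, h2]
    · push Not at ha
      simp [hi, ha]
  · simp [hi]

/-- Only tuples that use `a` see the new value, and by injectivity they use it at a single place
`l`. -/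
theorem tupleSum_update [DecidableEq ι] {z : ι → ℝ} (a : ι) (u : ℝ) (h : (Fin k → ℝ) → ℝ≥0∞) :
    tupleSum (update z a u) h = avoidingSum z a h + ∑ l, pinnedSum z l a u h := by
  simp only [tupleSum, avoidingSum, pinnedSum]
  rw [← Summable.tsum_finsetSum (fun _ _ => ENNReal.summable), ← ENNReal.tsum_add]
  refine tsum_congr fun i => ?_
  rw [ite_injective_split i a]
  congr 1
  · split_ifs with hi
    · congr 1
      funext j
      rw [update_of_ne (hi.2 j)]
    · rfl
  · refine Finset.sum_congr rfl fun l _ => ?_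
    split_ifs with hi
    · congr 1
      funext j
      rcases eq_or_ne j l with rfl | hj
      · simp [hi.2]
      · rw [update_of_ne hj, update_of_ne]
        exact fun hc => hj (hi.1 (hc.trans hi.2.symm))
    · rfl

theorem injective_insertNth_iff {m : Fin (n + 1)} {a : ι} {i : Fin n → ι} :
    Injective (m.insertNth (α := fun _ => ι) a i) ↔ Injective i ∧ ∀ j, i j ≠ a := by
  constructor
  · intro h
    refine ⟨fun p q hpq => ?_, fun j hj => ?_⟩
    · exact Fin.succAbove_right_injective (h (a₁ := m.succAbove p) (a₂ := m.succAbove q)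
        (by simpa using hpq))
    · exact Fin.succAbove_ne m j (h (by simpa using hj))
  · rintro ⟨h, ha⟩ p q hpq
    induction p using Fin.succAboveCases m <;> induction q using Fin.succAboveCases m
    · rfl
    · simp only [Fin.insertNth_apply_same, Fin.insertNth_apply_succAbove] at hpq
      exact absurd hpq.symm (ha _)
    · simp only [Fin.insertNth_apply_same, Fin.insertNth_apply_succAbove] at hpq
      exact absurd hpq (ha _)
    · simp only [Fin.insertNth_apply_succAbove] at hpq
      rw [h hpq]

theorem comp_insertNth (z : ι → κ) (m : Fin (n + 1)) (a : ι) (i : Fin n → ι) :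
    (fun j => z (m.insertNth (α := fun _ => ι) a i j))
      = m.insertNth (α := fun _ => κ) (z a) (fun j => z (i j)) := by
  funext j
  induction j using Fin.succAboveCases m <;> simp

/-- Inserting the index `a` at place `m` is a bijection from the injective tuples avoiding `a` onto
the injective tuples with `a` at place `m`. -/
theorem avoidingSum_insertNth (z : ι → ℝ) (a : ι) (m : Fin (n + 1)) (v : ℝ)
    (h : (Fin (n + 1) → ℝ) → ℝ≥0∞) :
    avoidingSum z a (fun x => h (m.insertNth v x)) = pinnedSum z m a v h := by
  have hinj : Injective (fun i : Fin n → ι => m.insertNth (α := fun _ => ι) a i) :=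
    Fin.insertNth_right_injective (α := fun _ => ι) a
  rw [avoidingSum, pinnedSum, ← hinj.tsum_eq]
  · refine tsum_congr fun i => ?_
    simp only [injective_insertNth_iff, comp_insertNth, Fin.insertNth_apply_same, and_true,
      Fin.update_insertNth]
  · intro i hi
    by_contra hc
    apply hi
    refine if_neg ?_
    rintro ⟨-, hm⟩
    exact hc ⟨m.removeNth i, by simp [← hm]⟩

/-- Adjoining a further entry `v` to the family. -/
theorem tupleSum_option (w : ι → ℝ) (v : ℝ) (h : (Fin (n + 1) → ℝ) → ℝ≥0∞) :
    tupleSum (fun o : Option ι => o.elim v w) h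
      = tupleSum w h + ∑ m : Fin (n + 1), tupleSum w (fun x => h (m.insertNth v x)) := by
  have hsome : ∀ {k : ℕ} (g : (Fin k → ℝ) → ℝ≥0∞),
      avoidingSum (fun o : Option ι => o.elim v w) none g = tupleSum w g := by
    intro k g
    have hinj : Injective (fun (i : Fin k → ι) l => some (i l)) :=
      (Option.some_injective ι).comp_left
    rw [avoidingSum, tupleSum, ← hinj.tsum_eq]
    · refine tsum_congr fun i => ?_
      have : Injective (fun l => some (i l)) ↔ Injective i :=
        (Option.some_injective ι).of_comp_iff i
      simp [this]
    · intro i hi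
      by_contra hc
      apply hi
      refine if_neg ?_
      rintro ⟨-, hm⟩
      have : ∀ l, ∃ b, some b = i l := fun l => by
        simpa [eq_comm] using Option.ne_none_iff_exists'.1 (hm l)
      choose g hg using this
      exact hc ⟨g, funext hg⟩
  have h1 := tupleSum_update (z := fun o : Option ι => o.elim v w) none v h
  have h2 : update (fun o : Option ι => o.elim v w) none v = fun o : Option ι => o.elim v w := by
    rw [update_eq_self_iff]; rfl
  rw [h2, hsome] at h1
  rw [h1]
  congr 1
  refine Finset.sum_congr rfl fun m _ => ?_
  rw [← avoidingSum_insertNth, hsome]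

/-- The set of injective index tuples is invariant under permutations of the places, here the one
that moves place `l` to place `m`. -/
theorem tupleSum_insertNth_removeNth (z : ι → ℝ) (l m : Fin (n + 1))
    (h : (Fin (n + 1) → ℝ) → ℝ≥0∞) :
    tupleSum z (fun x => h (m.insertNth (x l) (l.removeNth x))) = tupleSum z h := by
  rw [tupleSum, tupleSum]
  conv_rhs => rw [← ((Fin.insertNthEquiv (fun _ => ι) l).symm.trans
    (Fin.insertNthEquiv (fun _ => ι) m)).tsum_eq]
  refine tsum_congr fun i => ?_
  have : Injective i ↔ Injective (l.removeNth i) ∧ ∀ j, l.removeNth i j ≠ i l := by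
    rw [← injective_insertNth_iff (m := l)]; simp
  change _ = if Injective (m.insertNth (α := fun _ => ι) (i l) (l.removeNth i)) then
    h (fun j => z (m.insertNth (α := fun _ => ι) (i l) (l.removeNth i) j)) else 0
  rw [if_congr injective_insertNth_iff rfl rfl, if_congr this.symm rfl rfl, comp_insertNth]
  rfl

end TupleSum

/-! ### Merging and splitting up to a permutation of indices. -/

section Rearrangement

variable {k n : ℕ}

theorem exists_bijective_insertSorted {w : ℕ → ℝ} (hw : Antitone w)
    (hlim : Filter.Tendsto w Filter.atTop (nhds 0)) {v : ℝ} (hv : 0 < v) :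
    ∃ e : ℕ → Option ℕ, Bijective e ∧ ∀ n, insertSorted v w n = (e n).elim v w := by
  have hex : ∃ n, w n < v := (hlim.eventually (gt_mem_nhds hv)).exists
  -- `p` counts the entries that are at least `v`, so `v` lands at position `p`. It exists because
  -- `w` tends to `0 < v`.
  obtain ⟨p, hp1, hp2⟩ : ∃ p, (∀ n, p ≤ n → w n < v) ∧ ∀ n, n < p → v ≤ w n :=
    ⟨Nat.find hex, fun n hn => (hw hn).trans_lt (Nat.find_spec hex),
      fun n hn => not_lt.1 (Nat.find_min hex hn)⟩
  refine ⟨fun n => if n < p then some n else if n = p then none else some (n - 1), ⟨?_, ?_⟩, ?_⟩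
  · intro a b hab
    simp only at hab
    split_ifs at hab <;> simp only [Option.some.injEq] at hab <;> omega
  · rintro (_ | b)
    · exact ⟨p, by simp⟩
    · by_cases hb : b < p
      · exact ⟨b, by simp [hb]⟩
      · exact ⟨b + 1, by
          simp only
          rw [if_neg (by omega), if_neg (by omega)]; rfl⟩
  · rintro (_ | n)
    · simp only [insertSorted]
      by_cases h : 0 < p
      · simp [h, hp2 0 h]
      · have h' : p = 0 := by omega
        simp [h', (hp1 0 (by omega)).le]
    · simp only [insertSorted]
      by_cases h : n + 1 < p
      · rw [if_pos h, min_eq_left (hp2 n (by omega)), max_eq_right (hp2 _ h)]; rfl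
      · by_cases h' : n + 1 = p
        · rw [if_neg h, if_pos h', min_eq_left (hp2 n (by omega)),
            max_eq_left (hp1 _ (by omega)).le]; rfl
        · rw [if_neg h, if_neg h', min_eq_right (hp1 n (by omega)).le, max_eq_left (hw (by omega))]
          rfl

/-- The increasing enumeration of `{a}ᶜ`. -/
def skip (a n : ℕ) : ℕ := if n < a then n else n + 1

theorem skip_injective (a : ℕ) : Injective (skip a) := by
  intro p q h
  simp only [skip] at h
  split_ifs at h <;> omega

theorem mem_range_skip {a b : ℕ} : b ∈ range (skip a) ↔ b ≠ a := by
  constructor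
  · rintro ⟨n, rfl⟩
    simp only [skip]
    split_ifs <;> omega
  · intro h
    by_cases hb : b < a
    · exact ⟨b, by simp [skip, hb]⟩
    · exact ⟨b - 1, by simp only [skip]; split_ifs <;> omega⟩

theorem removeAt_eq_skip (a : ℕ) (z : ℕ → ℝ) : removeAt a z = fun n => z (skip a n) := by
  funext n
  simp only [removeAt, skip]
  split_ifs <;> rfl

theorem exists_bijective_insertSorted_removeAt {z : ℕ → ℝ} (hz : IsSizeSeq z) (a : ℕ) {v : ℝ}
    (hv : 0 < v) :
    ∃ e : ℕ → ℕ, Bijective e ∧ ∀ n, insertSorted v (removeAt a z) n = update z a v (e n) := by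
  have h1 := hz.removeAt a
  obtain ⟨e, he, hev⟩ := exists_bijective_insertSorted h1.antitone
    h1.summable.tendsto_atTop_zero hv
  refine ⟨fun n => (e n).elim a (skip a), Bijective.comp (g := fun o : Option ℕ => o.elim a (skip a))
    ⟨?_, ?_⟩ he, fun n => ?_⟩
  · rintro (_ | p) (_ | q) h
    · rfl
    · exact absurd h.symm (mem_range_skip.1 ⟨q, rfl⟩)
    · exact absurd h (mem_range_skip.1 ⟨p, rfl⟩)
    · exact congrArg some (skip_injective a h)
  · intro b
    by_cases hb : b = a
    · exact ⟨none, hb.symm⟩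
    · obtain ⟨n, hn⟩ := mem_range_skip.2 hb
      exact ⟨some n, hn⟩
  · rw [hev, removeAt_eq_skip]
    simp only
    cases e n with
    | none => simp
    | some q => exact (update_of_ne (mem_range_skip.1 ⟨q, rfl⟩) _ _).symm

/-- The entry at `b` is set to `0` rather than deleted, which keeps the index set `ℕ`. Since `a <
b`, deletion at `b` does not shift the index `a`. -/
theorem tupleSum_merge_aux {z : ℕ → ℝ} (hz : IsSizeSeq z) {a b : ℕ} (hab : a < b) {v : ℝ}
    (hv : 0 < v) {h : (Fin k → ℝ) → ℝ≥0∞} (h0 : ∀ x ∉ orthant k, h x = 0) :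
    tupleSum (insertSorted v (removeAt a (removeAt b z))) h
      = tupleSum (update (update z a v) b 0) h := by
  obtain ⟨e, he, hev⟩ := exists_bijective_insertSorted_removeAt (hz.removeAt b) a hv
  have h1 : insertSorted v (removeAt a (removeAt b z))
      = fun n => update (removeAt b z) a v (e n) := funext hev
  have h2 : update (removeAt b z) a v = fun n => update (update z a v) b 0 (skip b n) := by
    funext n
    have hb : skip b n ≠ b := mem_range_skip.1 ⟨n, rfl⟩
    rw [update_of_ne hb, removeAt_eq_skip]
    by_cases hn : n = a
    · subst hn
      have : skip b n = n := by simp [skip, hab]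
      simp [this]
    · have : skip b n ≠ a := by
        simp only [skip]; split_ifs <;> omega
      rw [update_of_ne hn, update_of_ne this]
  rw [h1, tupleSum_comp_bijective he, h2, tupleSum_comp_injective (skip_injective b) _ h0]
  intro c hc
  have : c = b := by
    by_contra hcb
    exact hc (mem_range_skip.2 hcb)
  simp [this]

theorem tupleSum_merge {I : Set ℝ} (z : Cone I) {i j : ℕ} (hij : i ≠ j) (hi : 0 < z.1 i)
    (hj : 0 < z.1 j) {h : (Fin k → ℝ) → ℝ≥0∞} (h0 : ∀ x ∉ orthant k, h x = 0) :
    tupleSum (merge i j z).1 h = tupleSum (update (update z.1 i (z.1 i + z.1 j)) j 0) h := by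
  simp only [merge, dif_neg hij]
  rcases lt_or_gt_of_ne hij with hlt | hlt
  · rw [min_eq_left hlt.le, max_eq_right hlt.le,
      tupleSum_merge_aux z.2.1 hlt (add_pos hi hj) h0]
  -- For `j < i` the auxiliary lemma puts the sum at `j` and the zero at `i`; the transposition of
  -- `i` and `j` exchanges them.
  · rw [min_eq_right hlt.le, max_eq_left hlt.le,
      tupleSum_merge_aux z.2.1 hlt (add_pos hi hj) h0,
      ← tupleSum_comp_bijective (Equiv.swap i j).bijective]
    congr 1
    funext n
    by_cases h1 : n = i
    · subst h1; simp [hij, hij.symm]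
    · by_cases h2 : n = j
      · subst h2; simp
      · rw [Equiv.swap_apply_of_ne_of_ne h1 h2]; simp [h1, h2]

theorem tupleSum_split {I : Set ℝ} (z : Cone I) {i : ℕ} {y : ℝ} (hy : 0 < y) (hyz : y < z.1 i)
    (h : (Fin (n + 1) → ℝ) → ℝ≥0∞) :
    tupleSum (split i y z).1 h
      = tupleSum (update z.1 i (z.1 i - y)) h
        + ∑ m : Fin (n + 1), tupleSum (update z.1 i (z.1 i - y)) (fun x => h (m.insertNth y x)) := by
  have hv : 0 < z.1 i - y := sub_pos.2 hyz
  have h1 := (z.2.1.removeAt i).insertSorted hv.le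
  obtain ⟨e, he, hev⟩ := exists_bijective_insertSorted_removeAt z.2.1 i hv
  obtain ⟨e', he', hev'⟩ := exists_bijective_insertSorted h1.antitone
    h1.summable.tendsto_atTop_zero hy
  simp only [split, dif_pos (And.intro hy hyz)]
  have h2 : insertSorted y (insertSorted (z.1 i - y) (removeAt i z.1)) = fun n =>
      (fun o : Option ℕ => o.elim y (insertSorted (z.1 i - y) (removeAt i z.1))) (e' n) :=
    funext hev'
  have h3 : insertSorted (z.1 i - y) (removeAt i z.1)
      = fun n => update z.1 i (z.1 i - y) (e n) := funext hev
  rw [h2, tupleSum_comp_bijective (w := fun o : Option ℕ => o.elim y _) he', tupleSum_option, h3]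
  simp only [tupleSum_comp_bijective he]

end Rearrangement

/-! ### Gain and loss of tuple sums under merging and splitting. -/

section Balance

variable {ι κ : Type*} {k n : ℕ}

/-- The sum of `h` over the tuples whose `l`-th index is `a` and which do not use `b`. -/
def freshSum (z : ι → ℝ) (l : Fin k) (a b : ι) (h : (Fin k → ℝ) → ℝ≥0∞) : ℝ≥0∞ :=
  ∑' i : Fin k → ι,
    if (Injective i ∧ ∀ j, i j ≠ b) ∧ i l = a then h (fun j => z (i j)) else 0

/-- The sum of `h` over the tuples with `l`-th index `a` and `m`-th index `b`. -/
def doubleSum (z : ι → ℝ) (l m : Fin k) (a b : ι) (h : (Fin k → ℝ) → ℝ≥0∞) : ℝ≥0∞ :=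
  ∑' i : Fin k → ι,
    if (Injective i ∧ i m = b) ∧ i l = a then h (fun j => z (i j)) else 0

/-- The part of `tupleSum z h` in which neither `a` nor `b` is used. -/
def avoidingPairSum (z : ι → ℝ) (a b : ι) (h : (Fin k → ℝ) → ℝ≥0∞) : ℝ≥0∞ :=
  ∑' i : Fin k → ι,
    if (Injective i ∧ ∀ j, i j ≠ b) ∧ ∀ j, i j ≠ a then h (fun j => z (i j)) else 0

theorem ite_split {P : Prop} [Decidable P] {i : Fin k → ι} (hP : P → Injective i) (a : ι) (c : ℝ≥0∞) :
    (if P then c else 0) = (if P ∧ ∀ j, i j ≠ a then c else 0)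
      + ∑ l : Fin k, if P ∧ i l = a then c else 0 := by
  by_cases h : P
  · simpa [h, hP h] using ite_injective_split i a c
  · simp [h]

/-- Tuples are classified by whether they use `b`, then by whether they use `a`. The double sums
need no condition `l ≠ m`: for `a ≠ b` the diagonal ones are empty. -/
theorem tupleSum_eq_of_pair (z : ι → ℝ) (a b : ι) (h : (Fin k → ℝ) → ℝ≥0∞) :
    tupleSum z h
      = avoidingPairSum z a b h
        + ∑ l, freshSum z l a b h + ∑ l, freshSum z l b a h
        + ∑ m, ∑ l, doubleSum z l m a b h := by
  simp only [tupleSum, freshSum, doubleSum, avoidingPairSum]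
  simp only [← Summable.tsum_finsetSum (fun _ _ => ENNReal.summable), ← ENNReal.tsum_add]
  refine tsum_congr fun i => ?_
  rw [ite_injective_split i b, ite_split (fun h => h.1) a, add_assoc (_ + _)]
  congr 1
  rw [← Finset.sum_add_distrib]
  refine Finset.sum_congr rfl fun m _ => ?_
  rw [ite_split (fun h => h.1) a]
  congr 1
  exact if_congr (by tauto) rfl rfl

/-- Any tuple using `b` has a coordinate `0` and drops out, so two of the four classes of
`tupleSum_eq_of_pair` disappear. -/
theorem tupleSum_update_update [DecidableEq ι] (z : ι → ℝ) (a b : ι) (v : ℝ)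
    {h : (Fin k → ℝ) → ℝ≥0∞} (h0 : ∀ x ∉ orthant k, h x = 0) :
    tupleSum (update (update z a v) b 0) h
      = avoidingPairSum z a b h
        + ∑ l, freshSum z l a b (fun x => h (update x l v)) := by
  obtain rfl : ‹DecidableEq ι› = fun a b => Classical.propDecidable (a = b) :=
    Subsingleton.elim _ _
  simp only [tupleSum, freshSum, avoidingPairSum]
  simp only [← Summable.tsum_finsetSum (fun _ _ => ENNReal.summable), ← ENNReal.tsum_add]
  refine tsum_congr fun i => ?_
  rw [ite_injective_split i b, ite_split (fun h => h.1) a]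
  have h1 : ∑ l : Fin k, (if Injective i ∧ i l = b then
      h (fun j => update (update z a v) b 0 (i j)) else 0) = 0 := by
    refine Finset.sum_eq_zero fun l _ => ?_
    split_ifs with hi
    · exact h0 _ fun hx => by simpa [hi.2] using hx l
    · rfl
  rw [h1, add_zero]
  congr 1
  · split_ifs with hi
    · congr 1
      funext j
      rw [update_of_ne (hi.1.2 j), update_of_ne (hi.2 j)]
    · rfl
  · refine Finset.sum_congr rfl fun l _ => ?_
    split_ifs with hi
    · congr 1
      funext j
      rw [update_of_ne (hi.1.2 j)]
      rcases eq_or_ne j l with rfl | hj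
      · simp [hi.2]
      · rw [update_of_ne hj, update_of_ne]
        exact fun hc => hj (hi.1.1 (hc.trans hi.2.symm))
    · rfl

/-- The tuples avoiding both `a` and `b` contribute equally before and after the merge. The identity
is kept additive because subtraction is unreliable in `[0, ∞]`. On a tuple with index `a` at place
`l`, the merged value is `x l + z b`, which no longer mentions `a`. -/
theorem tupleSum_merge_balance {I : Set ℝ} (z : Cone I) {a b : ℕ} (hab : a ≠ b) (ha : 0 < z.1 a)
    (hb : 0 < z.1 b) {h : (Fin k → ℝ) → ℝ≥0∞} (h0 : ∀ x ∉ orthant k, h x = 0) :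
    tupleSum (merge a b z).1 h + (∑ l, freshSum z.1 l a b h + ∑ l, freshSum z.1 l b a h
        + ∑ m, ∑ l, doubleSum z.1 l m a b h)
      = tupleSum z.1 h + ∑ l, freshSum z.1 l a b (fun x => h (update x l (x l + z.1 b))) := by
  rw [tupleSum_merge z hab ha hb h0, tupleSum_update_update z.1 a b _ h0,
    tupleSum_eq_of_pair z.1 a b h]
  have h1 : ∀ l : Fin k, freshSum z.1 l a b (fun x => h (update x l (x l + z.1 b)))
      = freshSum z.1 l a b (fun x => h (update x l (z.1 a + z.1 b))) := by
    intro l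
    refine tsum_congr fun i => ?_
    split_ifs with hi
    · simp only [hi.2]
    · rfl
  simp only [h1]
  ring

/-- The unused index `b` is inserted immediately after place `l`, producing an injective tuple one
longer; `a` is then forced to be the index at place `l`. This is how the hierarchy climbs from order
`k` to `k + 1`. -/
theorem tsum_mul_freshSum (z : ι → ℝ) (l : Fin (n + 1)) (κ : ℝ → ℝ → ℝ≥0∞)
    (g : (Fin (n + 1) → ℝ) → ℝ → ℝ≥0∞) :
    ∑' p : ι × ι, κ (z p.1) (z p.2) * freshSum z l p.1 p.2 (fun x => g x (z p.2))
      = tupleSum z (fun x : Fin (n + 2) → ℝ =>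
          κ (x l.castSucc) (x l.succ) * g (l.succ.removeNth x) (x l.succ)) := by
  rw [tupleSum, ← (Fin.insertNthEquiv (fun _ => ι) l.succ).tsum_eq, ENNReal.tsum_prod',
    ENNReal.tsum_comm, ENNReal.tsum_prod']
  refine tsum_congr fun b => ?_
  simp only [freshSum, ← ENNReal.tsum_mul_left]
  rw [ENNReal.tsum_comm]
  refine tsum_congr fun i => ?_
  rw [tsum_eq_single (i l)]
  · change _ = if Injective (l.succ.insertNth (α := fun _ => ι) b i) then
      κ (z (l.succ.insertNth (α := fun _ => ι) b i l.castSucc))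
        (z (l.succ.insertNth (α := fun _ => ι) b i l.succ)) *
        g (l.succ.removeNth (fun j => z (l.succ.insertNth (α := fun _ => ι) b i j)))
          (z (l.succ.insertNth (α := fun _ => ι) b i l.succ)) else 0
    rw [if_congr injective_insertNth_iff rfl rfl, comp_insertNth, Fin.removeNth_insertNth,
      Fin.insertNth_apply_same]
    have h1 : l.succ.insertNth (α := fun _ => ι) b i l.castSucc = i l := by
      have := Fin.insertNth_apply_succAbove (α := fun _ => ι) l.succ b i l
      simpa using this
    rw [h1, mul_ite, mul_zero]
    simp
  · intro a ha
    rw [if_neg (fun hc => ha hc.2.symm), mul_zero]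

theorem tsum_mul_doubleSum (z : ι → ℝ) (l m : Fin k) (κ : ℝ → ℝ → ℝ≥0∞)
    (h : (Fin k → ℝ) → ℝ≥0∞) :
    ∑' p : ι × ι, κ (z p.1) (z p.2) * doubleSum z l m p.1 p.2 h
      = tupleSum z (fun x => κ (x l) (x m) * h x) := by
  simp only [doubleSum, tupleSum, ← ENNReal.tsum_mul_left]
  rw [ENNReal.tsum_comm]
  refine tsum_congr fun i => ?_
  rw [tsum_eq_single (i l, i m)]
  · simp
  · rintro ⟨a, b⟩ hab
    rw [if_neg, mul_zero]
    rintro ⟨⟨-, rfl⟩, rfl⟩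
    exact hab rfl

theorem coag_eq_update (l : Fin (n + 1)) (x : Fin (n + 2) → ℝ) :
    coag l x = update (l.succ.removeNth x) l (l.succ.removeNth x l + x l.succ) := by
  funext j
  have h1 : ∀ j : Fin (n + 1), l.succ.removeNth x j = x (l.succ.succAbove j) := fun j => rfl
  simp only [coag]
  rcases lt_trichotomy j l with hj | rfl | hj
  · rw [if_pos hj, update_of_ne hj.ne, h1, Fin.succAbove_of_castSucc_lt]
    exact Fin.castSucc_lt_succ_iff.2 hj.le
  · simp [h1]
  · rw [if_neg hj.not_gt, if_neg hj.ne', update_of_ne hj.ne', h1, Fin.succAbove_of_le_castSucc]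
    exact Fin.succ_le_castSucc_iff.2 hj

theorem dropNext_eq_removeNth (l : Fin (n + 1)) (x : Fin (n + 2) → ℝ) :
    dropNext l x = l.succ.removeNth x := by
  funext j
  have h1 : ∀ j : Fin (n + 1), l.succ.removeNth x j = x (l.succ.succAbove j) := fun j => rfl
  simp only [dropNext]
  rcases le_or_gt j l with hj | hj
  · rw [if_pos hj, h1, Fin.succAbove_of_castSucc_lt]
    exact Fin.castSucc_lt_succ_iff.2 hj
  · rw [if_neg hj.not_ge, h1, Fin.succAbove_of_le_castSucc]
    exact Fin.succ_le_castSucc_iff.2 hj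

theorem removeNth_succ_apply (l : Fin (n + 1)) (x : Fin (n + 2) → ℝ) :
    l.succ.removeNth x l = x l.castSucc := by
  simp [Fin.removeNth]

/-- Gain by coagulation, summed over ordered pairs. -/
theorem tsum_merge_gain [DecidableEq ι] (z : ι → ℝ) (κ : ℝ → ℝ → ℝ≥0∞) (hκ : ∀ x y, ¬(0 < x ∧ 0 < y) → κ x y = 0)
    (h : (Fin (n + 1) → ℝ) → ℝ≥0∞) :
    ∑' p : ι × ι, (if p.1 ≠ p.2 ∧ 0 < z p.1 * z p.2 then κ (z p.1) (z p.2) else 0)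
        * ∑ l, freshSum z l p.1 p.2 (fun x => h (update x l (x l + z p.2)))
      = ∑ l, tupleSum z (fun x : Fin (n + 2) → ℝ =>
          κ (x l.castSucc) (x l.succ) * h (coag l x)) := by
  simp only [Finset.mul_sum]
  rw [Summable.tsum_finsetSum (fun _ _ => ENNReal.summable)]
  refine Finset.sum_congr rfl fun l _ => ?_
  simp only [coag_eq_update]
  rw [← tsum_mul_freshSum z l κ (fun x b => h (update x l (x l + b)))]
  refine tsum_congr fun p => ?_
  split_ifs with hp
  · rfl
  -- Pairs excluded on the left contribute nothing on the right: no tuple both uses and avoids the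
  -- same index, and the kernel vanishes off the open quadrant.
  · by_cases h1 : p.1 = p.2
    · have : freshSum z l p.1 p.2 (fun x => h (update x l (x l + z p.2))) = 0 := by
        refine ENNReal.tsum_eq_zero.2 fun i => if_neg ?_
        rintro ⟨⟨-, h2⟩, h3⟩
        exact h2 l (h3.trans h1)
      rw [this, mul_zero, mul_zero]
    · rw [hκ, zero_mul]
      rintro ⟨h2, h3⟩
      exact hp ⟨h1, mul_pos h2 h3⟩

/-- Loss by coagulation, summed over ordered pairs. -/
theorem tsum_merge_loss [DecidableEq ι] (z : ι → ℝ) (κ : ℝ → ℝ → ℝ≥0∞) (hκ : ∀ x y, ¬(0 < x ∧ 0 < y) → κ x y = 0)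
    (hsymm : ∀ x y, κ x y = κ y x) (h : (Fin (n + 1) → ℝ) → ℝ≥0∞) :
    ∑' p : ι × ι, (if p.1 ≠ p.2 ∧ 0 < z p.1 * z p.2 then κ (z p.1) (z p.2) else 0)
        * (∑ l, freshSum z l p.1 p.2 h + ∑ l, freshSum z l p.2 p.1 h
          + ∑ m, ∑ l, doubleSum z l m p.1 p.2 h)
      = 2 * ∑ l, tupleSum z (fun x : Fin (n + 2) → ℝ =>
          κ (x l.castSucc) (x l.succ) * h (dropNext l x))
        + ∑ m, ∑ l, if l = m then 0 else tupleSum z (fun x => κ (x l) (x m) * h x) := by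
  have hfresh : ∑' p : ι × ι, (if p.1 ≠ p.2 ∧ 0 < z p.1 * z p.2 then κ (z p.1) (z p.2) else 0)
        * ∑ l, freshSum z l p.1 p.2 h
      = ∑ l, tupleSum z (fun x : Fin (n + 2) → ℝ =>
          κ (x l.castSucc) (x l.succ) * h (dropNext l x)) := by
    simp only [Finset.mul_sum]
    rw [Summable.tsum_finsetSum (fun _ _ => ENNReal.summable)]
    refine Finset.sum_congr rfl fun l _ => ?_
    simp only [dropNext_eq_removeNth]
    rw [← tsum_mul_freshSum z l κ (fun x _ => h x)]
    refine tsum_congr fun p => ?_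
    split_ifs with hp
    · rfl
    · by_cases h1 : p.1 = p.2
      · have : freshSum z l p.1 p.2 h = 0 := by
          refine ENNReal.tsum_eq_zero.2 fun i => if_neg ?_
          rintro ⟨⟨-, h2⟩, h3⟩
          exact h2 l (h3.trans h1)
        rw [this, mul_zero, mul_zero]
      · rw [hκ, zero_mul]
        rintro ⟨h2, h3⟩
        exact hp ⟨h1, mul_pos h2 h3⟩
  simp only [mul_add]
  rw [ENNReal.tsum_add, ENNReal.tsum_add, hfresh, two_mul]
  congr 1
  · congr 1
    -- Exchanging the members of the pair and using the symmetry of `κ` shows that the two fresh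
    -- sums have equal totals, whence the factor `2`.
    rw [← hfresh, ← (Equiv.prodComm ι ι).tsum_eq]
    refine tsum_congr fun p => ?_
    change (if p.2 ≠ p.1 ∧ 0 < z p.2 * z p.1 then κ (z p.2) (z p.1) else 0)
        * ∑ l, freshSum z l p.1 p.2 h
      = (if p.1 ≠ p.2 ∧ 0 < z p.1 * z p.2 then κ (z p.1) (z p.2) else 0)
        * ∑ l, freshSum z l p.1 p.2 h
    rw [hsymm (z p.2)]
    congr 1
    exact if_congr (by rw [ne_comm, mul_comm]) rfl rfl
  · simp only [Finset.mul_sum]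
    rw [Summable.tsum_finsetSum (fun _ _ => ENNReal.summable)]
    refine Finset.sum_congr rfl fun m _ => ?_
    rw [Summable.tsum_finsetSum (fun _ _ => ENNReal.summable)]
    refine Finset.sum_congr rfl fun l _ => ?_
    split_ifs with hlm
    · refine ENNReal.tsum_eq_zero.2 fun p => ?_
      split_ifs with hp
      · have : doubleSum z l m p.1 p.2 h = 0 := by
          refine ENNReal.tsum_eq_zero.2 fun i => if_neg ?_
          rintro ⟨⟨-, h2⟩, h3⟩
          exact hp.1 (h3.symm.trans (hlm ▸ h2))
        rw [this, mul_zero]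
      · rw [zero_mul]
    · rw [← tsum_mul_doubleSum]
      refine tsum_congr fun p => ?_
      split_ifs with hp
      · rfl
      · by_cases h1 : p.1 = p.2
        · have : doubleSum z l m p.1 p.2 h = 0 := by
            refine ENNReal.tsum_eq_zero.2 fun i => if_neg ?_
            rintro ⟨⟨h4, h2⟩, h3⟩
            exact hlm (h4 (h3.trans (h1.trans h2.symm)))
          rw [this, mul_zero, mul_zero]
        · rw [hκ, zero_mul]
          rintro ⟨h2, h3⟩
          exact hp ⟨h1, mul_pos h2 h3⟩

/-- A tuple of the split sequence uses neither piece, exactly one, or both. The first kind cancels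
against the tuples of `z` avoiding `a`; the last kind is the double sum. -/
theorem tupleSum_split_balance {I : Set ℝ} (z : Cone I) {a : ℕ} {y : ℝ} (hy : 0 < y)
    (hya : y < z.1 a) (h : (Fin (n + 1) → ℝ) → ℝ≥0∞) :
    tupleSum (split a y z).1 h + ∑ l, pinnedSum z.1 l a (z.1 a) h
      = tupleSum z.1 h + (∑ l, pinnedSum z.1 l a (z.1 a - y) h + ∑ l, pinnedSum z.1 l a y h
        + ∑ m : Fin (n + 1), ∑ l : Fin n,
          pinnedSum z.1 l a (z.1 a - y) (fun x => h (m.insertNth y x))) := by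
  have h1 := tupleSum_update (z := z.1) a (z.1 a) h
  rw [update_eq_self] at h1
  rw [tupleSum_split z hy hya, h1]
  simp only [tupleSum_update, avoidingSum_insertNth, Finset.sum_add_distrib]
  ring

/-- By Tonelli the sum over tuples comes out of the integral; for a given tuple only `a = i l`
survives. -/
theorem tsum_lintegral_pinned [Countable ι] (z : ι → ℝ) (l : Fin k)
    {G : ℝ → (Fin k → ℝ) → ℝ≥0∞} (hG : ∀ x, Measurable fun y => G y x) :
    ∑' a : ι, ∫⁻ y in Ioo 0 (z a), ∑' i : Fin k → ι,
        (if Injective i ∧ i l = a then G y (fun j => z (i j)) else 0)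
      = tupleSum z (fun x => ∫⁻ y in Ioo 0 (x l), G y x) := by
  have h1 : ∀ a : ι, ∫⁻ y in Ioo 0 (z a), ∑' i : Fin k → ι,
        (if Injective i ∧ i l = a then G y (fun j => z (i j)) else 0)
      = ∑' i : Fin k → ι, if i l = a then
          (if Injective i then ∫⁻ y in Ioo 0 (z (i l)), G y (fun j => z (i j)) else 0) else 0 := by
    intro a
    rw [lintegral_tsum]
    · refine tsum_congr fun i => ?_
      by_cases hi : Injective i <;> by_cases ha : i l = a <;> simp [hi, ha]
    · intro i
      split_ifs
      · exact (hG _).aemeasurable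
      · exact aemeasurable_const
  simp only [h1]
  rw [ENNReal.tsum_comm, tupleSum]
  refine tsum_congr fun i => ?_
  rw [tsum_eq_single (i l)]
  · simp
  · intro a ha
    rw [if_neg ha.symm]

theorem lintegral_Ioo_sub_left (G : ℝ → ℝ≥0∞) (a : ℝ) :
    ∫⁻ y in Ioo 0 a, G (a - y) = ∫⁻ y in Ioo 0 a, G y := by
  have h := (Measure.measurePreserving_sub_left (volume : Measure ℝ) a).setLIntegral_comp_preimage_emb
    (MeasurableEquiv.subLeft a).measurableEmbedding G (Ioo 0 a)
  simpa using h

variable {φ : ℝ → ℝ → ℝ≥0∞}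

theorem measurable_rate (hφ : Measurable (uncurry φ)) (a : ℝ) :
    Measurable fun y => φ y (a - y) :=
  hφ.comp (measurable_id.prodMk (measurable_const.sub measurable_id))

theorem tsum_lintegral_mul_pinnedSum [Countable ι] (hφ : Measurable (uncurry φ)) (z : ι → ℝ)
    (l : Fin k) {u : ℝ → ℝ → ℝ} {g : ℝ → ℝ → (Fin k → ℝ) → ℝ≥0∞}
    (hg : ∀ a x, Measurable fun y => g a y (update x l (u a y))) :
    ∑' a : ι, ∫⁻ y in Ioo 0 (z a), φ y (z a - y) * pinnedSum z l a (u (z a) y) (g (z a) y)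
      = tupleSum z (fun x => ∫⁻ y in Ioo 0 (x l),
          φ y (x l - y) * g (x l) y (update x l (u (x l) y))) := by
  rw [← tsum_lintegral_pinned z l
    (G := fun y x => φ y (x l - y) * g (x l) y (update x l (u (x l) y)))
    fun x => (measurable_rate hφ _).mul (hg _ _)]
  refine tsum_congr fun a => lintegral_congr fun y => ?_
  rw [pinnedSum, ← ENNReal.tsum_mul_left]
  refine tsum_congr fun i => ?_
  by_cases hi : Injective i <;> by_cases ha : i l = a <;> simp [hi, ha]

theorem measurable_pinnedSum [Countable ι] (z : ι → ℝ) (l : Fin k) (a : ι) {u : ℝ → ℝ}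
    {g : ℝ → (Fin k → ℝ) → ℝ≥0∞} (hg : ∀ x, Measurable fun y => g y (update x l (u y))) :
    Measurable fun y => pinnedSum z l a (u y) (g y) := by
  refine Measurable.tsum fun i => ?_
  split_ifs
  · exact hg _
  · exact measurable_const

/-- Loss by fragmentation. -/
theorem tsum_split_loss [Countable ι] (hφ : Measurable (uncurry φ)) (z : ι → ℝ)
    (h : (Fin k → ℝ) → ℝ≥0∞) :
    ∑' a : ι, ∫⁻ y in Ioo 0 (z a), φ y (z a - y) * ∑ l, pinnedSum z l a (z a) h
      = ∑ l, tupleSum z (fun x => (∫⁻ y in Ioo 0 (x l), φ y (x l - y)) * h x) := by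
  simp only [Finset.mul_sum]
  have h1 : ∀ a, ∫⁻ y in Ioo 0 (z a), ∑ l, φ y (z a - y) * pinnedSum z l a (z a) h
      = ∑ l, ∫⁻ y in Ioo 0 (z a), φ y (z a - y) * pinnedSum z l a (z a) h := fun a =>
    lintegral_finsetSum _ fun l _ => (measurable_rate hφ _).mul measurable_const
  simp only [h1]
  rw [Summable.tsum_finsetSum (fun _ _ => ENNReal.summable)]
  refine Finset.sum_congr rfl fun l _ => ?_
  rw [tsum_lintegral_mul_pinnedSum (u := fun a _ => a) (g := fun _ _ => h) hφ z l
    (fun _ _ => measurable_const)]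
  congr 1
  funext x
  rw [update_eq_self, lintegral_mul_const _ (measurable_rate hφ _)]

/-- The integral defining `term6`, for arbitrary positions. -/
def fragPair (φ : ℝ → ℝ → ℝ≥0∞) (h : (Fin (n + 1) → ℝ) → ℝ≥0∞) (l : Fin n) (m : Fin (n + 1))
    (x : Fin n → ℝ) : ℝ≥0∞ :=
  ∫⁻ y in Ioo 0 (x l), φ y (x l - y) * h (frag l m y x)

theorem measurable_insertNth_update {h : (Fin (n + 1) → ℝ) → ℝ≥0∞} (hh : Measurable h)
    (x : Fin n → ℝ) (l : Fin n) (m : Fin (n + 1)) (a : ℝ) :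
    Measurable fun y => h (m.insertNth y (update x l (a - y))) := by
  refine hh.comp (measurable_pi_iff.2 fun j => ?_)
  induction j using Fin.succAboveCases m with
  | x => simpa using measurable_id'
  | p j =>
    simp only [Fin.insertNth_apply_succAbove]
    by_cases hj : j = l
    · subst hj
      simp only [update_self]
      fun_prop
    · simp [update_of_ne hj]

/-- The reflection `y ↦ z a - y`, harmless as `φ` is symmetric, puts `y` at place `l` and `z a - y`
at the inserted place, as in `frag`. -/
theorem tsum_split_pair [Countable ι] (hφ : Measurable (uncurry φ)) (hsymm : ∀ x y, φ x y = φ y x)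
    (z : ι → ℝ) {h : (Fin (n + 1) → ℝ) → ℝ≥0∞} (hh : Measurable h) (l : Fin n) (m : Fin (n + 1)) :
    ∑' a : ι, ∫⁻ y in Ioo 0 (z a),
        φ y (z a - y) * pinnedSum z l a (z a - y) (fun x => h (m.insertNth y x))
      = tupleSum z (fragPair φ h l m) := by
  have h1 : ∀ a, ∫⁻ y in Ioo 0 (z a),
        φ y (z a - y) * pinnedSum z l a (z a - y) (fun x => h (m.insertNth y x))
      = ∫⁻ y in Ioo 0 (z a),
        φ y (z a - y) * pinnedSum z l a y (fun x => h (m.insertNth (z a - y) x)) := by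
    intro a
    rw [← lintegral_Ioo_sub_left]
    refine lintegral_congr fun y => ?_
    rw [sub_sub_cancel, hsymm]
  simp only [h1]
  rw [tsum_lintegral_mul_pinnedSum (u := fun _ y => y)
    (g := fun a y x => h (m.insertNth (a - y) x)) hφ z l]
  · rfl
  · intro a x
    refine hh.comp (measurable_pi_iff.2 fun j => ?_)
    induction j using Fin.succAboveCases m with
    | x =>
      simp only [Fin.insertNth_apply_same]
      fun_prop
    | p j =>
      simp only [Fin.insertNth_apply_succAbove]
      by_cases hj : j = l
      · subst hj; simpa using measurable_id'
      · simp [update_of_ne hj]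

/-- Two insertions commute up to a shift: the place lying further right is raised by one when the
other entry is inserted first. -/
theorem insertNth_castSucc_insertNth (v y : ℝ) {l m : Fin (n + 1)} (hml : m ≤ l)
    (r : Fin n → ℝ) :
    m.castSucc.insertNth (α := fun _ => ℝ) v (l.insertNth (α := fun _ => ℝ) y r)
      = l.succ.insertNth (α := fun _ => ℝ) y (m.insertNth (α := fun _ => ℝ) v r) := by
  funext j
  induction j using Fin.succAboveCases l.succ with
  | x =>
    have : l.succ = m.castSucc.succAbove l := by
      rw [Fin.succAbove_of_le_castSucc _ _ (Fin.castSucc_le_castSucc_iff.2 hml)]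
    rw [Fin.insertNth_apply_same]
    conv_lhs => rw [this]
    rw [Fin.insertNth_apply_succAbove, Fin.insertNth_apply_same]
  | p j =>
    rw [Fin.insertNth_apply_succAbove]
    induction j using Fin.succAboveCases m with
    | x =>
      have : l.succ.succAbove m = m.castSucc := by
        rw [Fin.succAbove_of_castSucc_lt _ _ (Fin.castSucc_lt_succ_iff.2 hml)]
      rw [this, Fin.insertNth_apply_same, Fin.insertNth_apply_same]
    | p j =>
      have : l.succ.succAbove (m.succAbove j) = m.castSucc.succAbove (l.succAbove j) := by
        have := Fin.le_def.1 hml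
        simp only [Fin.succAbove, Fin.lt_def, Fin.ext_iff]
        split_ifs <;> simp_all <;> omega
      rw [this]
      simp only [Fin.insertNth_apply_succAbove]

/-- Which piece is called `y` is immaterial. Reflecting `y` and moving place `l` to place `m` turns
a configuration with the second piece on the left into one with it on the right. -/
theorem fragPair_swap (hsymm : ∀ x y, φ x y = φ y x) (z : ι → ℝ)
    (h : (Fin (n + 2) → ℝ) → ℝ≥0∞) {l m : Fin (n + 1)} (hml : m ≤ l) :
    tupleSum z (fragPair φ h l m.castSucc) = tupleSum z (fragPair φ h m l.succ) := by
  rw [← tupleSum_insertNth_removeNth z l m (fragPair φ h m l.succ)]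
  congr 1
  funext x
  simp only [fragPair, Fin.insertNth_apply_same]
  rw [← lintegral_Ioo_sub_left]
  refine lintegral_congr fun y => ?_
  rw [sub_sub_cancel, hsymm]
  congr 2
  simp only [frag, Fin.insertNth_apply_same, sub_sub_cancel, Fin.update_insertNth]
  rw [← Fin.insertNth_removeNth (α := fun _ => ℝ) l]
  exact insertNth_castSucc_insertNth y (x l - y) hml _

/-- The pairs with `l.castSucc < m` are half of all pairs; `(l, m.castSucc) ↦ (m, l.succ)` maps the
other half, `m ≤ l`, onto them, with equal sums by `fragPair_swap`. -/
theorem sum_fragPair (hsymm : ∀ x y, φ x y = φ y x) (z : ι → ℝ) (h : (Fin (n + 1) → ℝ) → ℝ≥0∞) :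
    ∑ m : Fin (n + 1), ∑ l : Fin n, tupleSum z (fragPair φ h l m)
      = 2 * ∑ l : Fin n, ∑ m : Fin (n + 1),
          if l.castSucc < m then tupleSum z (fragPair φ h l m) else 0 := by
  cases n with
  | zero => simp
  | succ n =>
    rw [Finset.sum_comm, two_mul]
    have h1 : ∀ l : Fin (n + 1), ∑ m : Fin (n + 2), tupleSum z (fragPair φ h l m)
        = (∑ m : Fin (n + 2), if l.castSucc < m then tupleSum z (fragPair φ h l m) else 0)
          + ∑ m : Fin (n + 2), if l.castSucc < m then 0 else tupleSum z (fragPair φ h l m) := by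
      intro l
      rw [← Finset.sum_add_distrib]
      refine Finset.sum_congr rfl fun m _ => ?_
      split_ifs <;> simp
    simp only [h1, Finset.sum_add_distrib]
    congr 1
    have h2 : ∀ l : Fin (n + 1), (∑ m : Fin (n + 2), if l.castSucc < m then 0 else
          tupleSum z (fragPair φ h l m))
        = ∑ m : Fin (n + 1), if m ≤ l then tupleSum z (fragPair φ h m l.succ) else 0 := by
      intro l
      -- The last place always lies in the increasing half, so the remaining places have the form
      -- `m.castSucc`.
      rw [Fin.sum_univ_castSucc, if_pos (Fin.castSucc_lt_last l), add_zero]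
      refine Finset.sum_congr rfl fun m _ => ?_
      by_cases hml : m ≤ l
      · rw [if_pos hml, if_neg (not_lt.2 (Fin.castSucc_le_castSucc_iff.2 hml)),
          fragPair_swap hsymm z h hml]
      · rw [if_neg hml, if_pos (Fin.castSucc_lt_castSucc_iff.2 (not_le.1 hml))]
    simp only [h2]
    rw [Finset.sum_comm]
    refine Finset.sum_congr rfl fun m _ => ?_
    conv_rhs => rw [Fin.sum_univ_succ, if_neg (by simp), zero_add]
    refine Finset.sum_congr rfl fun l _ => ?_
    simp only [Fin.castSucc_lt_succ_iff]

/-- Gain by fragmentation. -/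
theorem tsum_split_gain [Countable ι] (hφ : Measurable (uncurry φ)) (hsymm : ∀ x y, φ x y = φ y x)
    (z : ι → ℝ) {h : (Fin (n + 1) → ℝ) → ℝ≥0∞} (hh : Measurable h) :
    ∑' a : ι, ∫⁻ y in Ioo 0 (z a), φ y (z a - y) * (∑ l, pinnedSum z l a (z a - y) h
        + ∑ l, pinnedSum z l a y h + ∑ m : Fin (n + 1), ∑ l : Fin n,
          pinnedSum z l a (z a - y) (fun x => h (m.insertNth y x)))
      = 2 * ∑ l, tupleSum z (fun x => ∫⁻ y in Ioo 0 (x l), φ y (x l - y) * h (update x l y))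
        + 2 * ∑ l : Fin n, ∑ m : Fin (n + 1),
          if l.castSucc < m then tupleSum z (fragPair φ h l m) else 0 := by
  have hup : ∀ (x : Fin (n + 1) → ℝ) (l : Fin (n + 1)), Measurable fun y => h (update x l y) :=
    fun x l => hh.comp (measurable_update x)
  have hup' : ∀ (x : Fin (n + 1) → ℝ) (l : Fin (n + 1)) (a : ℝ),
      Measurable fun y => h (update x l (a - y)) :=
    fun x l a => (hup x l).comp (measurable_const.sub measurable_id)
  have m1 : ∀ a (l : Fin (n + 1)), Measurable fun y => φ y (z a - y) * pinnedSum z l a (z a - y) h :=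
    fun a l => (measurable_rate hφ _).mul
      (measurable_pinnedSum z l a (u := fun y => z a - y) (g := fun _ => h) fun x => hup' x l _)
  have m2 : ∀ a (l : Fin (n + 1)), Measurable fun y => φ y (z a - y) * pinnedSum z l a y h :=
    fun a l => (measurable_rate hφ _).mul
      (measurable_pinnedSum z l a (u := fun y => y) (g := fun _ => h) fun x => hup x l)
  have m3 : ∀ a (m : Fin (n + 1)) (l : Fin n), Measurable fun y =>
      φ y (z a - y) * pinnedSum z l a (z a - y) (fun x => h (m.insertNth y x)) :=
    fun a m l => (measurable_rate hφ _).mul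
      (measurable_pinnedSum z l a (u := fun y => z a - y)
        (g := fun y x => h (m.insertNth y x)) fun x => measurable_insertNth_update hh x l m _)
  have h1 : ∀ a, ∫⁻ y in Ioo 0 (z a), φ y (z a - y) * (∑ l, pinnedSum z l a (z a - y) h
        + ∑ l, pinnedSum z l a y h + ∑ m : Fin (n + 1), ∑ l : Fin n,
          pinnedSum z l a (z a - y) (fun x => h (m.insertNth y x)))
      = ∑ l, (∫⁻ y in Ioo 0 (z a), φ y (z a - y) * pinnedSum z l a (z a - y) h)
        + ∑ l, (∫⁻ y in Ioo 0 (z a), φ y (z a - y) * pinnedSum z l a y h)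
        + ∑ m : Fin (n + 1), ∑ l : Fin n, ∫⁻ y in Ioo 0 (z a),
          φ y (z a - y) * pinnedSum z l a (z a - y) (fun x => h (m.insertNth y x)) := by
    intro a
    simp only [mul_add, Finset.mul_sum]
    have e1 : Measurable fun y => ∑ l, φ y (z a - y) * pinnedSum z l a (z a - y) h :=
      Finset.measurable_fun_sum _ fun l _ => m1 a l
    have e2 : Measurable fun y => ∑ l, φ y (z a - y) * pinnedSum z l a y h :=
      Finset.measurable_fun_sum _ fun l _ => m2 a l
    have e4 : Measurable fun y => (∑ l, φ y (z a - y) * pinnedSum z l a (z a - y) h)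
        + ∑ l, φ y (z a - y) * pinnedSum z l a y h := e1.add e2
    have e3 : ∀ m : Fin (n + 1), Measurable fun y => ∑ l : Fin n,
        φ y (z a - y) * pinnedSum z l a (z a - y) (fun x => h (m.insertNth y x)) :=
      fun m => Finset.measurable_fun_sum _ fun l _ => m3 a m l
    rw [lintegral_add_left e4, lintegral_add_left e1,
      lintegral_finsetSum _ fun l _ => m1 a l, lintegral_finsetSum _ fun l _ => m2 a l,
      lintegral_finsetSum _ fun m _ => e3 m]
    congr 1
    exact Finset.sum_congr rfl fun m _ => lintegral_finsetSum _ fun l _ => m3 a m l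
  simp only [h1]
  rw [ENNReal.tsum_add, ENNReal.tsum_add, ← sum_fragPair hsymm, two_mul]
  -- The pieces `y` and `z a - y` have the same distribution under the symmetric rate, which gives
  -- the first factor `2`.
  have h2 : ∀ (l : Fin (n + 1)) (a : ι),
      ∫⁻ y in Ioo 0 (z a), φ y (z a - y) * pinnedSum z l a (z a - y) h
        = ∫⁻ y in Ioo 0 (z a), φ y (z a - y) * pinnedSum z l a y h := by
    intro l a
    rw [← lintegral_Ioo_sub_left]
    refine lintegral_congr fun y => ?_
    rw [sub_sub_cancel, hsymm]
  have h3 : ∀ l : Fin (n + 1), ∑' a, ∫⁻ y in Ioo 0 (z a), φ y (z a - y) * pinnedSum z l a y h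
      = tupleSum z (fun x => ∫⁻ y in Ioo 0 (x l), φ y (x l - y) * h (update x l y)) := fun l =>
    tsum_lintegral_mul_pinnedSum (u := fun _ y => y) (g := fun _ _ => h) hφ z l
      (fun _ x => hup x l)
  simp only [h2]
  congr 1
  · rw [Summable.tsum_finsetSum (fun _ _ => ENNReal.summable)]
    simp only [h3]
  · rw [Summable.tsum_finsetSum (fun _ _ => ENNReal.summable)]
    refine Finset.sum_congr rfl fun m _ => ?_
    rw [Summable.tsum_finsetSum (fun _ _ => ENNReal.summable)]
    exact Finset.sum_congr rfl fun l _ => tsum_split_pair hφ hsymm z hh l m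

end Balance

/-! ### Factorial measures as tuple sums, and their bounds by the mass. -/

section FactorialMeasure

variable {k n : ℕ}

instance : Countable (Fin k ↪ ℕ) := DFunLike.coe_injective.countable

theorem lintegral_factorialMeasure_eq_tsum (z : ℕ → ℝ) (h : (Fin k → ℝ) → ℝ≥0∞) :
    ∫⁻ x, h x ∂factorialMeasure k z
      = ∑' i : Fin k ↪ ℕ, if ∀ l, 0 < z (i l) then h (fun l => z (i l)) else 0 := by
  rw [factorialMeasure, lintegral_sum_measure]
  refine tsum_congr fun i => ?_
  split_ifs
  · rw [lintegral_dirac]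
  · rw [lintegral_zero_measure]

theorem lintegral_factorialMeasure (z : ℕ → ℝ) {h : (Fin k → ℝ) → ℝ≥0∞}
    (h0 : ∀ x ∉ orthant k, h x = 0) :
    ∫⁻ x, h x ∂factorialMeasure k z = tupleSum z h := by
  have h1 : tupleSum z h = ∑' i : Fin k → ℕ,
      {i : Fin k → ℕ | Injective i}.indicator (fun i => h (fun j => z (i j))) i :=
    tsum_congr fun i => by by_cases hi : Injective i <;> simp [hi]
  rw [lintegral_factorialMeasure_eq_tsum, h1, ← tsum_subtype,
    ← (Equiv.subtypeInjectiveEquivEmbedding (Fin k) ℕ).tsum_eq]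
  refine tsum_congr fun i => ?_
  by_cases hi : ∀ l, 0 < z (i.1 l)
  · exact if_pos hi
  · rw [h0 (fun j => z (i.1 j)) hi]
    exact if_neg hi

theorem measurable_factorialMeasure (k : ℕ) :
    Measurable fun z : ℕ → ℝ => factorialMeasure k z := by
  refine Measure.measurable_of_measurable_coe _ fun s hs => ?_
  simp only [factorialMeasure, Measure.sum_apply _ hs]
  refine Measurable.tsum fun i => ?_
  have h1 : MeasurableSet {z : ℕ → ℝ | ∀ l, 0 < z (i l)} := by
    rw [ofPred_forall]
    exact MeasurableSet.iInter fun l => measurableSet_lt measurable_const (measurable_pi_apply _)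
  have h2 : Measurable fun z : ℕ → ℝ => Measure.dirac (fun l => z (i l)) s :=
    (Measure.measurable_coe hs).comp
      (Measure.measurable_dirac.comp (measurable_pi_lambda _ fun l => measurable_pi_apply _))
  have h3 : (fun z : ℕ → ℝ => (if ∀ l, 0 < z (i l) then Measure.dirac (fun l => z (i l)) else 0 :
      Measure (Fin k → ℝ)) s)
      = {z : ℕ → ℝ | ∀ l, 0 < z (i l)}.indicator
        (fun z => Measure.dirac (fun l => z (i l)) s) := by
    funext z
    by_cases hz : ∀ l, 0 < z (i l)
    · rw [if_pos hz, indicator_of_mem (by exact hz)]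
    · rw [if_neg hz, indicator_of_notMem (by exact hz)]; rfl
  rw [h3]
  exact h2.indicator h1

theorem ae_factorialMeasure {z : ℕ → ℝ} {p : (Fin k → ℝ) → Prop}
    (hp : ∀ i : Fin k → ℕ, Injective i → (∀ l, 0 < z (i l)) → p (fun l => z (i l))) :
    ∀ᵐ x ∂factorialMeasure k z, p x := by
  rw [factorialMeasure, Measure.ae_sum_iff]
  intro i
  split_ifs with hi
  · rw [ae_dirac_eq]
    exact hp i i.injective hi
  · simp

theorem tsum_pi_prod (k : ℕ) (a : ℕ → ℝ≥0∞) :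
    ∑' i : Fin k → ℕ, ∏ l, a (i l) = (∑' n, a n) ^ k := by
  induction k with
  | zero => simp [tsum_fintype]
  | succ k ih =>
    rw [← (Fin.consEquiv fun _ => ℕ).tsum_eq, ENNReal.tsum_prod', pow_succ', ← ENNReal.tsum_mul_right]
    refine tsum_congr fun b => ?_
    rw [← ih, ← ENNReal.tsum_mul_left]
    refine tsum_congr fun i => ?_
    rw [Fin.prod_univ_succ]
    simp [Fin.consEquiv]

/-- Domination by `C ∏ x_l (1 + ∑ x_l)^N` on the orthant; such functions have integrals with
respect to the factorial measures that are bounded by a polynomial in the mass. -/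
def MassBounded (h : (Fin k → ℝ) → ℝ) : Prop :=
  ∃ C, 0 ≤ C ∧ ∃ N : ℕ, ∀ x ∈ orthant k, h x ≤ C * ((∏ l, x l) * (1 + ∑ l, x l) ^ N)

theorem sum_comp_le_tsum {z : ℕ → ℝ} (hz : IsSizeSeq z) {i : Fin k → ℕ} (hi : Injective i) :
    ∑ l, z (i l) ≤ ∑' n, z n := by
  have h1 : ∑ l, z (i l) = ∑ m ∈ Finset.univ.map ⟨i, hi⟩, z m := by
    rw [Finset.sum_map]; rfl
  rw [h1]
  exact hz.summable.sum_le_tsum _ fun m _ => hz.nonneg m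

/-- The coordinates of a tuple have distinct indices, so their sum is at most the mass `m`. Once
injectivity is dropped, the products sum to `m ^ k`. Hence the exponent `k + N`. -/
theorem MassBounded.lintegral_le {h : (Fin k → ℝ) → ℝ} (hh : MassBounded h) :
    ∃ C, 0 ≤ C ∧ ∃ p : ℕ, ∀ z, IsSizeSeq z →
      ∫⁻ x, ENNReal.ofReal (h x) ∂factorialMeasure k z
        ≤ ENNReal.ofReal (C * (1 + ∑' n, z n) ^ p) := by
  obtain ⟨C, hC, N, hN⟩ := hh
  refine ⟨C, hC, k + N, fun z hz => ?_⟩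
  set m := ∑' n, z n with hm
  have hm0 : 0 ≤ m := tsum_nonneg hz.nonneg
  rw [lintegral_factorialMeasure_eq_tsum]
  have hmE : ENNReal.ofReal m = ∑' n, ENNReal.ofReal (z n) :=
    ENNReal.ofReal_tsum_of_nonneg hz.nonneg hz.summable
  calc ∑' i : Fin k ↪ ℕ, (if ∀ l, 0 < z (i l) then ENNReal.ofReal (h fun l => z (i l)) else 0)
      ≤ ∑' i : Fin k ↪ ℕ, ENNReal.ofReal (C * (1 + m) ^ N) * ∏ l, ENNReal.ofReal (z (i l)) := by
        refine ENNReal.tsum_le_tsum fun i => ?_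
        split_ifs with hi
        · rw [← ENNReal.ofReal_prod_of_nonneg fun l _ => (hi l).le,
            ← ENNReal.ofReal_mul (by positivity)]
          refine ENNReal.ofReal_le_ofReal ((hN _ hi).trans ?_)
          rw [mul_assoc, mul_comm (∏ l, _)]
          have h1 : ∑ l, z (i l) ≤ m := sum_comp_le_tsum hz i.injective
          have h2 : 0 ≤ ∑ l, z (i l) := Finset.sum_nonneg fun l _ => (hi l).le
          have h3 : 0 ≤ ∏ l, z (i l) := Finset.prod_nonneg fun l _ => (hi l).le
          gcongr
        · exact zero_le
    _ = ENNReal.ofReal (C * (1 + m) ^ N)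
          * ∑' i : Fin k ↪ ℕ, ∏ l, ENNReal.ofReal (z (i l)) := ENNReal.tsum_mul_left
    _ ≤ ENNReal.ofReal (C * (1 + m) ^ N) * ENNReal.ofReal m ^ k := by
        gcongr
        rw [hmE, ← tsum_pi_prod]
        exact ENNReal.tsum_comp_le_tsum_of_injective (f := fun i : Fin k ↪ ℕ => (i : Fin k → ℕ))
          DFunLike.coe_injective fun i => ∏ l, ENNReal.ofReal (z (i l))
    _ ≤ ENNReal.ofReal (C * (1 + m) ^ (k + N)) := by
        rw [← ENNReal.ofReal_pow hm0, ← ENNReal.ofReal_mul (by positivity)]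
        refine ENNReal.ofReal_le_ofReal ?_
        rw [mul_assoc, pow_add, mul_comm ((1 + m) ^ k)]
        gcongr
        linarith

end FactorialMeasure

/-! ### Correlation measures of processes with bounded mass moments. -/

section Correlation

variable {I : Set ℝ} {S : Type*} {mS : MeasurableSpace S} {P : Measure S} {k n : ℕ}

theorem measurable_factorialMeasure_comp {T : Type*} [MeasurableSpace T] {Y : T → Cone I}
    (hY : Measurable Y) (k : ℕ) : Measurable fun ω => factorialMeasure k (Y ω).1 :=
  (measurable_factorialMeasure k).comp (measurable_subtype_coe.comp hY)

theorem measurable_lintegral_factorialMeasure {T : Type*} [MeasurableSpace T] {Y : T → Cone I}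
    (hY : Measurable Y) {h : (Fin k → ℝ) → ℝ≥0∞} (hh : Measurable h) :
    Measurable fun ω => ∫⁻ x, h x ∂factorialMeasure k (Y ω).1 :=
  (Measure.measurable_lintegral hh).comp (measurable_factorialMeasure_comp hY k)

theorem lintegral_correlationMeasure {Y : S → Cone I} (hY : Measurable Y)
    {h : (Fin k → ℝ) → ℝ≥0∞} (hh : Measurable h) :
    ∫⁻ x, h x ∂correlationMeasure P Y k = ∫⁻ ω, ∫⁻ x, h x ∂factorialMeasure k (Y ω).1 ∂P :=
  Measure.lintegral_bind (measurable_factorialMeasure_comp hY k).aemeasurable hh.aemeasurable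

theorem ae_correlationMeasure {Y : S → Cone I} (hY : Measurable Y) {p : (Fin k → ℝ) → Prop}
    (hpm : MeasurableSet {x | p x})
    (hp : ∀ z : Cone I, ∀ i : Fin k → ℕ, Injective i → (∀ l, 0 < z.1 (i l)) →
      p (fun l => z.1 (i l))) :
    ∀ᵐ x ∂correlationMeasure P Y k, p x := by
  have h1 : correlationMeasure P Y k {x | p x}ᶜ = 0 := by
    rw [correlationMeasure, Measure.bind_apply hpm.compl
      (measurable_factorialMeasure_comp hY k).aemeasurable]
    refine lintegral_eq_zero_of_ae_eq_zero (Filter.Eventually.of_forall fun ω => ?_)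
    exact ae_factorialMeasure (hp (Y ω))
  exact h1

theorem measurable_mass : Measurable (mass : Cone I → ℝ) := by
  have h1 : ∀ z : Cone I, mass z = (∑' i, ENNReal.ofReal (z.1 i)).toReal := fun z => by
    rw [← ENNReal.ofReal_tsum_of_nonneg z.2.1.nonneg z.2.1.summable,
      ENNReal.toReal_ofReal (tsum_nonneg z.2.1.nonneg)]
    rfl
  simp only [funext h1]
  refine ENNReal.measurable_toReal.comp (Measurable.tsum fun i => ?_)
  exact ENNReal.measurable_ofReal.comp ((measurable_pi_apply i).comp measurable_subtype_coe)

theorem mass_nonneg (z : Cone I) : 0 ≤ mass z := tsum_nonneg z.2.1.nonneg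

/-- A jointly measurable process whose mass has moments bounded uniformly in time. -/
structure HasMassMoments (P : Measure S) (Z : ℝ≥0 → S → Cone I) : Prop where
  measurable : Measurable (fun q : ℝ≥0 × S => Z q.1 q.2)
  moments : ∀ p : ℕ, ∃ M : ℝ≥0∞, M < ∞ ∧
    ∀ t, ∫⁻ ω, ENNReal.ofReal ((1 + mass (Z t ω)) ^ p) ∂P ≤ M

namespace HasMassMoments

variable {Z : ℝ≥0 → S → Cone I}

theorem measurable_apply (hZ : HasMassMoments P Z) (t : ℝ≥0) : Measurable (Z t) :=
  hZ.measurable.comp (measurable_const.prodMk measurable_id)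

theorem measurable_real (hZ : HasMassMoments P Z) :
    Measurable (fun q : ℝ × S => Z q.1.toNNReal q.2) :=
  hZ.measurable.comp ((measurable_real_toNNReal.comp measurable_fst).prodMk measurable_snd)

theorem lintegral_le (hZ : HasMassMoments P Z) {h : (Fin k → ℝ) → ℝ} (hb : MassBounded h) :
    ∃ M : ℝ≥0∞, M < ∞ ∧ ∀ t,
      ∫⁻ ω, ∫⁻ x, ENNReal.ofReal (h x) ∂factorialMeasure k (Z t ω).1 ∂P ≤ M := by
  obtain ⟨C, hC, p, hp⟩ := hb.lintegral_le
  obtain ⟨M, hM, hMp⟩ := hZ.moments p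
  refine ⟨ENNReal.ofReal C * M, ENNReal.mul_lt_top ENNReal.ofReal_lt_top hM, fun t => ?_⟩
  calc _ ≤ ∫⁻ ω, ENNReal.ofReal C * ENNReal.ofReal ((1 + mass (Z t ω)) ^ p) ∂P := by
        refine lintegral_mono fun ω => ?_
        rw [← ENNReal.ofReal_mul hC]
        exact hp _ (Z t ω).2.1
    _ = ENNReal.ofReal C * ∫⁻ ω, ENNReal.ofReal ((1 + mass (Z t ω)) ^ p) ∂P :=
        lintegral_const_mul' _ _ ENNReal.ofReal_ne_top
    _ ≤ _ := by gcongr; exact hMp t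

theorem locIntegrable [SFinite P] (hZ : HasMassMoments P Z) {h : (Fin k → ℝ) → ℝ}
    (hm : Measurable h) (hb : MassBounded h) :
    LocIntegrable fun t => ∫⁻ x, ENNReal.ofReal (h x) ∂correlationMeasure P (Z t) k := by
  intro T
  have hm' : Measurable fun x => ENNReal.ofReal (h x) := hm.ennreal_ofReal
  simp only [fun t => lintegral_correlationMeasure (P := P) (hZ.measurable_apply t) hm']
  have h1 := (measurable_lintegral_factorialMeasure hZ.measurable_real hm').lintegral_prod_right'
    (ν := P)
  refine ⟨h1.aemeasurable, ?_⟩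
  obtain ⟨M, hM, hMt⟩ := hZ.lintegral_le hb
  calc _ ≤ ∫⁻ t in Icc 0 T, M := lintegral_mono fun t => hMt _
    _ < ∞ := by
      rw [setLIntegral_const]
      exact ENNReal.mul_lt_top hM (by simp)

/-- A nonnegative measurable function that is bounded in terms of the mass. -/
structure _root_.CoagFrag.IsWeight (h : (Fin k → ℝ) → ℝ) : Prop where
  measurable : Measurable h
  nonneg : ∀ x, 0 ≤ h x
  bounded : MassBounded h

/-- The integral of `h` against the factorial measure of `z`. -/
def _root_.CoagFrag.pairing (h : (Fin k → ℝ) → ℝ) (z : Cone I) : ℝ :=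
  (∫⁻ x, ENNReal.ofReal (h x) ∂factorialMeasure k z.1).toReal

theorem _root_.CoagFrag.IsWeight.lintegral_lt_top {h : (Fin k → ℝ) → ℝ} (hh : IsWeight h)
    (z : Cone I) : ∫⁻ x, ENNReal.ofReal (h x) ∂factorialMeasure k z.1 < ∞ := by
  obtain ⟨C, hC, p, hp⟩ := hh.bounded.lintegral_le
  exact (hp _ z.2.1).trans_lt ENNReal.ofReal_lt_top

theorem _root_.CoagFrag.IsWeight.measurable_pairing {h : (Fin k → ℝ) → ℝ} (hh : IsWeight h) :
    Measurable (pairing h : Cone I → ℝ) :=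
  ENNReal.measurable_toReal.comp
    (measurable_lintegral_factorialMeasure measurable_id hh.measurable.ennreal_ofReal)

theorem _root_.CoagFrag.pairing_nonneg (h : (Fin k → ℝ) → ℝ) (z : Cone I) : 0 ≤ pairing h z :=
  ENNReal.toReal_nonneg

theorem _root_.CoagFrag.IsWeight.pairing_le {h : (Fin k → ℝ) → ℝ} (hh : IsWeight h) :
    ∃ C, 0 ≤ C ∧ ∃ p : ℕ, ∀ z : Cone I, pairing h z ≤ C * (1 + mass z) ^ p := by
  obtain ⟨C, hC, p, hp⟩ := hh.bounded.lintegral_le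
  refine ⟨C, hC, p, fun z => ?_⟩
  have h0 := mass_nonneg z
  refine ENNReal.toReal_le_of_le_ofReal (by positivity) (hp _ z.2.1)

variable {h : (Fin k → ℝ) → ℝ}

theorem integrable_correlation (hZ : HasMassMoments P Z) (hh : IsWeight h) (t : ℝ≥0) :
    Integrable h (correlationMeasure P (Z t) k) := by
  refine ⟨hh.measurable.aestronglyMeasurable, ?_⟩
  rw [hasFiniteIntegral_iff_ofReal (Filter.Eventually.of_forall hh.nonneg),
    lintegral_correlationMeasure (hZ.measurable_apply t) hh.measurable.ennreal_ofReal]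
  obtain ⟨M, hM, hMt⟩ := hZ.lintegral_le hh.bounded
  exact (hMt t).trans_lt hM

/-- Campbell's formula: an integral against the mean measure is the expected integral. -/
theorem integral_correlation (hZ : HasMassMoments P Z) (hh : IsWeight h) (t : ℝ≥0) :
    ∫ x, h x ∂correlationMeasure P (Z t) k = ∫ ω, pairing h (Z t ω) ∂P := by
  rw [integral_eq_lintegral_of_nonneg_ae (Filter.Eventually.of_forall hh.nonneg)
      hh.measurable.aestronglyMeasurable,
    lintegral_correlationMeasure (hZ.measurable_apply t) hh.measurable.ennreal_ofReal]
  simp only [pairing]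
  rw [integral_toReal]
  · exact (measurable_lintegral_factorialMeasure (hZ.measurable_apply t)
      hh.measurable.ennreal_ofReal).aemeasurable
  · exact Filter.Eventually.of_forall fun ω => hh.lintegral_lt_top _

theorem integrable_pairing (hZ : HasMassMoments P Z) (hh : IsWeight h) (t : ℝ≥0) :
    Integrable (fun ω => pairing h (Z t ω)) P := by
  obtain ⟨M, hM, hMt⟩ := hZ.lintegral_le hh.bounded
  exact integrable_toReal_of_lintegral_ne_top
    (measurable_lintegral_factorialMeasure (hZ.measurable_apply t)
      hh.measurable.ennreal_ofReal).aemeasurable ((hMt t).trans_lt hM).ne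

theorem integrable_pairing_prod [SFinite P] (hZ : HasMassMoments P Z) (hh : IsWeight h) (t : ℝ≥0) :
    Integrable (fun q : ℝ × S => pairing h (Z q.1.toNNReal q.2))
      ((volume.restrict (Ioc (0 : ℝ) t)).prod P) := by
  have h1 := measurable_lintegral_factorialMeasure hZ.measurable_real
    hh.measurable.ennreal_ofReal
  refine integrable_toReal_of_lintegral_ne_top h1.aemeasurable ?_
  rw [lintegral_prod _ h1.aemeasurable]
  obtain ⟨M, hM, hMt⟩ := hZ.lintegral_le hh.bounded
  refine ne_of_lt ?_
  calc _ ≤ ∫⁻ s in Ioc (0 : ℝ) t, M := lintegral_mono fun s => hMt _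
    _ < ∞ := by
      rw [setLIntegral_const]
      exact ENNReal.mul_lt_top hM (by simp)

theorem timeSpaceIntegrable [SFinite P] (hZ : HasMassMoments P Z) (hh : IsWeight h) (t : ℝ≥0) :
    TimeSpaceIntegrable (fun t k => correlationMeasure P (Z t) k) t h := by
  refine ⟨Filter.Eventually.of_forall fun s => hZ.integrable_correlation hh _, ?_⟩
  simp only [fun s : ℝ => hZ.integral_correlation hh s.toNNReal]
  exact (hZ.integrable_pairing_prod hh t).integral_prod_left

/-- Written over the product of time and probability space, the terms of the hierarchy can be
compared with the martingale identity under a single measure. -/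
theorem timeSpaceIntegral_eq [SFinite P] (hZ : HasMassMoments P Z) (hh : IsWeight h) (t : ℝ≥0) :
    timeSpaceIntegral (fun t k => correlationMeasure P (Z t) k) t h
      = ∫ q, pairing h (Z q.1.toNNReal q.2) ∂((volume.restrict (Ioc (0 : ℝ) t)).prod P) := by
  rw [timeSpaceIntegral, integral_prod _ (hZ.integrable_pairing_prod hh t)]
  simp only [fun s : ℝ => hZ.integral_correlation hh s.toNNReal]

end HasMassMoments

end Correlation

/-! ### Polynomial mass bounds for the integrands of the hierarchy. -/

section Weights

variable {k n : ℕ}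

theorem IsTest.eq_zero {f : (Fin k → ℝ) → ℝ} (hf : IsTest f) {x : Fin k → ℝ} (hx : x ∉ orthant k) :
    f x = 0 := by
  obtain ⟨C, hC, -, h⟩ := hf.compact_support
  exact h x fun hxC => hx (hC hxC)

/-- On a compact subset of the open orthant the coordinates stay away from `0`. One constant serves
every `s`, so that each integrand can leave to the kernel the coordinates that the kernel already
supplies. -/
theorem IsTest.exists_le_prod {f : (Fin k → ℝ) → ℝ} (hf : IsTest f) :
    ∃ C, 0 ≤ C ∧ ∀ x ∈ orthant k, ∀ s : Finset (Fin k), f x ≤ C * ∏ j ∈ s, x j := by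
  obtain ⟨D, hD, hDc, h⟩ := hf.compact_support
  obtain ⟨B, hB⟩ := hf.bounded
  rcases D.eq_empty_or_nonempty with rfl | hne
  · refine ⟨0, le_rfl, fun x _ s => ?_⟩
    rw [h x (notMem_empty x), zero_mul]
  -- Truncation at `1` makes the full product at most every partial product, so its minimum over the
  -- support bounds them all from below.
  have hcont : Continuous fun x : Fin k → ℝ => ∏ j, min (x j) 1 := by fun_prop
  obtain ⟨x₀, hx₀, hmin⟩ := hDc.exists_isMinOn hne hcont.continuousOn
  set δ := ∏ j, min (x₀ j) 1 with hδ
  have hδ0 : 0 < δ := Finset.prod_pos fun j _ => lt_min (hD hx₀ j) one_pos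
  have hB0 : 0 ≤ B := (hf.nonneg 0).trans (hB 0)
  refine ⟨B / δ, by positivity, fun x hx s => ?_⟩
  have hs0 : 0 ≤ ∏ j ∈ s, x j := Finset.prod_nonneg fun j _ => (hx j).le
  by_cases hxD : x ∈ D
  · have h1 : δ ≤ ∏ j ∈ s, x j := by
      calc δ ≤ ∏ j, min (x j) 1 := hmin hxD
        _ ≤ ∏ j ∈ s, min (x j) 1 := by
          refine Finset.prod_le_prod_of_subset_of_le_one (Finset.subset_univ s)
            (fun j _ => le_min (hx j).le zero_le_one) fun j _ _ => min_le_right _ _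
        _ ≤ ∏ j ∈ s, x j := Finset.prod_le_prod (fun j _ => le_min (hx j).le zero_le_one)
          fun j _ => min_le_left _ _
    calc f x ≤ B := hB x
      _ = B / δ * δ := by field_simp
      _ ≤ _ := by gcongr
  · rw [h x hxD]
    positivity

theorem prod_eq_mul_mul (x : Fin (n + 2) → ℝ) (l : Fin (n + 1)) :
    ∏ j, x j = x l.castSucc * x l.succ * ∏ j ∈ Finset.univ.erase l, l.succ.removeNth x j := by
  rw [Fin.prod_univ_succAbove x l.succ, ← removeNth_succ_apply l x,
    mul_comm (l.succ.removeNth x l), mul_assoc, Finset.mul_prod_erase _ _ (Finset.mem_univ l)]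
  rfl

theorem le_sum_of_mem_orthant {x : Fin k → ℝ} (hx : x ∈ orthant k) (l : Fin k) :
    x l ≤ ∑ j, x j :=
  Finset.single_le_sum (fun j _ => (hx j).le) (Finset.mem_univ l)

theorem add_le_sum_of_mem_orthant {x : Fin k → ℝ} (hx : x ∈ orthant k) {l m : Fin k}
    (hlm : l ≠ m) : x l + x m ≤ ∑ j, x j := by
  rw [← Finset.sum_pair hlm]
  exact Finset.sum_le_sum_of_subset_of_nonneg (Finset.subset_univ _) fun j _ _ => (hx j).le

/-- Globally measurable symmetric kernels, polynomially bounded. -/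
structure IsKernelPair (K F : ℝ → ℝ → ℝ) : Prop where
  measurable_coag : Measurable (uncurry K)
  measurable_frag : Measurable (uncurry F)
  coag_nonneg : ∀ x y, 0 ≤ K x y
  frag_nonneg : ∀ x y, 0 ≤ F x y
  coag_symm : ∀ x y, K x y = K y x
  frag_symm : ∀ x y, F x y = F y x
  coag_zero : ∀ x y, ¬(0 < x ∧ 0 < y) → K x y = 0
  coag_le : ∃ C, 0 ≤ C ∧ ∃ N : ℕ, ∀ x y, 0 < x → 0 < y → K x y ≤ C * (x * y * (1 + (x + y)) ^ N)
  frag_le : ∃ C, 0 ≤ C ∧ ∃ N : ℕ, ∀ x, 0 < x →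
    ∫⁻ y in Ioo 0 x, ENNReal.ofReal (F y (x - y)) ≤ ENNReal.ofReal (C * (x * (1 + x) ^ N))

/-- The kernel supplies the coordinates `l` and `l + 1` of the product through its factor `xy`; `g`
supplies the others. -/
theorem massBounded_mul_coag {κ : ℝ → ℝ → ℝ} {C : ℝ} (hC : 0 ≤ C) {N : ℕ}
    (hκ : ∀ x y, 0 < x → 0 < y → κ x y ≤ C * (x * y * (1 + (x + y)) ^ N)) (l : Fin (n + 1))
    {g : (Fin (n + 2) → ℝ) → ℝ} {D : ℝ} (hD : 0 ≤ D) (hg0 : ∀ x ∈ orthant (n + 2), 0 ≤ g x)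
    (hg : ∀ x ∈ orthant (n + 2), g x ≤ D * ∏ j ∈ Finset.univ.erase l, l.succ.removeNth x j) :
    MassBounded fun x : Fin (n + 2) → ℝ => κ (x l.castSucc) (x l.succ) * g x := by
  refine ⟨C * D, by positivity, N, fun x hx => ?_⟩
  have h1 := hκ _ _ (hx l.castSucc) (hx l.succ)
  have h2 := add_le_sum_of_mem_orthant hx (Fin.castSucc_lt_succ (i := l)).ne
  have hp : 0 ≤ ∏ j ∈ Finset.univ.erase l, l.succ.removeNth x j :=
    Finset.prod_nonneg fun _ _ => (hx _).le
  have ha := hx l.castSucc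
  have hb := hx l.succ
  rw [prod_eq_mul_mul x l]
  calc κ (x l.castSucc) (x l.succ) * g x
      ≤ (C * (x l.castSucc * x l.succ * (1 + (x l.castSucc + x l.succ)) ^ N))
          * (D * ∏ j ∈ Finset.univ.erase l, l.succ.removeNth x j) := by
        refine mul_le_mul h1 (hg x hx) (hg0 x hx) (by positivity)
    _ ≤ (C * (x l.castSucc * x l.succ * (1 + ∑ j, x j) ^ N))
          * (D * ∏ j ∈ Finset.univ.erase l, l.succ.removeNth x j) := by gcongr
    _ = _ := by ring

theorem removeNth_mem_orthant {x : Fin (n + 1) → ℝ} (hx : x ∈ orthant (n + 1)) (l : Fin (n + 1)) :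
    l.removeNth x ∈ orthant n := fun _ => hx _

theorem coag_mem_orthant {x : Fin (n + 2) → ℝ} (hx : x ∈ orthant (n + 2)) (l : Fin (n + 1)) :
    coag l x ∈ orthant (n + 1) := by
  intro j
  rw [coag_eq_update]
  by_cases hj : j = l
  · subst hj
    rw [update_self]
    exact add_pos (hx _) (hx _)
  · rw [update_of_ne hj]
    exact hx _

theorem massBounded_mul_coag_test {κ : ℝ → ℝ → ℝ} {C : ℝ} (hC : 0 ≤ C) {N : ℕ}
    (hκ : ∀ x y, 0 < x → 0 < y → κ x y ≤ C * (x * y * (1 + (x + y)) ^ N))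
    {f : (Fin (n + 1) → ℝ) → ℝ} (hf : IsTest f) (l : Fin (n + 1)) :
    MassBounded fun x : Fin (n + 2) → ℝ => κ (x l.castSucc) (x l.succ) * f (coag l x) := by
  obtain ⟨D, hD, h⟩ := hf.exists_le_prod
  refine massBounded_mul_coag hC hκ l hD (fun x _ => hf.nonneg _) fun x hx => ?_
  refine (h _ (coag_mem_orthant hx l) (Finset.univ.erase l)).trans_eq ?_
  congr 1
  refine Finset.prod_congr rfl fun j hj => ?_
  rw [coag_eq_update, update_of_ne (Finset.ne_of_mem_erase hj)]

theorem measurable_coag_map (l : Fin (n + 1)) :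
    Measurable (coag l : (Fin (n + 2) → ℝ) → Fin (n + 1) → ℝ) := by
  refine measurable_pi_iff.2 fun j => ?_
  simp only [coag]
  split_ifs <;> fun_prop

theorem measurable_dropNext (l : Fin (n + 1)) :
    Measurable (dropNext l : (Fin (n + 2) → ℝ) → Fin (n + 1) → ℝ) := by
  refine measurable_pi_iff.2 fun j => ?_
  simp only [dropNext]
  split_ifs <;> fun_prop

theorem measurable_frag_map (l : Fin n) (m : Fin (n + 1)) :
    Measurable fun q : ℝ × (Fin n → ℝ) => frag l m q.1 q.2 := by
  refine measurable_pi_iff.2 fun j => ?_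
  simp only [frag]
  induction j using Fin.succAboveCases m with
  | x =>
    simp only [Fin.insertNth_apply_same]
    fun_prop
  | p j =>
    simp only [Fin.insertNth_apply_succAbove]
    by_cases hj : j = l
    · subst hj
      simp only [update_self]
      fun_prop
    · simp only [update_of_ne hj]
      fun_prop

theorem measurable_update_map (l : Fin n) :
    Measurable fun q : ℝ × (Fin n → ℝ) => update q.2 l q.1 := by
  refine measurable_pi_iff.2 fun j => ?_
  by_cases hj : j = l
  · subst hj
    simp only [update_self]
    fun_prop
  · simp only [update_of_ne hj]
    fun_prop

theorem measurable_comp_kernel {κ : ℝ → ℝ → ℝ} (hκ : Measurable (uncurry κ)) (l m : Fin k) :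
    Measurable fun x : Fin k → ℝ => κ (x l) (x m) :=
  Measurable.comp (g := uncurry κ) (f := fun x : Fin k → ℝ => (x l, x m)) hκ
    ((measurable_pi_apply l).prodMk (measurable_pi_apply m))

variable {K F : ℝ → ℝ → ℝ} (hKF : IsKernelPair K F)
include hKF

theorem IsKernelPair.lintegral_frag_lt_top (a : ℝ) :
    ∫⁻ y in Ioo 0 a, ENNReal.ofReal (F y (a - y)) < ∞ := by
  obtain ⟨C, -, N, h⟩ := hKF.frag_le
  by_cases ha : 0 < a
  · exact (h a ha).trans_lt ENNReal.ofReal_lt_top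
  · simp [Ioo_eq_empty ha]

theorem IsKernelPair.measurable_frag_section (a : ℝ) : Measurable fun y => F y (a - y) :=
  hKF.measurable_frag.comp (measurable_id.prodMk (measurable_const.sub measurable_id))

theorem IsKernelPair.integrableOn_frag (a : ℝ) :
    IntegrableOn (fun y => F y (a - y)) (Ioo 0 a) := by
  refine ⟨(hKF.measurable_frag_section a).aestronglyMeasurable, ?_⟩
  rw [hasFiniteIntegral_iff_ofReal (Filter.Eventually.of_forall fun _ => hKF.frag_nonneg _ _)]
  exact hKF.lintegral_frag_lt_top a

theorem IsKernelPair.integral_frag_nonneg (a : ℝ) : 0 ≤ ∫ y in Ioo 0 a, F y (a - y) :=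
  integral_nonneg fun _ => hKF.frag_nonneg _ _

theorem IsKernelPair.exists_integral_frag_le :
    ∃ C, 0 ≤ C ∧ ∃ N : ℕ, ∀ x, 0 < x → ∫ y in Ioo 0 x, F y (x - y) ≤ C * (x * (1 + x) ^ N) := by
  obtain ⟨C, hC, N, h⟩ := hKF.frag_le
  refine ⟨C, hC, N, fun x hx => ?_⟩
  rw [integral_eq_lintegral_of_nonneg_ae
    (Filter.Eventually.of_forall fun y => hKF.frag_nonneg _ _)
    (hKF.measurable_frag_section x).aestronglyMeasurable]
  exact ENNReal.toReal_le_of_le_ofReal (by positivity) (h x hx)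

theorem IsKernelPair.integrableOn_frag_mul (a : ℝ) {g : ℝ → ℝ} (hg : Measurable g) {B : ℝ}
    (hB : ∀ y, |g y| ≤ B) : IntegrableOn (fun y => F y (a - y) * g y) (Ioo 0 a) :=
  (hKF.integrableOn_frag a).mul_bdd hg.aestronglyMeasurable
    (Filter.Eventually.of_forall fun y => hB y)

theorem IsKernelPair.ofReal_integral_frag_mul (a : ℝ) {g : ℝ → ℝ} (hg : Measurable g)
    (hg0 : ∀ y, 0 ≤ g y) {B : ℝ} (hB : ∀ y, g y ≤ B) :
    ENNReal.ofReal (∫ y in Ioo 0 a, F y (a - y) * g y)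
      = ∫⁻ y in Ioo 0 a, ENNReal.ofReal (F y (a - y)) * ENNReal.ofReal (g y) := by
  rw [ofReal_integral_eq_lintegral_ofReal
    (hKF.integrableOn_frag_mul a hg fun y => (abs_of_nonneg (hg0 y)).trans_le (hB y))
    (Filter.Eventually.of_forall fun y => mul_nonneg (hKF.frag_nonneg _ _) (hg0 y))]
  simp only [fun y => ENNReal.ofReal_mul (q := g y) (hKF.frag_nonneg y (a - y))]

/-- The total fragmentation rate of a particle of size `x l` is at most `x l` times a polynomial,
and so supplies the coordinate `l`. -/
theorem IsKernelPair.massBounded_mul_frag (l : Fin k) {T : (Fin k → ℝ) → ℝ} {D : ℝ} (hD : 0 ≤ D)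
    (hT : ∀ x ∈ orthant k, T x ≤ (∫ y in Ioo 0 (x l), F y (x l - y))
      * (D * ∏ j ∈ Finset.univ.erase l, x j)) : MassBounded T := by
  obtain ⟨C, hC, N, h⟩ := hKF.exists_integral_frag_le
  refine ⟨C * D, by positivity, N, fun x hx => (hT x hx).trans ?_⟩
  have hp : 0 ≤ ∏ j ∈ Finset.univ.erase l, x j := Finset.prod_nonneg fun j _ => (hx _).le
  have h1 := le_sum_of_mem_orthant hx l
  have h2 := hx l
  rw [← Finset.mul_prod_erase _ _ (Finset.mem_univ l)]
  calc _ ≤ (C * (x l * (1 + x l) ^ N)) * (D * ∏ j ∈ Finset.univ.erase l, x j) := by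
        gcongr; exact h _ (hx l)
    _ ≤ (C * (x l * (1 + ∑ j, x j) ^ N)) * (D * ∏ j ∈ Finset.univ.erase l, x j) := by gcongr
    _ = _ := by ring

theorem IsKernelPair.massBounded_integral_frag (l : Fin k) {g : ℝ → (Fin k → ℝ) → ℝ}
    (hgm : ∀ x, Measurable fun y => g y x) (hg0 : ∀ y x, 0 ≤ g y x) {B : ℝ}
    (hB : ∀ y x, g y x ≤ B) {D : ℝ} (hD : 0 ≤ D)
    (hg : ∀ x ∈ orthant k, ∀ y, 0 < y → y < x l →
      g y x ≤ D * ∏ j ∈ Finset.univ.erase l, x j) :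
    MassBounded fun x => ∫ y in Ioo 0 (x l), F y (x l - y) * g y x := by
  refine hKF.massBounded_mul_frag l hD fun x hx => ?_
  rw [← integral_mul_const]
  refine setIntegral_mono_on (hKF.integrableOn_frag_mul _ (hgm x)
    fun y => (abs_of_nonneg (hg0 y x)).trans_le (hB y x))
    ((hKF.integrableOn_frag _).mul_const _) measurableSet_Ioo fun y hy => ?_
  exact mul_le_mul_of_nonneg_left (hg x hx y hy.1 hy.2) (hKF.frag_nonneg _ _)

theorem IsKernelPair.measurable_integral_frag (l : Fin k) {g : ℝ → (Fin k → ℝ) → ℝ}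
    (hg : Measurable (uncurry g)) :
    Measurable fun x : Fin k → ℝ => ∫ y in Ioo 0 (x l), F y (x l - y) * g y x := by
  -- The domain of integration depends on `x`; as an indicator on the product space it becomes part
  -- of a jointly measurable integrand.
  have h1 : ∀ x : Fin k → ℝ, ∫ y in Ioo 0 (x l), F y (x l - y) * g y x
      = ∫ y, {q : (Fin k → ℝ) × ℝ | 0 < q.2 ∧ q.2 < q.1 l}.indicator
        (fun q => F q.2 (q.1 l - q.2) * g q.2 q.1) (x, y) := by
    intro x
    rw [← integral_indicator measurableSet_Ioo]
    rfl
  simp only [h1]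
  refine (StronglyMeasurable.integral_prod_right' (ν := volume) ?_).measurable
  refine (Measurable.indicator ?_ ?_).stronglyMeasurable
  · refine Measurable.mul (Measurable.comp (g := uncurry F)
      (f := fun q : (Fin k → ℝ) × ℝ => (q.2, q.1 l - q.2)) hKF.measurable_frag ?_)
      (hg.comp measurable_swap)
    fun_prop
  · exact (measurableSet_lt measurable_const measurable_snd).inter
      (measurableSet_lt measurable_snd (by fun_prop))

variable {f : (Fin (n + 1) → ℝ) → ℝ} (hf : IsTest f)

omit hKF in
include hf in
theorem IsTest.isWeight : IsWeight f := by
  refine ⟨hf.measurable, hf.nonneg, ?_⟩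
  obtain ⟨D, hD, h⟩ := hf.exists_le_prod
  exact ⟨D, hD, 0, fun x hx => by simpa using h x hx Finset.univ⟩

include hf

theorem isWeight_term1 (l : Fin (n + 1)) : IsWeight (term1 K f l) := by
  obtain ⟨C, hC, N, h⟩ := hKF.coag_le
  exact ⟨(measurable_comp_kernel hKF.measurable_coag _ _).mul
      (hf.measurable.comp (measurable_coag_map l)),
    fun x => mul_nonneg (hKF.coag_nonneg _ _) (hf.nonneg _), massBounded_mul_coag_test hC h hf l⟩

theorem isWeight_term2 (l : Fin (n + 1)) : IsWeight (term2 F f l) := by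
  obtain ⟨D, hD, h⟩ := hf.exists_le_prod
  refine ⟨?_, fun x => mul_nonneg (hKF.integral_frag_nonneg _) (hf.nonneg _),
    hKF.massBounded_mul_frag l hD fun x hx => mul_le_mul_of_nonneg_left (h x hx _)
      (hKF.integral_frag_nonneg _)⟩
  have h1 := hKF.measurable_integral_frag l (g := fun _ _ => 1) measurable_const
  simp only [mul_one] at h1
  exact h1.mul hf.measurable

theorem isWeight_term3 (l : Fin (n + 1)) : IsWeight (term3 K f l) := by
  obtain ⟨C, hC, N, h⟩ := hKF.coag_le
  obtain ⟨D, hD, hfD⟩ := hf.exists_le_prod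
  refine ⟨(measurable_comp_kernel hKF.measurable_coag _ _).mul
      (hf.measurable.comp (measurable_dropNext l)),
    fun x => mul_nonneg (hKF.coag_nonneg _ _) (hf.nonneg _),
    massBounded_mul_coag hC h l hD (fun x _ => hf.nonneg _) fun x hx => ?_⟩
  rw [dropNext_eq_removeNth]
  exact hfD _ (removeNth_mem_orthant hx _) _

theorem isWeight_term4 (l : Fin (n + 1)) : IsWeight (term4 F f l) := by
  obtain ⟨D, hD, h⟩ := hf.exists_le_prod
  obtain ⟨B, hB⟩ := hf.bounded
  have hm : Measurable (uncurry fun (y : ℝ) x => f (update x l y)) :=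
    hf.measurable.comp (measurable_update_map l)
  refine ⟨hKF.measurable_integral_frag l hm,
    fun x => integral_nonneg fun y => mul_nonneg (hKF.frag_nonneg _ _) (hf.nonneg _),
    hKF.massBounded_integral_frag l (fun x => hm.of_uncurry_right (y := x))
      (fun _ _ => hf.nonneg _) (fun _ _ => hB _) hD fun x hx y hy _ => ?_⟩
  have hmem : update x l y ∈ orthant (n + 1) := by
    intro j
    by_cases hj : j = l
    · subst hj; simpa using hy
    · rw [update_of_ne hj]; exact hx j
  refine (h _ hmem (Finset.univ.erase l)).trans_eq ?_
  congr 1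
  exact Finset.prod_congr rfl fun j hj => update_of_ne (Finset.ne_of_mem_erase hj) _ _

theorem isWeight_term5 {l m : Fin (n + 1)} (hlm : l ≠ m) : IsWeight (term5 K f l m) := by
  obtain ⟨C, hC, N, h⟩ := hKF.coag_le
  obtain ⟨D, hD, hfD⟩ := hf.exists_le_prod
  refine ⟨(measurable_comp_kernel hKF.measurable_coag _ _).mul hf.measurable,
    fun x => mul_nonneg (hKF.coag_nonneg _ _) (hf.nonneg _), C * D, by positivity, N,
    fun x hx => ?_⟩
  have h1 := h _ _ (hx l) (hx m)
  have h2 := add_le_sum_of_mem_orthant hx hlm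
  set s := (Finset.univ.erase l).erase m with hs
  have hp : 0 ≤ ∏ j ∈ s, x j := Finset.prod_nonneg fun j _ => (hx _).le
  have ha := hx l
  have hb := hx m
  have h3 : ∏ j, x j = x l * x m * ∏ j ∈ s, x j := by
    rw [mul_assoc, Finset.mul_prod_erase _ _ (Finset.mem_erase.2 ⟨hlm.symm, Finset.mem_univ m⟩),
      Finset.mul_prod_erase _ _ (Finset.mem_univ l)]
  rw [h3]
  calc K (x l) (x m) * f x
      ≤ (C * (x l * x m * (1 + (x l + x m)) ^ N)) * (D * ∏ j ∈ s, x j) :=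
        mul_le_mul h1 (hfD x hx s) (hf.nonneg _) (by positivity)
    _ ≤ (C * (x l * x m * (1 + ∑ j, x j) ^ N)) * (D * ∏ j ∈ s, x j) := by gcongr
    _ = _ := by ring

theorem isWeight_term6 (l : Fin n) (m : Fin (n + 1)) : IsWeight (term6 F f l m) := by
  obtain ⟨D, hD, h⟩ := hf.exists_le_prod
  obtain ⟨B, hB⟩ := hf.bounded
  have hm : Measurable (uncurry fun (y : ℝ) x => f (frag l m y x)) :=
    hf.measurable.comp (measurable_frag_map l m)
  refine ⟨hKF.measurable_integral_frag l hm,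
    fun x => integral_nonneg fun y => mul_nonneg (hKF.frag_nonneg _ _) (hf.nonneg _),
    hKF.massBounded_integral_frag l (fun x => hm.of_uncurry_right (y := x))
      (fun _ _ => hf.nonneg _) (fun _ _ => hB _) hD fun x hx y hy hyx => ?_⟩
  have hmem : frag l m y x ∈ orthant (n + 1) := by
    intro j
    induction j using Fin.succAboveCases m with
    | x => simpa [frag] using hyx
    | p j =>
      simp only [frag, Fin.insertNth_apply_succAbove]
      by_cases hj : j = l
      · subst hj; simpa using hy
      · rw [update_of_ne hj]; exact hx j
  -- The selected places are those of the unbroken particles: both pieces, at `m` and at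
  -- `m.succAbove l`, are left out.
  refine (h _ hmem ((Finset.univ.erase l).map m.succAboveEmb)).trans_eq ?_
  rw [Finset.prod_map]
  congr 1
  refine Finset.prod_congr rfl fun j hj => ?_
  change m.insertNth (α := fun _ => ℝ) (x l - y) (update x l y) (m.succAbove j) = x j
  rw [Fin.insertNth_apply_succAbove, update_of_ne (Finset.ne_of_mem_erase hj)]

end Weights

/-! ### The generator applied to integrals against factorial measures. -/

section Generator

variable {I : Set ℝ} {k n : ℕ}

/-- The generator of the coagulation-fragmentation dynamics on a cone of size sequences. -/
def coneGenerator (K F : ℝ → ℝ → ℝ) (Φ : Cone I → ℝ) (z : Cone I) : ℝ :=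
  (1 / 2) * (∑' p : ℕ × ℕ, if p.1 ≠ p.2 ∧ 0 < z.1 p.1 * z.1 p.2 then
      K (z.1 p.1) (z.1 p.2) * (Φ (merge p.1 p.2 z) - Φ z) else 0)
  + (1 / 2) * ∑' i : ℕ, ∫ y in Ioo 0 (z.1 i), F y (z.1 i - y) * (Φ (split i y z) - Φ z)

theorem mass_merge (i j : ℕ) (z : Cone I) : mass (merge i j z) = mass z := by
  by_cases hij : i = j
  · simp [merge, hij]
  · have h1 := z.2.1.removeAt (max i j)
    have h2 := h1.removeAt (min i j)
    have hv := add_nonneg (z.2.1.nonneg i) (z.2.1.nonneg j)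
    have hm : min i j < max i j := by omega
    simp only [merge, dif_neg hij, mass]
    rw [tsum_insertSorted h2 hv, tsum_removeAt h1, tsum_removeAt z.2.1]
    have h3 : removeAt (max i j) z.1 (min i j) = z.1 (min i j) := by
      simp only [removeAt, if_pos hm]
    have h4 : z.1 (max i j) + z.1 (min i j) = z.1 i + z.1 j := by
      rcases le_total i j with hij | hij <;> simp [hij, add_comm]
    rw [h3, sub_sub, h4, sub_add_cancel]

theorem mass_split (i : ℕ) (y : ℝ) (z : Cone I) : mass (split i y z) = mass z := by
  by_cases h : 0 < y ∧ y < z.1 i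
  · have h1 := z.2.1.removeAt i
    have hv : 0 ≤ z.1 i - y := by linarith [h.2]
    have h2 := h1.insertSorted hv
    simp only [split, dif_pos h, mass]
    rw [tsum_insertSorted h2 h.1.le, tsum_insertSorted h1 hv, tsum_removeAt z.2.1]
    ring
  · simp [split, h]

/-- Both transitions preserve mass, so `g (mass z)` is a constant factor in every jump. No
convergence is needed, since a constant factor passes through `tsum` and the integral in all cases.
-/
theorem coneGenerator_mul_mass (K F : ℝ → ℝ → ℝ) (g : ℝ → ℝ) (Φ : Cone I → ℝ) (z : Cone I) :
    coneGenerator K F (fun z => g (mass z) * Φ z) z = g (mass z) * coneGenerator K F Φ z := by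
  simp only [coneGenerator, mass_merge, mass_split, ← mul_sub]
  have h1 : ∀ p : ℕ × ℕ, (if p.1 ≠ p.2 ∧ 0 < z.1 p.1 * z.1 p.2 then
        K (z.1 p.1) (z.1 p.2) * (g (mass z) * (Φ (merge p.1 p.2 z) - Φ z)) else 0)
      = g (mass z) * (if p.1 ≠ p.2 ∧ 0 < z.1 p.1 * z.1 p.2 then
        K (z.1 p.1) (z.1 p.2) * (Φ (merge p.1 p.2 z) - Φ z) else 0) := by
    intro p
    split_ifs
    · ring
    · simp
  have h2 : ∀ i, ∫ y in Ioo 0 (z.1 i), F y (z.1 i - y) * (g (mass z) * (Φ (split i y z) - Φ z))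
      = g (mass z) * ∫ y in Ioo 0 (z.1 i), F y (z.1 i - y) * (Φ (split i y z) - Φ z) := by
    intro i
    rw [← integral_const_mul]
    congr 1
    funext y
    ring
  simp only [h1, h2, tsum_mul_left]
  ring

theorem coneGenerator_mass (K F : ℝ → ℝ → ℝ) (g : ℝ → ℝ) (z : Cone I) :
    coneGenerator K F (fun z => g (mass z)) z = 0 := by
  simp [coneGenerator, mass_merge, mass_split]

/-- Turns a balance in `[0, ∞]` into a difference of reals. Only the products with the rate are
assumed finite, so `a` and `b` are not controlled when `c = 0`; that case is trivial and treated
apart. -/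
theorem mul_toReal_sub {c : ℝ} (hc : 0 ≤ c) {m z a b : ℝ≥0∞} (h : m + a = z + b) (hm : m ≠ ∞)
    (hz : z ≠ ∞) (ha : ENNReal.ofReal c * a ≠ ∞) (hb : ENNReal.ofReal c * b ≠ ∞) :
    c * (m.toReal - z.toReal)
      = (ENNReal.ofReal c * b).toReal - (ENNReal.ofReal c * a).toReal := by
  rcases hc.eq_or_lt with rfl | hc
  · simp
  · have hc' : ENNReal.ofReal c ≠ 0 := by simpa using hc
    have ha' : a ≠ ∞ := fun h => ha (h ▸ ENNReal.mul_top hc')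
    have hb' : b ≠ ∞ := fun h => hb (h ▸ ENNReal.mul_top hc')
    have := congrArg ENNReal.toReal h
    rw [ENNReal.toReal_add hm ha', ENNReal.toReal_add hz hb'] at this
    rw [ENNReal.toReal_mul, ENNReal.toReal_mul, ENNReal.toReal_ofReal hc.le, ← mul_sub]
    congr 1
    linarith

variable {K F : ℝ → ℝ → ℝ} {f : (Fin (n + 1) → ℝ) → ℝ}

/-- The kernel forces the coordinates `l` and `l + 1` to be positive and `f` forces the rest.
Vanishing off the orthant is what allows a factorial integral to be read as a `tupleSum`, here and
for the other terms. -/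
theorem term1_eq_zero (hKF : IsKernelPair K F) (hf : IsTest f) (l : Fin (n + 1))
    {x : Fin (n + 2) → ℝ} (hx : x ∉ orthant (n + 2)) : term1 K f l x = 0 := by
  by_contra hne
  obtain ⟨h1, h2⟩ := mul_ne_zero_iff.1 hne
  have h3 : 0 < x l.castSucc ∧ 0 < x l.succ := by
    by_contra h; exact h1 (hKF.coag_zero _ _ h)
  have h4 : coag l x ∈ orthant (n + 1) := by
    by_contra h; exact h2 (hf.eq_zero h)
  apply hx
  intro j
  induction j using Fin.succAboveCases l.succ with
  | x => exact h3.2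
  | p j =>
    by_cases hj : j = l
    · subst hj; simpa using h3.1
    · have := h4 j
      rwa [coag_eq_update, update_of_ne hj] at this

theorem term2_eq_zero (hf : IsTest f) (l : Fin (n + 1)) {x : Fin (n + 1) → ℝ}
    (hx : x ∉ orthant (n + 1)) : term2 F f l x = 0 := by
  rw [term2, hf.eq_zero hx, mul_zero]

theorem term3_eq_zero (hKF : IsKernelPair K F) (hf : IsTest f) (l : Fin (n + 1))
    {x : Fin (n + 2) → ℝ} (hx : x ∉ orthant (n + 2)) : term3 K f l x = 0 := by
  by_contra hne
  obtain ⟨h1, h2⟩ := mul_ne_zero_iff.1 hne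
  have h3 : 0 < x l.castSucc ∧ 0 < x l.succ := by
    by_contra h; exact h1 (hKF.coag_zero _ _ h)
  have h4 : dropNext l x ∈ orthant (n + 1) := by
    by_contra h; exact h2 (hf.eq_zero h)
  apply hx
  intro j
  induction j using Fin.succAboveCases l.succ with
  | x => exact h3.2
  | p j =>
    have := h4 j
    rwa [dropNext_eq_removeNth] at this

theorem term4_eq_zero (hf : IsTest f) (l : Fin (n + 1)) {x : Fin (n + 1) → ℝ}
    (hx : x ∉ orthant (n + 1)) : term4 F f l x = 0 := by
  obtain ⟨j, hj⟩ := not_forall.1 hx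
  by_cases hjl : j = l
  · subst hjl
    simp [term4, Ioo_eq_empty hj]
  · have : ∀ y, f (update x l y) = 0 := fun y => hf.eq_zero fun h => hj (by
      have := h j
      rwa [update_of_ne hjl] at this)
    simp [term4, this]

theorem term5_eq_zero (hf : IsTest f) (l m : Fin (n + 1)) {x : Fin (n + 1) → ℝ}
    (hx : x ∉ orthant (n + 1)) : term5 K f l m x = 0 := by
  rw [term5, hf.eq_zero hx, mul_zero]

theorem term6_eq_zero (hf : IsTest f) (l : Fin n) (m : Fin (n + 1)) {x : Fin n → ℝ}
    (hx : x ∉ orthant n) : term6 F f l m x = 0 := by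
  obtain ⟨j, hj⟩ := not_forall.1 hx
  by_cases hjl : j = l
  · subst hjl
    simp [term6, Ioo_eq_empty hj]
  · have : ∀ y, f (frag l m y x) = 0 := fun y => hf.eq_zero fun h => hj (by
      have := h (m.succAbove j)
      simp only [frag, Fin.insertNth_apply_succAbove] at this
      rwa [update_of_ne hjl] at this)
    simp [term6, this]

theorem measurable_split_gain (z : ℕ → ℝ) (a : ℕ) {h : (Fin (n + 1) → ℝ) → ℝ≥0∞}
    (hh : Measurable h) :
    Measurable fun y => ∑ l, pinnedSum z l a (z a - y) h + ∑ l, pinnedSum z l a y h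
      + ∑ m : Fin (n + 1), ∑ l : Fin n,
          pinnedSum z l a (z a - y) (fun x => h (m.insertNth y x)) := by
  refine ((Finset.measurable_fun_sum _ fun l _ => ?_).add
    (Finset.measurable_fun_sum _ fun l _ => ?_)).add
    (Finset.measurable_fun_sum _ fun m _ => Finset.measurable_fun_sum _ fun l _ => ?_)
  · exact measurable_pinnedSum z l a (u := fun y => z a - y) (g := fun _ => h) fun x =>
      (hh.comp (measurable_update x)).comp (measurable_const.sub measurable_id)
  · exact measurable_pinnedSum z l a (u := fun y => y) (g := fun _ => h) fun x =>
      hh.comp (measurable_update x)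
  · exact measurable_pinnedSum z l a (u := fun y => z a - y)
      (g := fun y x => h (m.insertNth y x)) fun x => measurable_insertNth_update hh x l m _

variable (hKF : IsKernelPair K F) (hf : IsTest f)
include hKF hf

/-- Each jump is a gain minus a loss. Both total series are finite by the mass bounds, so the series
of differences is the difference of the two totals computed in `tsum_merge_gain` and
`tsum_merge_loss`. -/
theorem coag_part (z : Cone I) :
    ∑' p : ℕ × ℕ, (if p.1 ≠ p.2 ∧ 0 < z.1 p.1 * z.1 p.2 then
      K (z.1 p.1) (z.1 p.2) * (pairing f (merge p.1 p.2 z) - pairing f z) else 0)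
      = ∑ l, pairing (term1 K f l) z
        - (2 * ∑ l, pairing (term3 K f l) z
          + ∑ m, ∑ l, if l = m then 0 else pairing (term5 K f l m) z) := by
  set h : (Fin (n + 1) → ℝ) → ℝ≥0∞ := fun x => ENNReal.ofReal (f x) with hh
  have h0 : ∀ x ∉ orthant (n + 1), h x = 0 := fun x hx => by simp [hh, hf.eq_zero hx]
  set κ : ℝ → ℝ → ℝ≥0∞ := fun x y => ENNReal.ofReal (K x y) with hκdef
  have hκ0 : ∀ x y, ¬(0 < x ∧ 0 < y) → κ x y = 0 := fun x y hxy => by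
    simp [hκdef, hKF.coag_zero x y hxy]
  have hκs : ∀ x y, κ x y = κ y x := fun x y => by simp [hκdef, hKF.coag_symm x y]
  have hf1 := hf.isWeight
  have hw1 := isWeight_term1 hKF hf
  have hw3 := isWeight_term3 hKF hf
  have hw5 := fun l m hlm => isWeight_term5 hKF hf (l := l) (m := m) hlm
  have e1 : ∀ l, ∫⁻ x, ENNReal.ofReal (term1 K f l x) ∂factorialMeasure (n + 2) z.1
      = tupleSum z.1 (fun x : Fin (n + 2) → ℝ =>
          κ (x l.castSucc) (x l.succ) * h (coag l x)) := fun l => by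
    rw [lintegral_factorialMeasure _ fun x hx => by rw [term1_eq_zero hKF hf l hx]; simp]
    simp only [term1, ENNReal.ofReal_mul (hKF.coag_nonneg _ _), hκdef, hh]
  have e3 : ∀ l, ∫⁻ x, ENNReal.ofReal (term3 K f l x) ∂factorialMeasure (n + 2) z.1
      = tupleSum z.1 (fun x : Fin (n + 2) → ℝ =>
          κ (x l.castSucc) (x l.succ) * h (dropNext l x)) := fun l => by
    rw [lintegral_factorialMeasure _ fun x hx => by rw [term3_eq_zero hKF hf l hx]; simp]
    simp only [term3, ENNReal.ofReal_mul (hKF.coag_nonneg _ _), hκdef, hh]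
  have e5 : ∀ l m, ∫⁻ x, ENNReal.ofReal (term5 K f l m x) ∂factorialMeasure (n + 1) z.1
      = tupleSum z.1 (fun x => κ (x l) (x m) * h x) := fun l m => by
    rw [lintegral_factorialMeasure _ fun x hx => by rw [term5_eq_zero hf l m hx]; simp]
    simp only [term5, ENNReal.ofReal_mul (hKF.coag_nonneg _ _), hκdef, hh]
  have ef : ∀ z : Cone I, ∫⁻ x, ENNReal.ofReal (f x) ∂factorialMeasure (n + 1) z.1
      = tupleSum z.1 h := fun z => lintegral_factorialMeasure _ h0
  have hB := tsum_merge_gain z.1 κ hκ0 h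
  have hA := tsum_merge_loss z.1 κ hκ0 hκs h
  simp only [← e1] at hB
  simp only [← e3, ← e5] at hA
  have hBt : ∑ l, ∫⁻ x, ENNReal.ofReal (term1 K f l x) ∂factorialMeasure (n + 2) z.1 ≠ ∞ :=
    ENNReal.sum_ne_top.2 fun l _ => ((hw1 l).lintegral_lt_top z).ne
  have h5t : ∀ l m, (if l = m then 0 else
      ∫⁻ x, ENNReal.ofReal (term5 K f l m x) ∂factorialMeasure (n + 1) z.1) ≠ ∞ := by
    intro l m
    split_ifs with hlm
    · simp
    · exact ((hw5 l m hlm).lintegral_lt_top z).ne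
  have h3t : ∑ l, ∫⁻ x, ENNReal.ofReal (term3 K f l x) ∂factorialMeasure (n + 2) z.1 ≠ ∞ :=
    ENNReal.sum_ne_top.2 fun l _ => ((hw3 l).lintegral_lt_top z).ne
  have h5s : ∑ m, ∑ l, (if l = m then 0 else
      ∫⁻ x, ENNReal.ofReal (term5 K f l m x) ∂factorialMeasure (n + 1) z.1) ≠ ∞ :=
    ENNReal.sum_ne_top.2 fun m _ => ENNReal.sum_ne_top.2 fun l _ => h5t l m
  have h3t2 := ENNReal.mul_ne_top ENNReal.ofNat_ne_top h3t (a := 2)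
  rw [← hB] at hBt
  have hAt := ENNReal.add_ne_top.2 ⟨h3t2, h5s⟩
  rw [← hA] at hAt
  have hterm : ∀ p : ℕ × ℕ, (if p.1 ≠ p.2 ∧ 0 < z.1 p.1 * z.1 p.2 then
      K (z.1 p.1) (z.1 p.2) * (pairing f (merge p.1 p.2 z) - pairing f z) else 0)
      = ((if p.1 ≠ p.2 ∧ 0 < z.1 p.1 * z.1 p.2 then κ (z.1 p.1) (z.1 p.2) else 0)
        * ∑ l, freshSum z.1 l p.1 p.2 (fun x => h (update x l (x l + z.1 p.2)))).toReal
        - ((if p.1 ≠ p.2 ∧ 0 < z.1 p.1 * z.1 p.2 then κ (z.1 p.1) (z.1 p.2) else 0)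
        * (∑ l, freshSum z.1 l p.1 p.2 h + ∑ l, freshSum z.1 l p.2 p.1 h
          + ∑ m, ∑ l, doubleSum z.1 l m p.1 p.2 h)).toReal := by
    intro p
    have hBp := ENNReal.ne_top_of_tsum_ne_top hBt p
    have hAp := ENNReal.ne_top_of_tsum_ne_top hAt p
    split_ifs at hBp hAp ⊢ with hp
    · have hpos : 0 < z.1 p.1 ∧ 0 < z.1 p.2 := by
        have h1 := z.2.1.nonneg p.1
        have h2 := z.2.1.nonneg p.2
        constructor
        · exact h1.lt_of_ne' (left_ne_zero_of_mul hp.2.ne')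
        · exact h2.lt_of_ne' (right_ne_zero_of_mul hp.2.ne')
      exact mul_toReal_sub (hKF.coag_nonneg _ _)
        (by rw [ef, ef]; exact tupleSum_merge_balance z hp.1 hpos.1 hpos.2 h0)
        (hf1.lintegral_lt_top _).ne (hf1.lintegral_lt_top _).ne hAp hBp
    · simp
  simp only [hterm]
  rw [Summable.tsum_sub (ENNReal.summable_toReal hBt) (ENNReal.summable_toReal hAt),
    ← ENNReal.tsum_toReal_eq (ENNReal.ne_top_of_tsum_ne_top hBt),
    ← ENNReal.tsum_toReal_eq (ENNReal.ne_top_of_tsum_ne_top hAt), hB, hA,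
    ENNReal.toReal_add h3t2 h5s, ENNReal.toReal_mul, ENNReal.toReal_ofNat,
    ENNReal.toReal_sum fun l _ => ((hw1 l).lintegral_lt_top z).ne,
    ENNReal.toReal_sum fun l _ => ((hw3 l).lintegral_lt_top z).ne,
    ENNReal.toReal_sum fun m _ => ENNReal.sum_ne_top.2 fun l _ => h5t l m]
  congr 2
  refine Finset.sum_congr rfl fun m _ => ?_
  rw [ENNReal.toReal_sum fun l _ => h5t l m]
  refine Finset.sum_congr rfl fun l _ => ?_
  split_ifs <;> simp [pairing]

theorem frag_part (z : Cone I) :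
    ∑' i : ℕ, ∫ y in Ioo 0 (z.1 i),
        F y (z.1 i - y) * (pairing f (split i y z) - pairing f z)
      = 2 * ∑ l, pairing (term4 F f l) z
        + 2 * (∑ l : Fin n, ∑ m : Fin (n + 1),
          if l.castSucc < m then pairing (term6 F f l m) z else 0)
        - ∑ l, pairing (term2 F f l) z := by
  set h : (Fin (n + 1) → ℝ) → ℝ≥0∞ := fun x => ENNReal.ofReal (f x) with hh
  have h0 : ∀ x ∉ orthant (n + 1), h x = 0 := fun x hx => by simp [hh, hf.eq_zero hx]
  set φ : ℝ → ℝ → ℝ≥0∞ := fun x y => ENNReal.ofReal (F x y) with hφdef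
  have hhm : Measurable h := hf.measurable.ennreal_ofReal
  have hφm : Measurable (uncurry φ) := hKF.measurable_frag.ennreal_ofReal
  have hφs : ∀ x y, φ x y = φ y x := fun x y => by simp [hφdef, hKF.frag_symm x y]
  obtain ⟨B, hB⟩ := hf.bounded
  have hf1 := hf.isWeight
  have hw2 := isWeight_term2 hKF hf
  have hw4 := isWeight_term4 hKF hf
  have hw6 := isWeight_term6 hKF hf
  have e2 : ∀ l, ∫⁻ x, ENNReal.ofReal (term2 F f l x) ∂factorialMeasure (n + 1) z.1
      = tupleSum z.1 (fun x => (∫⁻ y in Ioo 0 (x l), φ y (x l - y)) * h x) := fun l => by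
    rw [lintegral_factorialMeasure _ fun x hx => by rw [term2_eq_zero hf l hx]; simp]
    congr 1
    funext x
    have := hKF.ofReal_integral_frag_mul (x l) (g := fun _ => 1) measurable_const
      (fun _ => zero_le_one) fun _ => le_rfl
    simp only [mul_one, ENNReal.ofReal_one] at this
    rw [term2, ENNReal.ofReal_mul (hKF.integral_frag_nonneg _), this]
  have e4 : ∀ l, ∫⁻ x, ENNReal.ofReal (term4 F f l x) ∂factorialMeasure (n + 1) z.1
      = tupleSum z.1 (fun x => ∫⁻ y in Ioo 0 (x l), φ y (x l - y) * h (update x l y)) := fun l => by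
    rw [lintegral_factorialMeasure _ fun x hx => by rw [term4_eq_zero hf l hx]; simp]
    congr 1
    funext x
    exact hKF.ofReal_integral_frag_mul (x l) (hf.measurable.comp (measurable_update x))
      (fun _ => hf.nonneg _) fun _ => hB _
  have e6 : ∀ l m, ∫⁻ x, ENNReal.ofReal (term6 F f l m x) ∂factorialMeasure n z.1
      = tupleSum z.1 (fragPair φ h l m) := fun l m => by
    rw [lintegral_factorialMeasure _ fun x hx => by rw [term6_eq_zero hf l m hx]; simp]
    congr 1
    funext x
    exact hKF.ofReal_integral_frag_mul (x l)
      (hf.measurable.comp ((measurable_frag_map l m).comp (measurable_id.prodMk measurable_const)))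
      (fun _ => hf.nonneg _) fun _ => hB _
  have ef : ∀ z : Cone I, ∫⁻ x, ENNReal.ofReal (f x) ∂factorialMeasure (n + 1) z.1
      = tupleSum z.1 h := fun z => lintegral_factorialMeasure _ h0
  have hG := tsum_split_gain hφm hφs z.1 hhm
  have hL := tsum_split_loss hφm z.1 h
  simp only [← e4, ← e6] at hG
  simp only [← e2] at hL
  have h4t : ∑ l, ∫⁻ x, ENNReal.ofReal (term4 F f l x) ∂factorialMeasure (n + 1) z.1 ≠ ∞ :=
    ENNReal.sum_ne_top.2 fun l _ => ((hw4 l).lintegral_lt_top z).ne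
  have h6t : ∀ (l : Fin n) (m : Fin (n + 1)), (if l.castSucc < m then
      ∫⁻ x, ENNReal.ofReal (term6 F f l m x) ∂factorialMeasure n z.1 else 0) ≠ ∞ := by
    intro l m
    split_ifs with hlm
    · exact ((hw6 l m).lintegral_lt_top z).ne
    · simp
  have h6s : ∑ l : Fin n, ∑ m : Fin (n + 1), (if l.castSucc < m then
      ∫⁻ x, ENNReal.ofReal (term6 F f l m x) ∂factorialMeasure n z.1 else 0) ≠ ∞ :=
    ENNReal.sum_ne_top.2 fun l _ => ENNReal.sum_ne_top.2 fun m _ => h6t l m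
  have h4t2 := ENNReal.mul_ne_top ENNReal.ofNat_ne_top h4t (a := 2)
  have h6s2 := ENNReal.mul_ne_top ENNReal.ofNat_ne_top h6s (a := 2)
  have hGt := ENNReal.add_ne_top.2 ⟨h4t2, h6s2⟩
  rw [← hG] at hGt
  have hLt : ∑ l, ∫⁻ x, ENNReal.ofReal (term2 F f l x) ∂factorialMeasure (n + 1) z.1 ≠ ∞ :=
    ENNReal.sum_ne_top.2 fun l _ => ((hw2 l).lintegral_lt_top z).ne
  rw [← hL] at hLt
  have hterm : ∀ i : ℕ, ∫ y in Ioo 0 (z.1 i),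
        F y (z.1 i - y) * (pairing f (split i y z) - pairing f z)
      = (∫⁻ y in Ioo 0 (z.1 i), φ y (z.1 i - y) * (∑ l, pinnedSum z.1 l i (z.1 i - y) h
        + ∑ l, pinnedSum z.1 l i y h + ∑ m : Fin (n + 1), ∑ l : Fin n,
          pinnedSum z.1 l i (z.1 i - y) (fun x => h (m.insertNth y x)))).toReal
        - (∫⁻ y in Ioo 0 (z.1 i), φ y (z.1 i - y)
          * ∑ l, pinnedSum z.1 l i (z.1 i) h).toReal := by
    intro i
    have hGi := ENNReal.ne_top_of_tsum_ne_top hGt i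
    have hLi := ENNReal.ne_top_of_tsum_ne_top hLt i
    have mG : Measurable fun y => φ y (z.1 i - y) * (∑ l, pinnedSum z.1 l i (z.1 i - y) h
        + ∑ l, pinnedSum z.1 l i y h + ∑ m : Fin (n + 1), ∑ l : Fin n,
          pinnedSum z.1 l i (z.1 i - y) (fun x => h (m.insertNth y x))) :=
      (measurable_rate hφm (z.1 i)).mul (measurable_split_gain z.1 i hhm)
    have mL : Measurable fun y => φ y (z.1 i - y) * ∑ l, pinnedSum z.1 l i (z.1 i) h :=
      (measurable_rate hφm (z.1 i)).mul measurable_const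
    -- Finite integrals make gain and loss rates finite for almost every `y`, which suffices for
    -- applying the balance pointwise under the integral.
    have aG := ae_lt_top mG hGi
    have aL := ae_lt_top mL hLi
    rw [← integral_toReal mG.aemeasurable aG, ← integral_toReal mL.aemeasurable aL,
      ← integral_sub (integrable_toReal_of_lintegral_ne_top mG.aemeasurable hGi)
        (integrable_toReal_of_lintegral_ne_top mL.aemeasurable hLi)]
    refine integral_congr_ae ?_
    filter_upwards [aG, aL, ae_restrict_mem measurableSet_Ioo] with y hG hL hy
    exact mul_toReal_sub (hKF.frag_nonneg _ _)
        (by rw [ef, ef]; exact tupleSum_split_balance z hy.1 hy.2 h)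
        (hf1.lintegral_lt_top _).ne (hf1.lintegral_lt_top _).ne hL.ne hG.ne
  simp only [hterm]
  rw [Summable.tsum_sub (ENNReal.summable_toReal hGt) (ENNReal.summable_toReal hLt),
    ← ENNReal.tsum_toReal_eq (ENNReal.ne_top_of_tsum_ne_top hGt),
    ← ENNReal.tsum_toReal_eq (ENNReal.ne_top_of_tsum_ne_top hLt), hG, hL,
    ENNReal.toReal_add h4t2 h6s2, ENNReal.toReal_mul, ENNReal.toReal_mul, ENNReal.toReal_ofNat,
    ENNReal.toReal_sum fun l _ => ((hw4 l).lintegral_lt_top z).ne,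
    ENNReal.toReal_sum fun l _ => ((hw2 l).lintegral_lt_top z).ne,
    ENNReal.toReal_sum fun l _ => ENNReal.sum_ne_top.2 fun m _ => h6t l m]
  congr 3
  refine Finset.sum_congr rfl fun l _ => ?_
  rw [ENNReal.toReal_sum fun m _ => h6t l m]
  refine Finset.sum_congr rfl fun m _ => ?_
  split_ifs <;> simp [pairing]

omit hf in
-- Symmetry of `K` folds ordered pairs of places into unordered ones; the resulting `2` cancels the
-- `1 / 2` of the generator.
theorem sum_pairing_term5 (z : Cone I) :
    ∑ m, ∑ l, (if l = m then 0 else pairing (term5 K f l m) z)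
      = 2 * ∑ l, ∑ m, if l < m then pairing (term5 K f l m) z else 0 := by
  have hs : ∀ l m, pairing (term5 K f l m) z = pairing (term5 K f m l) z := fun l m => by
    congr 1
    funext x
    rw [term5, term5, hKF.coag_symm]
  have h1 : ∀ l m : Fin (n + 1), (if l = m then 0 else pairing (term5 K f l m) z)
      = (if l < m then pairing (term5 K f l m) z else 0)
        + if m < l then pairing (term5 K f m l) z else 0 := by
    intro l m
    rcases lt_trichotomy l m with hlm | rfl | hlm
    · simp [hlm, hlm.ne, hlm.not_gt]
    · simp
    · simp [hlm, hlm.ne', hlm.not_gt, hs l m]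
  simp only [h1, Finset.sum_add_distrib, two_mul]
  rw [Finset.sum_comm]

/-- The generator applied to a linear statistic of the factorial measures. -/
theorem coneGenerator_pairing (z : Cone I) :
    coneGenerator K F (pairing f) z
      = (1 / 2) * ∑ l, pairing (term1 K f l) z
        - (1 / 2) * ∑ l, pairing (term2 F f l) z
        - ∑ l, pairing (term3 K f l) z
        + ∑ l, pairing (term4 F f l) z
        - ∑ l, ∑ m, (if l < m then pairing (term5 K f l m) z else 0)
        + ∑ l : Fin n, ∑ m : Fin (n + 1),
          (if l.castSucc < m then pairing (term6 F f l m) z else 0) := by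
  rw [coneGenerator, coag_part hKF hf, frag_part hKF hf, sum_pairing_term5 hKF]
  ring

end Generator

section Dynamics

variable {I : Set ℝ} {S : Type*} {mS : MeasurableSpace S} {P : Measure S} {k n : ℕ}

/-! ### Expectations in the martingale problem, and conservation of mass in law. -/

section Martingale

variable [IsFiniteMeasure P] {ℱ : Filtration ℝ≥0 mS}

theorem IsBoundedBorel.integrable_comp {E T : Type*} [MeasurableSpace E] [MeasurableSpace T]
    {μ : Measure T} [IsFiniteMeasure μ] {Φ : E → ℝ} (hΦ : IsBoundedBorel Φ) {Y : T → E}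
    (hY : Measurable Y) : Integrable (fun ω => Φ (Y ω)) μ := by
  obtain ⟨hm, C, hC⟩ := hΦ
  exact Integrable.of_bound (hm.comp hY).aestronglyMeasurable C
    (Filter.Eventually.of_forall fun ω => hC _)

/-- Dynkin's formula: the martingale starts at `0`, hence has mean `0`; Fubini merges the time
integral with the expectation. -/
theorem IsGeneratedBy.integral_sub_eq {E : Type*} [MeasurableSpace E] {L : (E → ℝ) → E → ℝ}
    {Z : ℝ≥0 → S → E} (hZ : IsGeneratedBy L P ℱ Z) {Φ : E → ℝ} (hΦ : IsBoundedBorel Φ)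
    (hLΦ : IsBoundedBorel (L Φ)) (t : ℝ≥0) :
    ∫ ω, Φ (Z t ω) ∂P - ∫ ω, Φ (Z 0 ω) ∂P
      = ∫ q, L Φ (Z q.1.toNNReal q.2) ∂((volume.restrict (Ioc (0 : ℝ) t)).prod P) := by
  have hmeas : Measurable (fun q : ℝ × S => Z q.1.toNNReal q.2) :=
    hZ.measurable.comp ((measurable_real_toNNReal.comp measurable_fst).prodMk measurable_snd)
  have hmt : ∀ t, Measurable (Z t) := fun t =>
    hZ.measurable.comp (measurable_const.prodMk measurable_id)
  have hprod : Integrable (fun q : ℝ × S => L Φ (Z q.1.toNNReal q.2))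
      ((volume.restrict (Ioc (0 : ℝ) t)).prod P) := hLΦ.integrable_comp hmeas
  have hM := hZ.martingale Φ hΦ hLΦ
  have h1 := hM.setIntegral_eq (zero_le : (0 : ℝ≥0) ≤ t) (MeasurableSet.univ)
  simp only [Measure.restrict_univ] at h1
  have h2 : ∫ ω, (Φ (Z 0 ω) - Φ (Z 0 ω)
      - ∫ u in Ioc (0 : ℝ) ((0 : ℝ≥0) : ℝ), L Φ (Z u.toNNReal ω)) ∂P = 0 := by simp
  have i1 : Integrable (fun ω => Φ (Z t ω) - Φ (Z 0 ω)) P :=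
    (hΦ.integrable_comp (hmt t)).sub (hΦ.integrable_comp (hmt 0))
  have i2 : Integrable (fun ω => ∫ u in Ioc (0 : ℝ) t, L Φ (Z u.toNNReal ω)) P :=
    hprod.integral_prod_right
  rw [h2, integral_sub i1 i2, integral_sub (hΦ.integrable_comp (hmt t))
    (hΦ.integrable_comp (hmt 0))] at h1
  rw [integral_prod_symm _ hprod]
  linarith

variable {K F : ℝ → ℝ → ℝ} {Z : ℝ≥0 → S → Cone I}

/-- The generator kills the indicator of `mass z ∈ B`, so the probability of this event is constant
in time. Equality in law is enough for the moments; nothing about paths is needed. -/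
theorem IsGeneratedBy.map_mass_eq (hZ : IsGeneratedBy (coneGenerator K F) P ℱ Z) (t : ℝ≥0) :
    P.map (fun ω => mass (Z t ω)) = P.map (fun ω => mass (Z 0 ω)) := by
  have hmt : ∀ t, Measurable fun ω => mass (Z t ω) := fun t =>
    measurable_mass.comp (hZ.measurable.comp (measurable_const.prodMk measurable_id))
  ext B hB
  rw [Measure.map_apply (hmt t) hB, Measure.map_apply (hmt 0) hB]
  set g : ℝ → ℝ := B.indicator 1 with hg
  have hgm : Measurable g := measurable_one.indicator hB
  have h1 : coneGenerator K F (fun z : Cone I => g (mass z)) = fun _ => 0 :=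
    funext fun z => coneGenerator_mass K F g z
  have h2 := hZ.integral_sub_eq (Φ := fun z => g (mass z))
    ⟨hgm.comp measurable_mass, 1, fun z => by
      by_cases hz : mass z ∈ B <;> simp [hg, hz]⟩
    (by rw [h1]; exact ⟨measurable_const, 0, by simp⟩) t
  rw [h1, integral_zero, sub_eq_zero] at h2
  have h3 : ∀ t, ∫ ω, g (mass (Z t ω)) ∂P = P.real ((fun ω => mass (Z t ω)) ⁻¹' B) := fun t =>
    integral_indicator_one (hmt t hB)
  rw [h3, h3] at h2
  exact (measureReal_eq_measureReal_iff).1 h2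

theorem IsGeneratedBy.hasMassMoments (hZ : IsGeneratedBy (coneGenerator K F) P ℱ Z)
    (h0 : ∀ k : ℕ, Integrable (fun ω => mass (Z 0 ω) ^ k) P) : HasMassMoments P Z := by
  refine ⟨hZ.measurable, fun p => ⟨∫⁻ ω, ENNReal.ofReal ((1 + mass (Z 0 ω)) ^ p) ∂P, ?_, ?_⟩⟩
  · have h1 : Integrable (fun ω => (1 + mass (Z 0 ω)) ^ p) P := by
      simp only [add_comm (1 : ℝ), add_pow, one_pow, mul_one]
      exact integrable_finsetSum _ fun m _ => (h0 m).mul_const _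
    exact h1.lintegral_lt_top
  · intro t
    have hmt : ∀ t, Measurable fun ω => mass (Z t ω) := fun t =>
      measurable_mass.comp (hZ.measurable.comp (measurable_const.prodMk measurable_id))
    have hm : Measurable fun m : ℝ => ENNReal.ofReal ((1 + m) ^ p) := by fun_prop
    rw [← lintegral_map hm (hmt t), hZ.map_mass_eq, lintegral_map hm (hmt 0)]

end Martingale

/-! ### Admissibility. -/

section Admissible

variable {Z : ℝ≥0 → S → Cone I}

theorem rpow_one_add_le {lam : ℝ} (hlam : 0 ≤ lam) {x : ℝ} (hx : 0 ≤ x) :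
    x ^ (1 + lam) ≤ (1 + x) ^ ⌈1 + lam⌉₊ := by
  calc x ^ (1 + lam) ≤ (1 + x) ^ (1 + lam) :=
        Real.rpow_le_rpow hx (by linarith) (by linarith)
    _ ≤ (1 + x) ^ ((⌈1 + lam⌉₊ : ℕ) : ℝ) :=
        Real.rpow_le_rpow_of_exponent_le (by linarith) (Nat.le_ceil _)
    _ = _ := Real.rpow_natCast _ _

/-- The factor `z l` and the bound on `g` supply the whole product. The base `1 + ∑ x_j` is at least
`1`, which allows the real exponent `1 + lam` to be rounded up and absorbs the maximum with `1`. -/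
theorem massBounded_weight {lam : ℝ} (hlam : 0 ≤ lam) {g : (Fin n → ℝ) → ℝ} (hg : IsTest g)
    (l : Fin (n + 1)) :
    MassBounded fun z : Fin (n + 1) → ℝ =>
      z l * max (z l ^ (1 + lam)) 1 * g (l.removeNth z) := by
  obtain ⟨D, hD, h⟩ := hg.exists_le_prod
  refine ⟨D, hD, ⌈1 + lam⌉₊, fun x hx => ?_⟩
  have h1 := h _ (removeNth_mem_orthant hx l) Finset.univ
  have h2 := hx l
  have h3 := le_sum_of_mem_orthant hx l
  have h4 : max (x l ^ (1 + lam)) 1 ≤ (1 + ∑ j, x j) ^ ⌈1 + lam⌉₊ := by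
    refine max_le ((rpow_one_add_le hlam h2.le).trans (by gcongr)) (one_le_pow₀ (by linarith))
  have h5 : 0 ≤ max (x l ^ (1 + lam)) 1 := le_max_of_le_right zero_le_one
  rw [Fin.prod_univ_succAbove x l]
  calc x l * max (x l ^ (1 + lam)) 1 * g (l.removeNth x)
      ≤ x l * (1 + ∑ j, x j) ^ ⌈1 + lam⌉₊ * (D * ∏ j, l.removeNth x j) := by
        refine mul_le_mul (by gcongr) h1 (hg.nonneg _) ?_
        exact mul_nonneg h2.le (h5.trans h4)
    _ = _ := by simp only [Fin.removeNth]; ring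

theorem measurableSet_orthant (k : ℕ) : MeasurableSet (orthant k) := by
  have : orthant k = ⋂ l, {z : Fin k → ℝ | 0 < z l} := by
    ext z; simp [orthant]
  rw [this]
  exact MeasurableSet.iInter fun l => measurableSet_lt measurable_const (measurable_pi_apply l)

theorem isTest_indicator {C : Set (Fin k → ℝ)} (hC : C ⊆ orthant k) (hc : IsCompact C) :
    IsTest (C.indicator 1) := by
  refine ⟨measurable_one.indicator hc.measurableSet,
    fun z => indicator_nonneg (fun _ _ => zero_le_one) z, ⟨1, fun z => ?_⟩, C, hC, hc,
    fun z hz => indicator_of_notMem hz _⟩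
  by_cases hz : z ∈ C <;> simp [hz]

theorem HasMassMoments.admissible [SFinite P] (hZ : HasMassMoments P Z) {lam : ℝ}
    (hlam : 0 ≤ lam) : Admissible lam (fun t k => correlationMeasure P (Z t) k) where
  carried t n := ae_correlationMeasure (hZ.measurable_apply t) (measurableSet_orthant _)
    fun z i _ hi => hi
  locallyFinite t n C hC hc := by
    have h1 := (hZ.integrable_correlation (isTest_indicator hC hc).isWeight t).lintegral_lt_top
    have h2 : ∀ x, ENNReal.ofReal (C.indicator 1 x) = C.indicator 1 x := fun x => by
      by_cases hx : x ∈ C <;> simp [hx]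
    simpa [h2, lintegral_indicator_one hc.measurableSet] using h1
  locIntegrable_test n f hf := hZ.locIntegrable hf.measurable hf.isWeight.bounded
  locIntegrable_coag n f hf l := by
    -- The integrand is the coagulation gain for the kernel `xy`, with constant `1` and exponent
    -- `0`.
    refine hZ.locIntegrable ?_ (massBounded_mul_coag_test (κ := fun x y => x * y) zero_le_one
      (N := 0) (fun x y _ _ => by simp) hf l)
    exact (by fun_prop : Measurable fun z : Fin (n + 2) → ℝ => z l.castSucc * z l.succ).mul
      (hf.measurable.comp (measurable_coag_map l))
  locIntegrable_weight n g hg l := by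
    refine hZ.locIntegrable ?_ (massBounded_weight hlam hg l)
    have h1 : Measurable fun z : Fin (n + 1) → ℝ => l.removeNth z :=
      measurable_pi_iff.2 fun j => measurable_pi_apply _
    refine Measurable.mul ?_ (hg.measurable.comp h1)
    exact (measurable_pi_apply l).mul
      (((measurable_pi_apply l).pow_const _).max measurable_const)

end Admissible

/-! ### Truncation by mass and passage to the limit. -/

section Tame

variable {Z : ℝ≥0 → S → Cone I} {t : ℝ≥0} {G G' : Cone I → ℝ} {c c' : ℝ}

/-- `G` is measurable, bounded on sets of bounded mass, and integrable over `(0, t] × S` along `Z`,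
with integral `c`. -/
structure IsTame (P : Measure S) (Z : ℝ≥0 → S → Cone I) (t : ℝ≥0) (G : Cone I → ℝ) (c : ℝ) :
    Prop where
  measurable : Measurable G
  bounded : ∀ R : ℝ, ∃ C, ∀ z, mass z ≤ R → |G z| ≤ C
  integrable : Integrable (fun q : ℝ × S => G (Z q.1.toNNReal q.2))
    ((volume.restrict (Ioc (0 : ℝ) t)).prod P)
  integral_eq : ∫ q, G (Z q.1.toNNReal q.2) ∂((volume.restrict (Ioc (0 : ℝ) t)).prod P) = c

theorem IsTame.add (h : IsTame P Z t G c) (h' : IsTame P Z t G' c') :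
    IsTame P Z t (fun z => G z + G' z) (c + c') where
  measurable := h.measurable.add h'.measurable
  bounded R := by
    obtain ⟨C, hC⟩ := h.bounded R
    obtain ⟨C', hC'⟩ := h'.bounded R
    exact ⟨C + C', fun z hz => (abs_add_le _ _).trans (add_le_add (hC z hz) (hC' z hz))⟩
  integrable := h.integrable.add h'.integrable
  integral_eq := by rw [integral_add h.integrable h'.integrable, h.integral_eq, h'.integral_eq]

theorem IsTame.const_mul (a : ℝ) (h : IsTame P Z t G c) :
    IsTame P Z t (fun z => a * G z) (a * c) where
  measurable := h.measurable.const_mul a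
  bounded R := by
    obtain ⟨C, hC⟩ := h.bounded R
    refine ⟨|a| * C, fun z hz => ?_⟩
    rw [abs_mul]
    exact mul_le_mul_of_nonneg_left (hC z hz) (abs_nonneg a)
  integrable := h.integrable.const_mul a
  integral_eq := by rw [integral_const_mul, h.integral_eq]

theorem IsTame.sub (h : IsTame P Z t G c) (h' : IsTame P Z t G' c') :
    IsTame P Z t (fun z => G z - G' z) (c - c') := by
  have := h.add (h'.const_mul (-1))
  simpa only [neg_one_mul, ← sub_eq_add_neg] using this

theorem IsTame.zero : IsTame P Z t (fun _ => 0) 0 where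
  measurable := measurable_const
  bounded _ := ⟨0, by simp⟩
  integrable := integrable_zero _ _ _
  integral_eq := by simp

theorem IsTame.sum {α : Type*} {s : Finset α} {G : α → Cone I → ℝ} {c : α → ℝ}
    (h : ∀ a, IsTame P Z t (G a) (c a)) :
    IsTame P Z t (fun z => ∑ a ∈ s, G a z) (∑ a ∈ s, c a) := by
  induction s using Finset.induction_on with
  | empty => simpa using IsTame.zero
  | insert a s ha ih => simpa only [Finset.sum_insert ha] using (h a).add ih

theorem IsTame.ite {p : Prop} [Decidable p] (h : p → IsTame P Z t G c) :
    IsTame P Z t (fun z => if p then G z else 0) (if p then c else 0) := by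
  by_cases hp : p
  · simpa only [if_pos hp] using h hp
  · simpa only [if_neg hp] using IsTame.zero

theorem IsWeight.bounded_pairing {h : (Fin k → ℝ) → ℝ} (hh : IsWeight h) (R : ℝ) :
    ∃ C, ∀ z : Cone I, mass z ≤ R → |pairing h z| ≤ C := by
  obtain ⟨C, hC, p, hp⟩ := hh.pairing_le (I := I)
  refine ⟨C * (1 + R) ^ p, fun z hz => ?_⟩
  rw [abs_of_nonneg (pairing_nonneg h z)]
  have := mass_nonneg z
  exact (hp z).trans (by gcongr)

theorem HasMassMoments.isTame_pairing [SFinite P] (hZ : HasMassMoments P Z) {h : (Fin k → ℝ) → ℝ}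
    (hh : IsWeight h) :
    IsTame P Z t (pairing h)
      (timeSpaceIntegral (fun t k => correlationMeasure P (Z t) k) t h) where
  measurable := hh.measurable_pairing
  bounded := hh.bounded_pairing
  integrable := hZ.integrable_pairing_prod hh t
  integral_eq := (hZ.timeSpaceIntegral_eq hh t).symm

/-- The indicator of `(-∞, R]`. -/
def cutoff (R : ℕ) : ℝ → ℝ := (Iic (R : ℝ)).indicator 1

theorem measurable_cutoff (R : ℕ) : Measurable (cutoff R) :=
  measurable_one.indicator measurableSet_Iic

theorem abs_cutoff_mul_le (R : ℕ) (m a : ℝ) : |cutoff R m * a| ≤ |a| := by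
  by_cases hm : m ∈ Iic (R : ℝ) <;> simp [cutoff, hm]

theorem isBoundedBorel_cutoff (hG : Measurable G) (R : ℕ)
    (hb : ∃ C, ∀ z, mass z ≤ R → |G z| ≤ C) :
    IsBoundedBorel fun z : Cone I => cutoff R (mass z) * G z := by
  refine ⟨((measurable_cutoff R).comp measurable_mass).mul hG, ?_⟩
  obtain ⟨C, hC⟩ := hb
  refine ⟨max C 0, fun z => ?_⟩
  by_cases hz : mass z ≤ R
  · exact (abs_cutoff_mul_le _ _ _).trans ((hC z hz).trans (le_max_left _ _))
  · have : mass z ∉ Iic (R : ℝ) := hz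
    simp [cutoff, this]

/-- For each `ω` the cutoff equals `1` as soon as `R` exceeds the mass, and `|G|` dominates. -/
theorem tendsto_integral_cutoff {T : Type*} [MeasurableSpace T] {μ : Measure T} {Y : T → Cone I}
    (hY : Measurable Y) (hG : Integrable (fun ω => G (Y ω)) μ) :
    Filter.Tendsto (fun R : ℕ => ∫ ω, cutoff R (mass (Y ω)) * G (Y ω) ∂μ) Filter.atTop
      (nhds (∫ ω, G (Y ω) ∂μ)) := by
  refine tendsto_integral_of_dominated_convergence (fun ω => |G (Y ω)|) (fun R => ?_) hG.abs
    (fun R => Filter.Eventually.of_forall fun ω => abs_cutoff_mul_le _ _ _)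
    (Filter.Eventually.of_forall fun ω => ?_)
  · exact (((measurable_cutoff R).comp
      (measurable_mass.comp hY)).aestronglyMeasurable).mul hG.aestronglyMeasurable
  · refine tendsto_const_nhds.congr' ?_
    filter_upwards [Filter.eventually_ge_atTop ⌈mass (Y ω)⌉₊] with R hR
    have : mass (Y ω) ∈ Iic (R : ℝ) := Nat.ceil_le.1 hR
    simp [cutoff, this]

end Tame

/-- The martingale identity is applied to the truncated pairing, whose image under the generator is
the truncated image of `pairing f`. Both sides converge as `R → ∞`. -/
theorem IsGeneratedBy.weakHierarchy [IsFiniteMeasure P] {ℱ : Filtration ℝ≥0 mS}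
    {Z : ℝ≥0 → S → Cone I} {K F : ℝ → ℝ → ℝ} (hKF : IsKernelPair K F)
    (hgen : IsGeneratedBy (coneGenerator K F) P ℱ Z) (hZ : HasMassMoments P Z) :
    SatisfiesWeakHierarchy K F (fun t k => correlationMeasure P (Z t) k) := by
  intro t _ n f hf
  have w0 := hf.isWeight
  have w1 := isWeight_term1 hKF hf
  have w2 := isWeight_term2 hKF hf
  have w3 := isWeight_term3 hKF hf
  have w4 := isWeight_term4 hKF hf
  have w5 : ∀ l m : Fin (n + 1), l < m → IsWeight (term5 K f l m) := fun l m hlm =>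
    isWeight_term5 hKF hf hlm.ne
  have w6 := isWeight_term6 hKF hf
  refine ⟨⟨hZ.integrable_correlation w0 t, hZ.integrable_correlation w0 0,
    fun l => ⟨hZ.timeSpaceIntegrable (w1 l) t, hZ.timeSpaceIntegrable (w2 l) t,
      hZ.timeSpaceIntegrable (w3 l) t, hZ.timeSpaceIntegrable (w4 l) t⟩,
    fun l m hlm => hZ.timeSpaceIntegrable (w5 l m hlm) t,
    fun l m _ => hZ.timeSpaceIntegrable (w6 l m) t⟩, ?_⟩
  rw [hZ.integral_correlation w0 t, hZ.integral_correlation w0 0]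
  -- The expression is assembled in the exact shape of `coneGenerator_pairing`: its function is the
  -- generator applied to `pairing f`, and its recorded integral is the right-hand side of the
  -- hierarchy.
  have hT := (((((IsTame.sum (P := P) (Z := Z) (t := t) (s := Finset.univ)
      fun l => hZ.isTame_pairing (w1 l)).const_mul (1 / 2)).sub
    ((IsTame.sum (s := Finset.univ) fun l => hZ.isTame_pairing (w2 l)).const_mul (1 / 2))).sub
    (IsTame.sum (s := Finset.univ) fun l => hZ.isTame_pairing (w3 l))).add
    (IsTame.sum (s := Finset.univ) fun l => hZ.isTame_pairing (w4 l))).sub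
    (IsTame.sum (s := Finset.univ) fun l => IsTame.sum (s := Finset.univ) fun m =>
      IsTame.ite (p := l < m) fun hlm => hZ.isTame_pairing (w5 l m hlm)) |>.add
    (IsTame.sum (s := Finset.univ) fun l => IsTame.sum (s := Finset.univ) fun m =>
      IsTame.ite (p := l.castSucc < m) fun _ => hZ.isTame_pairing (w6 l m))
  simp only [← coneGenerator_pairing hKF hf] at hT
  rw [← hT.integral_eq]
  have hR : ∀ R : ℕ, ∫ ω, cutoff R (mass (Z t ω)) * pairing f (Z t ω) ∂P
      - ∫ ω, cutoff R (mass (Z 0 ω)) * pairing f (Z 0 ω) ∂P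
      = ∫ q, cutoff R (mass (Z q.1.toNNReal q.2))
          * coneGenerator K F (pairing f) (Z q.1.toNNReal q.2)
        ∂((volume.restrict (Ioc (0 : ℝ) t)).prod P) := by
    intro R
    have e : coneGenerator K F (fun z : Cone I => cutoff R (mass z) * pairing f z)
        = fun z => cutoff R (mass z) * coneGenerator K F (pairing f) z :=
      funext fun z => coneGenerator_mul_mass K F (cutoff R) (pairing f) z
    have := hgen.integral_sub_eq (Φ := fun z => cutoff R (mass z) * pairing f z)
      (isBoundedBorel_cutoff w0.measurable_pairing R (w0.bounded_pairing R))
      (by rw [e]; exact isBoundedBorel_cutoff hT.measurable R (hT.bounded R)) t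
    rwa [e] at this
  have hlim := (tendsto_integral_cutoff (hZ.measurable_apply t)
    (hZ.integrable_pairing w0 t)).sub (tendsto_integral_cutoff (hZ.measurable_apply 0)
    (hZ.integrable_pairing w0 0))
  simp only [hR] at hlim
  exact tendsto_nhds_unique hlim (tendsto_integral_cutoff hZ.measurable_real hT.integrable)

end Dynamics

/-! ### Extending kernels by zero outside the region that matters. -/

section Restriction

variable {I J : Set ℝ} {k n : ℕ}

/-- The kernel `κ` on `{x, y > 0, x + y ∈ J}`, extended by zero. -/
def restrictKernel (J : Set ℝ) (κ : ℝ → ℝ → ℝ) (x y : ℝ) : ℝ :=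
  if 0 < x ∧ 0 < y ∧ x + y ∈ J then κ x y else 0

theorem restrictKernel_of_mem {κ : ℝ → ℝ → ℝ} {x y : ℝ} (hx : 0 < x) (hy : 0 < y)
    (hxy : x + y ∈ J) : restrictKernel J κ x y = κ x y := if_pos ⟨hx, hy, hxy⟩

theorem restrictKernel_nonneg {κ : ℝ → ℝ → ℝ}
    (h : ∀ x y, 0 < x → 0 < y → x + y ∈ J → 0 ≤ κ x y) (x y : ℝ) :
    0 ≤ restrictKernel J κ x y := by
  unfold restrictKernel
  split_ifs with hxy
  · exact h x y hxy.1 hxy.2.1 hxy.2.2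
  · exact le_rfl

theorem restrictKernel_symm {κ : ℝ → ℝ → ℝ}
    (h : ∀ x y, 0 < x → 0 < y → x + y ∈ J → κ x y = κ y x) (x y : ℝ) :
    restrictKernel J κ x y = restrictKernel J κ y x := by
  unfold restrictKernel
  by_cases hxy : 0 < x ∧ 0 < y ∧ x + y ∈ J
  · rw [if_pos hxy, if_pos ⟨hxy.2.1, hxy.1, add_comm x y ▸ hxy.2.2⟩, h x y hxy.1 hxy.2.1 hxy.2.2]
  · rw [if_neg hxy, if_neg fun h => hxy ⟨h.2.1, h.1, add_comm y x ▸ h.2.2⟩]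

theorem measurable_restrictKernel {κ : ℝ → ℝ → ℝ} (hJ : MeasurableSet J)
    (h : Measurable fun p : {p : ℝ × ℝ | 0 < p.1 ∧ 0 < p.2 ∧ p.1 + p.2 ∈ J} => κ p.1.1 p.1.2) :
    Measurable (uncurry (restrictKernel J κ)) := by
  have hs : MeasurableSet {p : ℝ × ℝ | 0 < p.1 ∧ 0 < p.2 ∧ p.1 + p.2 ∈ J} :=
    (measurableSet_lt measurable_const measurable_fst).inter
      ((measurableSet_lt measurable_const measurable_snd).inter
        ((measurable_fst.add measurable_snd) hJ))
  refine measurable_of_restrict_of_restrict_compl hs ?_ ?_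
  · convert h using 1
    funext p
    exact if_pos p.2
  · convert measurable_const (a := (0 : ℝ)) using 1
    funext p
    exact if_neg p.2

/-- `J` contains every entry, and every sum of two entries, of the sequences in `Cone I`. -/
structure ContainsPairSums (I J : Set ℝ) : Prop where
  measurableSet : MeasurableSet J
  apply_mem : ∀ (z : Cone I) (i : ℕ), z.1 i ∈ J
  add_mem : ∀ (z : Cone I) (i j : ℕ), i ≠ j → z.1 i + z.1 j ∈ J

variable (hIJ : ContainsPairSums I J) (K F : ℝ → ℝ → ℝ)
include hIJ

/-- The generator evaluates `K` at two distinct positive entries, and `F` under the integral at two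
positive pieces whose sum is one entry. All these points lie in the region where the kernel is kept.
-/
theorem coneGenerator_restrictKernel :
    (coneGenerator (restrictKernel J K) (restrictKernel J F) : (Cone I → ℝ) → Cone I → ℝ)
      = coneGenerator K F := by
  funext Φ z
  unfold coneGenerator
  congr 2
  · refine tsum_congr fun p => ?_
    split_ifs with hp
    · have h1 := (z.2.1.nonneg p.1).lt_of_ne' (left_ne_zero_of_mul hp.2.ne')
      have h2 := (z.2.1.nonneg p.2).lt_of_ne' (right_ne_zero_of_mul hp.2.ne')
      rw [restrictKernel_of_mem h1 h2 (hIJ.add_mem z _ _ hp.1)]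
    · rfl
  · refine tsum_congr fun i => setIntegral_congr_fun measurableSet_Ioo fun y hy => ?_
    rw [restrictKernel_of_mem hy.1 (sub_pos.2 hy.2)
      (by rw [add_sub_cancel]; exact hIJ.apply_mem z i)]

omit hIJ in
theorem TimeSpaceIntegrable.congr {c : ℝ≥0 → (k : ℕ) → Measure (Fin k → ℝ)} {t : ℝ≥0}
    {h h' : (Fin k → ℝ) → ℝ} (hh : TimeSpaceIntegrable c t h) (he : ∀ s, h =ᵐ[c s k] h') :
    TimeSpaceIntegrable c t h' := by
  refine ⟨hh.1.mono fun s hs => hs.congr (he _), ?_⟩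
  have : ∀ s : ℝ, ∫ z, h z ∂c s.toNNReal k = ∫ z, h' z ∂c s.toNNReal k := fun s =>
    integral_congr_ae (he _)
  simpa only [this] using hh.2

omit hIJ in
theorem timeSpaceIntegral_congr {c : ℝ≥0 → (k : ℕ) → Measure (Fin k → ℝ)} (t : ℝ≥0)
    {h h' : (Fin k → ℝ) → ℝ} (he : ∀ s, h =ᵐ[c s k] h') :
    timeSpaceIntegral c t h = timeSpaceIntegral c t h' := by
  have : ∀ s : ℝ, ∫ z, h z ∂c s.toNNReal k = ∫ z, h' z ∂c s.toNNReal k := fun s =>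
    integral_congr_ae (he _)
  simp only [timeSpaceIntegral, this]

variable {S : Type*} {mS : MeasurableSpace S} {P : Measure S}

theorem ae_correlationMeasure_mem {Y : S → Cone I} (hY : Measurable Y) :
    ∀ᵐ x ∂correlationMeasure P Y k,
      (∀ l, 0 < x l ∧ x l ∈ J) ∧ ∀ l m, l ≠ m → x l + x m ∈ J := by
  have hJ := hIJ.measurableSet
  have h1 : ∀ᵐ x ∂correlationMeasure P Y k, ∀ l, 0 < x l ∧ x l ∈ J := by
    rw [ae_all_iff]
    intro l
    refine ae_correlationMeasure hY ?_ fun z i _ hi => ⟨hi l, hIJ.apply_mem z _⟩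
    exact (measurableSet_lt measurable_const (measurable_pi_apply l)).inter
      (measurable_pi_apply l hJ)
  have h2 : ∀ᵐ x ∂correlationMeasure P Y k, ∀ l m, l ≠ m → x l + x m ∈ J := by
    simp only [ae_all_iff]
    intro l m hlm
    refine ae_correlationMeasure hY ?_ fun z i hinj _ => hIJ.add_mem z _ _ (hinj.ne hlm)
    exact ((measurable_pi_apply l).add (measurable_pi_apply m)) hJ
  exact h1.and h2

/-- The correlation measures are carried by tuples whose coordinates, and sums of two coordinates,
lie in `J`; there the terms for the two kernel pairs agree. -/
theorem satisfiesWeakHierarchy_of_restrictKernel {Z : ℝ≥0 → S → Cone I}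
    (hZ : ∀ t, Measurable (Z t))
    (h : SatisfiesWeakHierarchy (restrictKernel J K) (restrictKernel J F)
      (fun t k => correlationMeasure P (Z t) k)) :
    SatisfiesWeakHierarchy K F (fun t k => correlationMeasure P (Z t) k) := by
  intro t ht n f hf
  obtain ⟨⟨i1, i2, i3, i4, i5⟩, heq⟩ := h t ht n f hf
  have hfrag : ∀ {k : ℕ} {x : Fin k → ℝ} (l : Fin k), 0 < x l ∧ x l ∈ J → ∀ g : ℝ → ℝ,
      ∫ y in Ioo 0 (x l), restrictKernel J F y (x l - y) * g y
        = ∫ y in Ioo 0 (x l), F y (x l - y) * g y := by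
    intro k x l hl g
    refine setIntegral_congr_fun measurableSet_Ioo fun y hy => ?_
    rw [restrictKernel_of_mem hy.1 (sub_pos.2 hy.2) (by rw [add_sub_cancel]; exact hl.2)]
  have e1 : ∀ l s, term1 (restrictKernel J K) f l
      =ᵐ[correlationMeasure P (Z s) (n + 2)] term1 K f l := fun l s => by
    filter_upwards [ae_correlationMeasure_mem (P := P) (k := n + 2) hIJ (hZ s)] with x hx
    rw [term1, term1, restrictKernel_of_mem (hx.1 _).1 (hx.1 _).1
      (hx.2 _ _ Fin.castSucc_lt_succ.ne)]
  have e2 : ∀ l s, term2 (restrictKernel J F) f l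
      =ᵐ[correlationMeasure P (Z s) (n + 1)] term2 F f l := fun l s => by
    filter_upwards [ae_correlationMeasure_mem (P := P) (k := n + 1) hIJ (hZ s)] with x hx
    have := hfrag l (hx.1 l) (fun _ => 1)
    simp only [mul_one] at this
    rw [term2, term2, this]
  have e3 : ∀ l s, term3 (restrictKernel J K) f l
      =ᵐ[correlationMeasure P (Z s) (n + 2)] term3 K f l := fun l s => by
    filter_upwards [ae_correlationMeasure_mem (P := P) (k := n + 2) hIJ (hZ s)] with x hx
    rw [term3, term3, restrictKernel_of_mem (hx.1 _).1 (hx.1 _).1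
      (hx.2 _ _ Fin.castSucc_lt_succ.ne)]
  have e4 : ∀ l s, term4 (restrictKernel J F) f l
      =ᵐ[correlationMeasure P (Z s) (n + 1)] term4 F f l := fun l s => by
    filter_upwards [ae_correlationMeasure_mem (P := P) (k := n + 1) hIJ (hZ s)] with x hx
    exact hfrag l (hx.1 l) _
  have e5 : ∀ l m, l < m → ∀ s, term5 (restrictKernel J K) f l m
      =ᵐ[correlationMeasure P (Z s) (n + 1)] term5 K f l m := fun l m hlm s => by
    filter_upwards [ae_correlationMeasure_mem (P := P) (k := n + 1) hIJ (hZ s)] with x hx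
    rw [term5, term5, restrictKernel_of_mem (hx.1 _).1 (hx.1 _).1 (hx.2 _ _ hlm.ne)]
  have e6 : ∀ (l : Fin n) m s, term6 (restrictKernel J F) f l m
      =ᵐ[correlationMeasure P (Z s) n] term6 F f l m := fun l m s => by
    filter_upwards [ae_correlationMeasure_mem (P := P) (k := n) hIJ (hZ s)] with x hx
    exact hfrag l (hx.1 l) _
  refine ⟨⟨i1, i2, fun l => ⟨(i3 l).1.congr (e1 l), (i3 l).2.1.congr (e2 l),
    (i3 l).2.2.1.congr (e3 l), (i3 l).2.2.2.congr (e4 l)⟩,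
    fun l m hlm => (i4 l m hlm).congr (e5 l m hlm),
    fun l m hlm => (i5 l m hlm).congr (e6 l m)⟩, heq.trans ?_⟩
  have t5 : ∀ l m : Fin (n + 1),
      (if l < m then timeSpaceIntegral (fun t k => correlationMeasure P (Z t) k) t
        (term5 (restrictKernel J K) f l m) else 0)
      = if l < m then timeSpaceIntegral (fun t k => correlationMeasure P (Z t) k) t
        (term5 K f l m) else 0 := by
    intro l m
    split_ifs with hlm
    · exact timeSpaceIntegral_congr t (e5 l m hlm)
    · rfl
  simp only [t5]
  simp only [fun l => timeSpaceIntegral_congr (c := fun t k => correlationMeasure P (Z t) k) t (e1 l),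
    fun l => timeSpaceIntegral_congr (c := fun t k => correlationMeasure P (Z t) k) t (e2 l),
    fun l => timeSpaceIntegral_congr (c := fun t k => correlationMeasure P (Z t) k) t (e3 l),
    fun l => timeSpaceIntegral_congr (c := fun t k => correlationMeasure P (Z t) k) t (e4 l),
    fun l m => timeSpaceIntegral_congr (c := fun t k => correlationMeasure P (Z t) k) t (e6 l m)]

variable {K F}

theorem admissible_and_weakHierarchy [IsFiniteMeasure P] {ℱ : Filtration ℝ≥0 mS}
    (hKF : IsKernelPair (restrictKernel J K) (restrictKernel J F)) {Z : ℝ≥0 → S → Cone I}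
    (hgen : IsGeneratedBy (coneGenerator K F) P ℱ Z)
    (h0 : ∀ k : ℕ, Integrable (fun ω => mass (Z 0 ω) ^ k) P) :
    (∀ lam : ℝ, 0 ≤ lam → Admissible lam (fun t k => correlationMeasure P (Z t) k)) ∧
      SatisfiesWeakHierarchy K F (fun t k => correlationMeasure P (Z t) k) := by
  have hZ := hgen.hasMassMoments h0
  rw [← coneGenerator_restrictKernel hIJ] at hgen
  exact ⟨fun lam hlam => hZ.admissible hlam, satisfiesWeakHierarchy_of_restrictKernel hIJ K F
    hZ.measurable_apply (hgen.weakHierarchy hKF hZ)⟩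

end Restriction

/-! ### Homogeneous rates. -/

section Homogeneous

variable {lam : ℝ} {H : ℝ → ℝ → ℝ}

theorem image_mul_Ioo {a : ℝ} (ha : 0 < a) : (fun u : ℝ => a * u) '' Ioo 0 1 = Ioo 0 a := by
  rw [image_mul_left_Ioo ha, mul_zero, mul_one]

theorem lintegral_Ioo_eq_mul {a : ℝ} (ha : 0 < a) (G : ℝ → ℝ≥0∞) :
    ∫⁻ y in Ioo 0 a, G y = ENNReal.ofReal a * ∫⁻ u in Ioo (0 : ℝ) 1, G (a * u) := by
  rw [← image_mul_Ioo ha, lintegral_image_eq_lintegral_abs_deriv_mul measurableSet_Ioo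
    (f' := fun _ => a) (fun x _ => by simpa using ((hasDerivAt_id x).const_mul a).hasDerivWithinAt)
    (fun x _ y _ h => mul_left_cancel₀ ha.ne' h), lintegral_const_mul' _ _ ENNReal.ofReal_ne_top,
    abs_of_pos ha]

theorem integral_Ioo_eq_mul {a : ℝ} (ha : 0 < a) (G : ℝ → ℝ) :
    ∫ y in Ioo 0 a, G y = a * ∫ u in Ioo (0 : ℝ) 1, G (a * u) := by
  rw [← image_mul_Ioo ha, integral_image_eq_integral_abs_deriv_smul measurableSet_Ioo
    (f' := fun _ => a) (fun x _ => by simpa using ((hasDerivAt_id x).const_mul a).hasDerivWithinAt)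
    (fun x _ y _ h => mul_left_cancel₀ ha.ne' h), abs_of_pos ha]
  simp only [smul_eq_mul, integral_const_mul]

theorem IsHomogeneousRate.measurable_triangle (hH : IsHomogeneousRate lam H) :
    Measurable fun p : {p : ℝ × ℝ | 0 < p.1 ∧ 0 < p.2 ∧ p.1 + p.2 ∈ (univ : Set ℝ)} =>
      H p.1.1 p.1.2 := by
  have h1 : Measurable fun p : {p : ℝ × ℝ | 0 < p.1 ∧ 0 < p.2 ∧ p.1 + p.2 ∈ (univ : Set ℝ)} =>
      ((⟨p.1.1, p.2.1⟩, ⟨p.1.2, p.2.2.1⟩) : Ioi (0 : ℝ) × Ioi (0 : ℝ)) :=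
    ((measurable_fst.comp measurable_subtype_coe).subtype_mk).prodMk
      ((measurable_snd.comp measurable_subtype_coe).subtype_mk)
  exact hH.measurable.comp h1

theorem IsHomogeneousRate.eq_rpow_mul (hH : IsHomogeneousRate lam H) {a u : ℝ} (ha : 0 < a)
    (hu : u ∈ Ioo (0 : ℝ) 1) : H (a * u) (a - a * u) = a ^ lam * H u (1 - u) := by
  rw [← hH.homogeneous a u (1 - u) ha hu.1 (sub_pos.2 hu.2), mul_sub, mul_one]

/-- Scaling by the total size reduces both bounds to the segment `(u, 1 - u)`. For coagulation `u =
x / (x + y)` and a power `(x + y) ^ lam` comes out. For fragmentation `y = x u`: one factor `x`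
comes from `dy`, and `x ^ (1 + lam)` from the kernel. -/
theorem isKernelPair_homogeneous {Hcoag Hfrag : ℝ → ℝ → ℝ} (hlam : 0 ≤ lam)
    (hc : IsHomogeneousRate lam Hcoag) (hcb : CoagBound Hcoag)
    (hf : IsHomogeneousRate lam Hfrag) (hfb : FragBound Hfrag) :
    IsKernelPair (restrictKernel univ (coagKernel Hcoag))
      (restrictKernel univ (fragKernel Hfrag)) where
  measurable_coag := measurable_restrictKernel MeasurableSet.univ <| by
    have h1 := hc.measurable_triangle
    unfold coagKernel
    exact ((measurable_fst.comp measurable_subtype_coe).mul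
      (measurable_snd.comp measurable_subtype_coe)).mul h1
  measurable_frag := measurable_restrictKernel MeasurableSet.univ <| by
    have h1 := hf.measurable_triangle
    unfold fragKernel
    exact ((measurable_fst.comp measurable_subtype_coe).add
      (measurable_snd.comp measurable_subtype_coe)).mul h1
  coag_nonneg := restrictKernel_nonneg fun x y hx hy _ =>
    mul_nonneg (mul_pos hx hy).le (hc.nonneg x y hx hy)
  frag_nonneg := restrictKernel_nonneg fun x y hx hy _ =>
    mul_nonneg (add_pos hx hy).le (hf.nonneg x y hx hy)
  coag_symm := restrictKernel_symm fun x y hx hy _ => by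
    rw [coagKernel, coagKernel, hc.symm x y hx hy, mul_comm x y]
  frag_symm := restrictKernel_symm fun x y hx hy _ => by
    rw [fragKernel, fragKernel, hf.symm x y hx hy, add_comm x y]
  coag_zero x y h := if_neg fun h' => h ⟨h'.1, h'.2.1⟩
  coag_le := by
    obtain ⟨C, hC⟩ := hcb.1
    refine ⟨max C 0, le_max_right _ _, ⌈1 + lam⌉₊, fun x y hx hy => ?_⟩
    rw [restrictKernel_of_mem hx hy (mem_univ _), coagKernel]
    have ha := add_pos hx hy
    have hu : x / (x + y) ∈ Ioo (0 : ℝ) 1 := ⟨by positivity, by rw [div_lt_one ha]; linarith⟩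
    have h1 := hc.eq_rpow_mul ha hu
    rw [mul_div_cancel₀ _ ha.ne', add_sub_cancel_left] at h1
    have h2 : Hcoag (x / (x + y)) (1 - x / (x + y)) ≤ max C 0 :=
      (hC ⟨_, hu, rfl⟩).trans (le_max_left _ _)
    have h3 : (x + y) ^ lam ≤ (1 + (x + y)) ^ ⌈1 + lam⌉₊ := by
      calc (x + y) ^ lam ≤ (1 + (x + y)) ^ lam := Real.rpow_le_rpow ha.le (by linarith) hlam
        _ ≤ (1 + (x + y)) ^ ((⌈1 + lam⌉₊ : ℕ) : ℝ) :=
          Real.rpow_le_rpow_of_exponent_le (by linarith)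
            ((by linarith : lam ≤ 1 + lam).trans (Nat.le_ceil _))
        _ = _ := Real.rpow_natCast _ _
    have h4 := hc.nonneg _ _ hu.1 (sub_pos.2 hu.2)
    rw [h1]
    calc x * y * ((x + y) ^ lam * Hcoag (x / (x + y)) (1 - x / (x + y)))
        ≤ x * y * ((1 + (x + y)) ^ ⌈1 + lam⌉₊ * max C 0) := by gcongr
      _ = _ := by ring
  frag_le := by
    refine ⟨∫ u in Ioo (0 : ℝ) 1, Hfrag u (1 - u), hfb.2.le, ⌈1 + lam⌉₊, fun x hx => ?_⟩
    rw [lintegral_Ioo_eq_mul hx]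
    have h1 : ∀ u ∈ Ioo (0 : ℝ) 1,
        ENNReal.ofReal (restrictKernel univ (fragKernel Hfrag) (x * u) (x - x * u))
          = ENNReal.ofReal (x ^ (1 + lam)) * ENNReal.ofReal (Hfrag u (1 - u)) := by
      intro u hu
      rw [restrictKernel_of_mem (mul_pos hx hu.1) (by nlinarith [hu.2]) (mem_univ _), fragKernel,
        hf.eq_rpow_mul hx hu, ← ENNReal.ofReal_mul (by positivity), Real.rpow_add hx, Real.rpow_one]
      congr 1
      ring
    have h0 : ∀ᵐ u ∂volume.restrict (Ioo (0 : ℝ) 1), 0 ≤ Hfrag u (1 - u) := by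
      filter_upwards [ae_restrict_mem measurableSet_Ioo] with u hu
      exact hf.nonneg _ _ hu.1 (sub_pos.2 hu.2)
    rw [setLIntegral_congr_fun measurableSet_Ioo h1,
      lintegral_const_mul' _ _ ENNReal.ofReal_ne_top,
      ← ofReal_integral_eq_lintegral_ofReal hfb.1 h0, ← ENNReal.ofReal_mul (by positivity),
      ← ENNReal.ofReal_mul hx.le]
    refine ENNReal.ofReal_le_ofReal ?_
    have h2 := rpow_one_add_le hlam hx.le
    have h3 := hfb.2.le
    calc _ ≤ x * ((1 + x) ^ ⌈1 + lam⌉₊ * ∫ u in Ioo (0 : ℝ) 1, Hfrag u (1 - u)) := by gcongr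
      _ = _ := by ring

end Homogeneous

/-! ### Bounded rates on sequences of mass one. -/

section Bounded

variable {Q : ℝ → ℝ → ℝ}

theorem IsBoundedRate.exists_bound (hQ : IsBoundedRate Q) :
    ∃ C, 0 ≤ C ∧ ∀ x y, 0 < x → 0 < y → x + y ∈ Iic (1 : ℝ) → Q x y ≤ C := by
  obtain ⟨C, hC⟩ := hQ.bounded
  exact ⟨max C 0, le_max_right _ _, fun x y hx hy hxy =>
    (hC x y ⟨hx, hy, hxy⟩).trans (le_max_left _ _)⟩

theorem isKernelPair_bounded {Qcoag Qfrag : ℝ → ℝ → ℝ} (hc : IsBoundedRate Qcoag)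
    (hf : IsBoundedRate Qfrag) :
    IsKernelPair (restrictKernel (Iic 1) (coagKernel Qcoag))
      (restrictKernel (Iic 1) (fragKernel Qfrag)) where
  measurable_coag := measurable_restrictKernel measurableSet_Iic <| by
    have h1 := hc.measurable
    unfold coagKernel
    exact ((measurable_fst.comp measurable_subtype_coe).mul
      (measurable_snd.comp measurable_subtype_coe)).mul h1
  measurable_frag := measurable_restrictKernel measurableSet_Iic <| by
    have h1 := hf.measurable
    unfold fragKernel
    exact ((measurable_fst.comp measurable_subtype_coe).add
      (measurable_snd.comp measurable_subtype_coe)).mul h1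
  coag_nonneg := restrictKernel_nonneg fun x y hx hy hxy =>
    mul_nonneg (mul_pos hx hy).le (hc.nonneg x y ⟨hx, hy, hxy⟩)
  frag_nonneg := restrictKernel_nonneg fun x y hx hy hxy =>
    mul_nonneg (add_pos hx hy).le (hf.nonneg x y ⟨hx, hy, hxy⟩)
  coag_symm := restrictKernel_symm fun x y hx hy hxy => by
    rw [coagKernel, coagKernel, hc.symm x y ⟨hx, hy, hxy⟩, mul_comm x y]
  frag_symm := restrictKernel_symm fun x y hx hy hxy => by
    rw [fragKernel, fragKernel, hf.symm x y ⟨hx, hy, hxy⟩, add_comm x y]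
  coag_zero x y h := if_neg fun h' => h ⟨h'.1, h'.2.1⟩
  coag_le := by
    obtain ⟨C, hC, h⟩ := hc.exists_bound
    refine ⟨C, hC, 0, fun x y hx hy => ?_⟩
    unfold restrictKernel
    split_ifs with hxy
    · have := h x y hx hy hxy.2.2
      rw [coagKernel, pow_zero, mul_one, mul_comm C]
      gcongr
    · positivity
  frag_le := by
    obtain ⟨C, hC, h⟩ := hf.exists_bound
    -- The kernel is at most `C x` on an interval of length `x`, so the integral is at most `C x²`;
    -- this is where the exponent `1` comes from.
    refine ⟨C, hC, 1, fun x hx => ?_⟩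
    have h1 : ∀ y ∈ Ioo 0 x,
        ENNReal.ofReal (restrictKernel (Iic 1) (fragKernel Qfrag) y (x - y))
          ≤ ENNReal.ofReal (x * C) := by
      intro y hy
      refine ENNReal.ofReal_le_ofReal ?_
      unfold restrictKernel
      split_ifs with hxy
      · have := h _ _ hxy.1 hxy.2.1 hxy.2.2
        rw [fragKernel, add_sub_cancel]
        gcongr
      · positivity
    refine (setLIntegral_mono' measurableSet_Ioo h1).trans ?_
    rw [setLIntegral_const, Real.volume_Ioo, sub_zero, ← ENNReal.ofReal_mul (by positivity)]
    refine ENNReal.ofReal_le_ofReal ?_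
    have : 0 ≤ C * x := by positivity
    nlinarith

theorem generatorSharp_eq_coneGenerator (K F : ℝ → ℝ → ℝ) :
    generatorSharp K F = coneGenerator K F := by
  funext Φ x
  unfold generatorSharp coneGenerator
  congr 2
  refine tsum_congr fun i => ?_
  -- A zero entry contributes `0` on both sides; for a positive one the prefactor `x i` is the
  -- Jacobian of `y = u x i`.
  rcases (x.2.1.nonneg i).eq_or_lt with hi | hi
  · simp [← hi]
  · rw [integral_Ioo_eq_mul hi]
    congr 2
    funext u
    rw [sub_mul, one_mul, mul_comm u]

end Bounded

theorem containsPairSums_univ (I : Set ℝ) : ContainsPairSums I univ :=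
  ⟨MeasurableSet.univ, fun _ _ => mem_univ _, fun _ _ _ _ => mem_univ _⟩

/-- Entries are nonnegative with total `1`, so one entry, or two with distinct indices, add up to at
most `1`. -/
theorem containsPairSums_one : ContainsPairSums {1} (Iic 1) := by
  have h1 : ∀ z : OmegaOne, ∑' n, z.1 n = 1 := fun z => z.2.2
  refine ⟨measurableSet_Iic, fun z i => ?_, fun z i j hij => ?_⟩
  · exact (z.2.1.summable.le_tsum i fun j _ => z.2.1.nonneg j).trans_eq (h1 z)
  · rw [mem_Iic, ← Finset.sum_pair hij]
    exact (z.2.1.summable.sum_le_tsum _ fun j _ => z.2.1.nonneg j).trans_eq (h1 z)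

end CoagFrag

end
theorem theorem3p2 {S : Type*} {mS : MeasurableSpace S} (P : Measure S) [IsProbabilityMeasure P]
    (ℱ : Filtration ℝ≥0 mS) :
    (∀ (lam : ℝ) (Hcoag Hfrag : ℝ → ℝ → ℝ) (Z : ℝ≥0 → S → Omega), 0 ≤ lam →
      IsHomogeneousRate lam Hcoag → CoagBound Hcoag →
      IsHomogeneousRate lam Hfrag → FragBound Hfrag →
      IsGeneratedBy (generator (coagKernel Hcoag) (fragKernel Hfrag)) P ℱ Z →
      (∀ k : ℕ, Integrable (fun ω => mass (Z 0 ω) ^ k) P) →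
      Admissible lam (fun t k => correlationMeasure P (Z t) k) ∧
      SatisfiesWeakHierarchy (coagKernel Hcoag) (fragKernel Hfrag)
        (fun t k => correlationMeasure P (Z t) k)) ∧
    (∀ (Qcoag Qfrag : ℝ → ℝ → ℝ) (X : ℝ≥0 → S → OmegaOne),
      IsBoundedRate Qcoag → IsBoundedRate Qfrag →
      IsGeneratedBy (generatorSharp (coagKernel Qcoag) (fragKernel Qfrag)) P ℱ X →
      (∀ lam : ℝ, 0 ≤ lam → Admissible lam (fun t k => correlationMeasure P (X t) k)) ∧
      SatisfiesWeakHierarchy (coagKernel Qcoag) (fragKernel Qfrag)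
        (fun t k => correlationMeasure P (X t) k)) := by
  constructor
  · intro lam Hcoag Hfrag Z hlam hc hcb hf hfb hgen h0
    have h := admissible_and_weakHierarchy (containsPairSums_univ _)
      (isKernelPair_homogeneous hlam hc hcb hf hfb) hgen h0
    exact ⟨h.1 lam hlam, h.2⟩
  · intro Qcoag Qfrag X hc hf hgen
    rw [generatorSharp_eq_coneGenerator] at hgen
    refine admissible_and_weakHierarchy containsPairSums_one (isKernelPair_bounded hc hf) hgen
      fun k => ?_
    -- The mass is deterministic, so the moment condition is automatic.
    have h1 : ∀ z : OmegaOne, mass z = 1 := fun z => z.2.2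
    simp [h1]
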